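/- **Setting.** Let $d,m\ge 1$ be integers, $1<p<\infty$ and $p'=p/(p-1)$. "Cube" means a cube $Q\subset\mathbb R^d$ with sides parallel to the axes, and $⨍_Q=|Q|^{-1}\int_Q$. *Young functions.* A Young function is a continuous, convex, nondecreasing $A:[0,\infty)\to[0,\infty)$ with $A(0)=0$ and $A(t)\to\infty$ as $t\to\infty$. Its conjugate is $\overline A(t)=\sup_{s\ge0}(st-A(s))\in[0,\infty]$. For $1<q<\infty$, $\Phi\in B_q$ means $\int_c^\infty \frac{\Phi(t)}{t^q}\frac{dt}{t}<\infty$ for some $c>0$. For $g:Q\to[0,\infty]$ put $\|g\|_{A,Q}=\inf\{\lambda>0: ⨍_Q A(g/\lambda)\le1\}$, where $A(\infty)=\infty$; in $\|g(x,y)\|_{A_x,Q}$ the norm is taken in the variable $x$ with $y$ fixed. *Matrix weights.* An $m\times m$ matrix weight is a measurable function $W$ on $\mathbb R^d$ with values in the complex $m\times m$ matrices that is positive definite almost everywhere (no integrability is assumed). For $\vec f:\mathbb R^d\to\mathbb C^m$ put $\|\vec f\|_{L^p(W)}=\big(\int_{\mathbb R^d}|W^{1/p}(x)\vec f(x)|^p\,dx\big)^{1/p}$.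 *Calderón–Zygmund operators.* A CZO is a bounded linear operator $T$ on $L^2(\mathbb R^d;\mathbb C)$ for which there are a kernel $K(x,y)$ and constants $c$ and $0<\delta\le 1$ with $|K(x,y)|\le c|x-y|^{-d}$ for $x\ne y$, with $$|K(x,y)-K(x',y)|+|K(y,x)-K(y,x')|\le c\,\frac{|x-x'|^\delta}{|x-y|^{d+\delta}}\qquad\text{whenever } x\ne y,\ |x-x'|\le\tfrac12|x-y|,$$ and with $Tf(x)=\int K(x,y)f(y)\,dy$ for a.e. $x\notin\operatorname{supp}f$, for every compactly supported $f\in L^2$. On $L^1(\mathbb R^d)$, $Tf$ denotes the limit in measure of $T\varphi_n$ for $\varphi_n\in L^1\cap L^2$ with $\varphi_n\to f$ in $L^1$. $T\otimes\mathbf I_m$ acts on $\mathbb C^m$-valued functions by applying $T$ to each component. *Commutator.* For a locally integrable $m\times m$ matrix function $B$, $[M_B,T\otimes\mathbf I_m]\vec f=B\,(T\otimes\mathbf I_m)\vec f-(T\otimes\mathbf I_m)(B\vec f)$, initially defined for the $\vec f\in L^p(U)$ with $\vec f\in L^1$ and $B\vec f\in L^1$. The norm $\|[M_B,T\otimes\mathbf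 I_m]\|_{L^p(U)\to L^p(V)}\in[0,\infty]$ is the least $c$ with $\|[M_B,T\otimes\mathbf I_m]\vec f\|_{L^p(V)}\le c\,\|\vec f\|_{L^p(U)}$ for all these $\vec f$. **Proposition 1.6.** Let $T$ be a CZO and let $C$, $D$ be Young functions with $\overline C\in B_{p'}$ and $\overline D\in B_p$. There is a constant $K<\infty$, depending only on $d,m,p,T,C,D$, such that for all $m\times m$ matrix weights $U,V$ and every locally integrable $m\times m$ matrix function $B$ the following hold. The initial domain above is dense in $L^p(U)$, the commutator is well defined on it (the defining limits in measure exist and do not depend, up to null sets, on the choices), and $$\|[M_B,T\otimes\mathbf I_m]\|_{L^p(U)\to L^p(V)}\le K\,\min\{\kappa_1,\kappa_2\},$$ where, with suprema over all cubes $Q$ and $\|\cdot\|$ the operator norm of matrices, $$\kappa_1=\sup_Q\Big\|\big\|\,\|V^{1/p}(x)(B(x)-B(y))U^{-1/p}(y)\|\,\big\|_{C_x,Q}\Big\|_{D_y,Q},$$ $$\kappa_2=\sup_Q\Big\|\big\|\,\|V^{1/p}(x)(B(x)-B(y))U^{-1/p}(y)\|\,\big\|_{D_y,Q}\Big\|_{C_x,Q}.$$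 -/

import Mathlib

open MeasureTheory Filter Topology
open scoped NNReal ENNReal ComplexOrder

noncomputable section

namespace OrliczCommutator

/-! ### Young functions, conjugates, the classes `B_p`, normalized Luxemburg norms -/

/-- Young functions `[0,∞) → [0,∞)`: continuous, convex, nondecreasing, vanishing at `0` and
tending to `∞` at `∞`. -/
structure IsYoung (A : ℝ≥0 → ℝ≥0) : Prop where
  continuous : Continuous A
  convex : ConvexOn ℝ≥0 Set.univ A
  monotone : Monotone A
  map_zero : A 0 = 0
  tendsto : Tendsto A atTop atTop

/-- The conjugate function `Ā(t) = sup_{s ≥ 0} (s t - A(s))`, with values in `[0,∞]`.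
Since `s = 0` contributes `0`, truncating the subtraction at `0` does not change the supremum. -/
def conj (A : ℝ≥0 → ℝ≥0) (t : ℝ≥0) : ℝ≥0∞ :=
  ⨆ s : ℝ≥0, ((s * t : ℝ≥0) : ℝ≥0∞) - (A s : ℝ≥0∞)

/-- The condition `Φ ∈ B_q`: `∫_c^∞ Φ(t) / t^q dt/t < ∞` for some `c > 0`. -/
def MemB (Φ : ℝ≥0 → ℝ≥0∞) (q : ℝ) : Prop :=
  ∃ c : ℝ, 0 < c ∧
    ∫⁻ t in Set.Ioi c, Φ t.toNNReal / ENNReal.ofReal (t ^ q) / ENNReal.ofReal t < ⊤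

/-- Extension of a Young function to `[0,∞]` by `A(∞) = ∞`. -/
def ext (A : ℝ≥0 → ℝ≥0) (t : ℝ≥0∞) : ℝ≥0∞ :=
  if t = ⊤ then ⊤ else (A t.toNNReal : ℝ≥0∞)

/-- `ℝ^d`. -/
abbrev Rd (d : ℕ) := EuclideanSpace ℝ (Fin d)

/-- `ℂ^m` with its Hermitian norm. -/
abbrev Cm (m : ℕ) := EuclideanSpace ℂ (Fin m)

/-- Complex `m × m` matrices. -/
abbrev Mat (m : ℕ) := Matrix (Fin m) (Fin m) ℂ

/-- The cube with corner `a`, side length `ℓ` and sides parallel to the axes. -/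
def cube {d : ℕ} (a : Rd d) (ℓ : ℝ) : Set (Rd d) :=
  {x | ∀ i, x i ∈ Set.Ico (a i) (a i + ℓ)}

/-- The normalized Luxemburg norm
`‖g‖_{A,Q} = inf {λ > 0 : ⨍_Q A(g / λ) ≤ 1}` of a `[0,∞]`-valued function. -/
def luxNorm {d : ℕ} (A : ℝ≥0 → ℝ≥0) (Q : Set (Rd d)) (g : Rd d → ℝ≥0∞) : ℝ≥0∞ :=
  ⨅ (l : ℝ≥0) (_ : 0 < l) (_ : ⨍⁻ x in Q, ext A (g x / l) ∂volume ≤ 1), (l : ℝ≥0∞)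

/-! ### Matrix weights -/

/-- Action of a matrix on the Hermitian space `ℂ^m`. -/
abbrev act {m : ℕ} (A : Mat m) : Cm m →L[ℂ] Cm m :=
  Matrix.toEuclideanCLM (n := Fin m) (𝕜 := ℂ) A

/-- The real power `A^r` of a positive definite matrix, through the functional calculus. -/
def mpow {m : ℕ} (A : Mat m) (r : ℝ) : Mat m := cfc (fun t : ℝ => t ^ r) A

/-- A matrix weight: a measurable, a.e. positive definite matrix function (no integrability). -/
structure IsMatrixWeight {d m : ℕ} (W : Rd d → Mat m) : Prop where
  aemeasurable : ∀ i j, AEMeasurable (fun x => W x i j) volume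
  posDef : ∀ᵐ x ∂(volume : Measure (Rd d)), (W x).PosDef

/-- `W^{1/p} f`. -/
def weighted {d m : ℕ} (p : ℝ) (W : Rd d → Mat m) (f : Rd d → Cm m) : Rd d → Cm m :=
  fun x => act (mpow (W x) (1 / p)) (f x)

/-- `‖f‖_{L^p(W)} = (∫ |W^{1/p} f|^p)^{1/p}`. -/
def wNorm {d m : ℕ} (p : ℝ) (W : Rd d → Mat m) (f : Rd d → Cm m) : ℝ≥0∞ :=
  eLpNorm (weighted p W f) (ENNReal.ofReal p) volume

/-! ### Calderón–Zygmund operators -/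

/-- A bounded operator on `L²(ℝ^d)` is a Calderón–Zygmund operator if it is associated with a
standard kernel, that is a kernel with the size estimate and the Hölder estimates in both
variables. -/
def IsCZO {d : ℕ} (T : Lp ℂ 2 (volume : Measure (Rd d)) →L[ℂ] Lp ℂ 2 (volume : Measure (Rd d))) :
    Prop :=
  ∃ (K : Rd d → Rd d → ℂ) (c δ : ℝ), 0 < δ ∧ δ ≤ 1 ∧
    (∀ x y, x ≠ y → ‖K x y‖ ≤ c / ‖x - y‖ ^ (d : ℝ)) ∧
    (∀ x x' y, x ≠ y → ‖x - x'‖ ≤ ‖x - y‖ / 2 →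
      ‖K x y - K x' y‖ + ‖K y x - K y x'‖ ≤ c * ‖x - x'‖ ^ δ / ‖x - y‖ ^ ((d : ℝ) + δ)) ∧
    ∀ (f : Rd d → ℂ) (hf : MemLp f 2 volume), HasCompactSupport f →
      ∀ᵐ x ∂(volume : Measure (Rd d)), x ∉ tsupport f →
        T (hf.toLp f) x = ∫ y, K x y * f y

/-- `g` is a value at `f ∈ L¹` of the canonical extension of `T` to `L¹`: there are
`φ_n ∈ L¹ ∩ L²` with `φ_n → f` in `L¹` and `T φ_n → g` in measure. -/
def IsValue {d : ℕ}
    (T : Lp ℂ 2 (volume : Measure (Rd d)) →L[ℂ] Lp ℂ 2 (volume : Measure (Rd d)))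
    (f g : Rd d → ℂ) : Prop :=
  ∃ φ : ℕ → Lp ℂ 2 (volume : Measure (Rd d)),
    (∀ n, Integrable (φ n) volume) ∧
    Tendsto (fun n => eLpNorm (fun x => φ n x - f x) 1 volume) atTop (𝓝 0) ∧
    TendstoInMeasure volume (fun n x => T (φ n) x) atTop g

/-- `g` is a value of `(T ⊗ I_m) f`: `T` acts on each component. -/
def IsTensorValue {d m : ℕ}
    (T : Lp ℂ 2 (volume : Measure (Rd d)) →L[ℂ] Lp ℂ 2 (volume : Measure (Rd d)))
    (f g : Rd d → Cm m) : Prop :=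
  ∀ i, IsValue T (fun x => f x i) (fun x => g x i)

/-! ### The commutator -/

/-- `M_B f`. -/
def mul {d m : ℕ} (B : Rd d → Mat m) (f : Rd d → Cm m) : Rd d → Cm m :=
  fun x => act (B x) (f x)

/-- `h` is a value of `[M_B, T ⊗ I_m] f = B (T ⊗ I_m) f - (T ⊗ I_m) (B f)`. -/
def IsCommutatorValue {d m : ℕ}
    (T : Lp ℂ 2 (volume : Measure (Rd d)) →L[ℂ] Lp ℂ 2 (volume : Measure (Rd d)))
    (B : Rd d → Mat m) (f h : Rd d → Cm m) : Prop :=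
  ∃ u v : Rd d → Cm m, IsTensorValue T f u ∧ IsTensorValue T (mul B f) v ∧
    h =ᵐ[volume] fun x => mul B u x - v x

/-- The initial domain of the commutator in `L^p(U)`: the `f ∈ L^p(U)` with `f, B f ∈ L¹`
(for locally integrable `B` it contains all bounded `f ∈ L^p(U)` of compact support). -/
def commDomain {d m : ℕ} (p : ℝ) (U B : Rd d → Mat m) : Set (Rd d → Cm m) :=
  {f | MemLp (weighted p U f) (ENNReal.ofReal p) volume ∧ Integrable f volume ∧
    Integrable (mul B f) volume}

/-- The operator norm `‖[M_B, T ⊗ I_m]‖_{L^p(U) → L^p(V)}` (possibly infinite). -/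
def commNorm {d m : ℕ} (p : ℝ)
    (T : Lp ℂ 2 (volume : Measure (Rd d)) →L[ℂ] Lp ℂ 2 (volume : Measure (Rd d)))
    (U V B : Rd d → Mat m) : ℝ≥0∞ :=
  sInf {c : ℝ≥0∞ | ∀ f ∈ commDomain p U B, ∀ h, IsCommutatorValue T B f h →
    wNorm p V h ≤ c * wNorm p U f}

/-! ### The two bump conditions -/

/-- `‖V^{1/p}(x) (B(x) - B(y)) U^{-1/p}(y)‖` (operator norm). -/
def oscKernel {d m : ℕ} (p : ℝ) (U V B : Rd d → Mat m) (x y : Rd d) : ℝ≥0∞ :=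
  ‖act (mpow (V x) (1 / p) * (B x - B y) * mpow (U y) (-(1 / p)))‖ₑ

/-- `κ₁`: the norm `C` in `x` inside, the norm `D` in `y` outside. -/
def kappa₁ {d m : ℕ} (p : ℝ) (C D : ℝ≥0 → ℝ≥0) (U V B : Rd d → Mat m) : ℝ≥0∞ :=
  ⨆ (a : Rd d) (ℓ : ℝ) (_ : 0 < ℓ),
    luxNorm D (cube a ℓ) fun y => luxNorm C (cube a ℓ) fun x => oscKernel p U V B x y

/-- `κ₂`: the norm `D` in `y` inside, the norm `C` in `x` outside. -/
def kappa₂ {d m : ℕ} (p : ℝ) (C D : ℝ≥0 → ℝ≥0) (U V B : Rd d → Mat m) : ℝ≥0∞ :=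
  ⨆ (a : Rd d) (ℓ : ℝ) (_ : 0 < ℓ),
    luxNorm C (cube a ℓ) fun x => luxNorm D (cube a ℓ) fun y => oscKernel p U V B x y

end OrliczCommutator

end

/-! The commutator is read as one vector-valued singular integral. Put F = (f, Bf), with values in
ℂ^{2m}, and let w_i(x) be the i-th row of (V^{1/p}(x)B(x), -V^{1/p}(x)). Then the i-th entry of
V^{1/p}[M_B, T ⊗ I]f at x is w_i(x)·TF(x), while w_i(x)·F(y) is the i-th entry of
V^{1/p}(x)(B(x)-B(y))f(y), hence at most the oscillation kernel times |U^{1/p}f(y)|. So |w·TF(x)|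
has to be dominated by averages of |w·F|, for all covectors w at once, because w will depend on x.

This is a convex-body sparse domination. On a dyadic cube Q an Auerbach basis of the functions w·F
in L¹(3Q) reduces all w to finitely many scalar functions (`exists_auerbach_functions`). The weak
type (1,1) inequalities for T (`HasKernel.hasWeakType`) and for the maximal function
(`maximal_weak_type`) then give stopping cubes S filling at most half of Q. Off them |w·T(F 1_{3Q})|
is controlled by the average of |w·F| over 3Q, and on each S replacing 3Q by 3S costs no more than
that (`exists_sparse_step`). Iteration is done directly on the form paired with a function g
(`exists_sparse_form_bound`): if the averaged form on every cube is at most N(x) at every point x of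
the cube, the pairing is at most a constant times ∫ N, because half of every cube is left free by
the next generation. No sparse family is recorded.

With h = |U^{1/p}f|, two applications of Hölder's inequality in Orlicz spaces bound the averaged
form by κ times the Luxemburg norms of h for the conjugate of D and of g for the conjugate of C, in
either order of the mixed norm. Thus N can be a multiple of κ times a product of two Orlicz maximal
functions. These are bounded on L^p and L^{p'} by Pérez's theorem (`exists_maxFn_bound`), and
ordinary Hölder and duality (`lintegral_rpow_le_of_dual`) finish the estimate.

The weak type inequality also defines T on L¹, which makes the commutator well defined. The bilinear
bound passes from truncations in L² to F in L¹ by convergence in measure, an almost everywhere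
convergent subsequence and Fatou's lemma (`exists_bilinear_bound_of_isValue`). -/

noncomputable section

namespace OrliczCommutator

/-! ### Dyadic cubes -/

/-- The index of the dyadic cube of side `2^k` containing `x`. -/
def dyadicIdx {d : ℕ} (k : ℤ) (x : Rd d) : Fin d → ℤ := fun i => ⌊x i / (2 : ℝ) ^ k⌋

/-- The dyadic cube of side `2^k` with index `n`. -/
def dyadicCube {d : ℕ} (k : ℤ) (n : Fin d → ℤ) : Set (Rd d) := {x | dyadicIdx k x = n}

/-- The concentric threefold dilate of a dyadic cube. -/
def tripleCube {d : ℕ} (k : ℤ) (n : Fin d → ℤ) : Set (Rd d) :=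
  {x | ∀ i, |dyadicIdx k x i - n i| ≤ 1}

/-- Integer halving of the index encodes passage to the parent cube. Nesting of dyadic cubes, and of
their triples, becomes integer arithmetic: halving keeps indices that differ by at most one within
one of each other. -/
theorem dyadicIdx_add_one {d : ℕ} (k : ℤ) (x : Rd d) (i : Fin d) :
    dyadicIdx (k + 1) x i = dyadicIdx k x i / 2 := by
  unfold dyadicIdx
  have := Int.floor_div_natCast (x i / (2 : ℝ) ^ k) 2
  rw [zpow_add₀ (by norm_num), zpow_one, ← div_div]
  exact_mod_cast this

theorem dyadicIdx_eq_of_le {d : ℕ} {k k' : ℤ} (hk : k ≤ k') {x y : Rd d}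
    (h : dyadicIdx k x = dyadicIdx k y) : dyadicIdx k' x = dyadicIdx k' y := by
  induction k', hk using Int.leInduction with
  | base => exact h
  | succ k' _ ih => ext i; rw [dyadicIdx_add_one, dyadicIdx_add_one, ih]

theorem mem_tripleCube_of_le {d : ℕ} {k k' : ℤ} (hk : k ≤ k') {x y : Rd d}
    (h : y ∈ tripleCube k (dyadicIdx k x)) : y ∈ tripleCube k' (dyadicIdx k' x) := by
  induction k', hk using Int.leInduction with
  | base => exact h
  | succ k' _ ih =>
    intro i
    have := ih i
    rw [dyadicIdx_add_one, dyadicIdx_add_one]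
    rw [abs_le] at *
    omega

theorem mem_dyadicCube_self {d : ℕ} (k : ℤ) (x : Rd d) : x ∈ dyadicCube k (dyadicIdx k x) := rfl

theorem dyadicCube_subset_tripleCube {d : ℕ} (k : ℤ) (n : Fin d → ℤ) :
    dyadicCube k n ⊆ tripleCube k n := by
  rintro x rfl i; simp

theorem dyadicIdx_eq_iff {d : ℕ} (k : ℤ) (x : Rd d) (i : Fin d) (z : ℤ) :
    dyadicIdx k x i = z ↔ z * (2 : ℝ) ^ k ≤ x i ∧ x i < (z + 1) * (2 : ℝ) ^ k := by
  have : (0 : ℝ) < 2 ^ k := by positivity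
  unfold dyadicIdx
  rw [Int.floor_eq_iff, le_div_iff₀ this, div_lt_iff₀ this]

theorem dyadicIdx_mem_iff {d : ℕ} (k : ℤ) (x : Rd d) (i : Fin d) (z : ℤ) :
    |dyadicIdx k x i - z| ≤ 1 ↔ (z - 1) * (2 : ℝ) ^ k ≤ x i ∧ x i < (z + 2) * (2 : ℝ) ^ k := by
  have h0 : (0 : ℝ) < 2 ^ k := by positivity
  have h1 : z - 1 ≤ dyadicIdx k x i ↔ (z - 1) * (2 : ℝ) ^ k ≤ x i := by
    unfold dyadicIdx
    rw [Int.le_floor, le_div_iff₀ h0]; push_cast; rfl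
  have h2 : dyadicIdx k x i < z + 2 ↔ x i < (z + 2) * (2 : ℝ) ^ k := by
    unfold dyadicIdx
    rw [Int.floor_lt, div_lt_iff₀ h0]; push_cast; rfl
  rw [← h1, ← h2, abs_le]
  omega

theorem dyadicCube_eq_cube {d : ℕ} (k : ℤ) (n : Fin d → ℤ) :
    dyadicCube k n = cube (WithLp.toLp 2 fun i => (n i : ℝ) * 2 ^ k) (2 ^ k) := by
  ext x
  simp only [dyadicCube, cube, Set.mem_ofPred_eq, Set.mem_Ico, funext_iff, dyadicIdx_eq_iff]
  simp only [add_mul, one_mul]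

theorem tripleCube_eq_cube {d : ℕ} (k : ℤ) (n : Fin d → ℤ) :
    tripleCube k n = cube (WithLp.toLp 2 fun i => ((n i : ℝ) - 1) * 2 ^ k) (3 * 2 ^ k) := by
  ext x
  simp only [tripleCube, cube, Set.mem_ofPred_eq, Set.mem_Ico, dyadicIdx_mem_iff]
  refine forall_congr' fun i => ?_
  rw [show ((n i : ℝ) + 2) * 2 ^ k = ((n i : ℝ) - 1) * 2 ^ k + 3 * 2 ^ k by ring]

theorem cube_eq_preimage {d : ℕ} (a : Rd d) (l : ℝ) :
    cube a l = (MeasurableEquiv.toLp 2 (Fin d → ℝ)).symm ⁻¹'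
      (Set.univ.pi fun i => Set.Ico (a i) (a i + l)) := by
  ext x; simp [cube]

theorem measurableSet_cube {d : ℕ} (a : Rd d) (l : ℝ) : MeasurableSet (cube a l) := by
  rw [cube_eq_preimage]
  exact (MeasurableEquiv.toLp 2 (Fin d → ℝ)).symm.measurable
    (MeasurableSet.univ_pi fun i => measurableSet_Ico)

theorem volume_cube {d : ℕ} (a : Rd d) (l : ℝ) : volume (cube a l) = ENNReal.ofReal l ^ d := by
  rw [cube_eq_preimage, (EuclideanSpace.volume_preserving_symm_measurableEquiv_toLp
    (Fin d)).measure_preimage_equiv, Real.volume_pi_Ico]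
  simp

theorem measurableSet_dyadicCube {d : ℕ} (k : ℤ) (n : Fin d → ℤ) :
    MeasurableSet (dyadicCube k n) := by
  rw [dyadicCube_eq_cube]; exact measurableSet_cube _ _

theorem measurableSet_tripleCube {d : ℕ} (k : ℤ) (n : Fin d → ℤ) :
    MeasurableSet (tripleCube k n) := by
  rw [tripleCube_eq_cube]; exact measurableSet_cube _ _

theorem volume_dyadicCube {d : ℕ} (k : ℤ) (n : Fin d → ℤ) :
    volume (dyadicCube k n) = ENNReal.ofReal (2 ^ k) ^ d := by
  rw [dyadicCube_eq_cube, volume_cube]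

theorem volume_tripleCube {d : ℕ} (k : ℤ) (n : Fin d → ℤ) :
    volume (tripleCube k n) = 3 ^ d * volume (dyadicCube k n) := by
  rw [tripleCube_eq_cube, volume_cube, volume_dyadicCube, ENNReal.ofReal_mul (by norm_num), mul_pow]
  simp

theorem volume_dyadicCube_pos {d : ℕ} (k : ℤ) (n : Fin d → ℤ) :
    0 < volume (dyadicCube k n) := by
  rw [volume_dyadicCube]
  exact ENNReal.pow_pos (ENNReal.ofReal_pos.2 (by positivity)) _

theorem volume_dyadicCube_lt_top {d : ℕ} (k : ℤ) (n : Fin d → ℤ) :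
    volume (dyadicCube k n) < ⊤ := by
  rw [volume_dyadicCube]
  exact ENNReal.pow_lt_top ENNReal.ofReal_lt_top

theorem volume_tripleCube_pos {d : ℕ} (k : ℤ) (n : Fin d → ℤ) :
    0 < volume (tripleCube k n) :=
  (volume_dyadicCube_pos k n).trans_le (measure_mono (dyadicCube_subset_tripleCube k n))

theorem volume_tripleCube_lt_top {d : ℕ} (k : ℤ) (n : Fin d → ℤ) :
    volume (tripleCube k n) < ⊤ := by
  rw [volume_tripleCube]
  exact ENNReal.mul_lt_top (ENNReal.pow_lt_top (by simp)) (volume_dyadicCube_lt_top k n)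

theorem volume_dyadicCube_add_one {d : ℕ} (k : ℤ) (n n' : Fin d → ℤ) :
    volume (dyadicCube (k + 1) n) = 2 ^ d * volume (dyadicCube k n') := by
  rw [volume_dyadicCube, volume_dyadicCube, zpow_add₀ (by norm_num), zpow_one, mul_comm,
    ENNReal.ofReal_mul (by norm_num), mul_pow]
  simp

theorem measurable_dyadicIdx {d : ℕ} (k : ℤ) : Measurable (dyadicIdx k : Rd d → Fin d → ℤ) := by
  refine measurable_to_countable' fun n => ?_
  exact measurableSet_dyadicCube k n

theorem dyadicCube_subset_of_mem {d : ℕ} {k k' : ℤ} (hk : k ≤ k') {n n' : Fin d → ℤ} {x : Rd d}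
    (hx : x ∈ dyadicCube k n) (hx' : x ∈ dyadicCube k' n') :
    dyadicCube k n ⊆ dyadicCube k' n' := by
  rintro y hy
  exact (dyadicIdx_eq_of_le hk (hy.trans hx.symm)).trans hx'

theorem tripleCube_subset_of_mem {d : ℕ} {k k' : ℤ} (hk : k ≤ k') {n n' : Fin d → ℤ} {x : Rd d}
    (hx : x ∈ dyadicCube k n) (hx' : x ∈ dyadicCube k' n') :
    tripleCube k n ⊆ tripleCube k' n' := by
  obtain rfl : dyadicIdx k x = n := hx
  obtain rfl : dyadicIdx k' x = n' := hx'
  exact fun y hy => mem_tripleCube_of_le hk hy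

theorem le_norm_of_notMem_tripleCube {d : ℕ} {k : ℤ} {x y : Rd d}
    (h : y ∉ tripleCube k (dyadicIdx k x)) : (2 : ℝ) ^ k ≤ ‖x - y‖ := by
  simp only [tripleCube, Set.mem_ofPred_eq, not_forall] at h
  obtain ⟨i, hi⟩ := h
  refine le_trans ?_ (PiLp.norm_apply_le (x - y) i)
  rw [dyadicIdx_mem_iff] at hi
  obtain ⟨h1, h2⟩ := (dyadicIdx_eq_iff k x i _).1 rfl
  rw [Real.norm_eq_abs, PiLp.sub_apply, le_abs]
  by_contra! h
  apply hi
  constructor <;> linarith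

theorem norm_sub_le_of_mem_dyadicCube {d : ℕ} {k : ℤ} {n : Fin d → ℤ} {x y : Rd d}
    (hx : x ∈ dyadicCube k n) (hy : y ∈ dyadicCube k n) : ‖x - y‖ ≤ d * (2 : ℝ) ^ k := by
  have h : ∀ i, ‖(x - y) i‖ ≤ (2 : ℝ) ^ k := by
    intro i
    obtain ⟨h1, h2⟩ := (dyadicIdx_eq_iff k x i _).1 (congrFun hx i)
    obtain ⟨h3, h4⟩ := (dyadicIdx_eq_iff k y i _).1 (congrFun hy i)
    rw [Real.norm_eq_abs, PiLp.sub_apply, abs_le]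
    constructor <;> linarith
  have h0 : (0 : ℝ) < 2 ^ k := by positivity
  rw [EuclideanSpace.norm_eq]
  apply Real.sqrt_le_iff.2
  refine ⟨by positivity, ?_⟩
  calc ∑ i, ‖(x - y) i‖ ^ 2 ≤ ∑ _i : Fin d, ((2 : ℝ) ^ k) ^ 2 := by gcongr with i; exact h i
    _ = d * ((2 : ℝ) ^ k) ^ 2 := by simp
    _ ≤ (d * (2 : ℝ) ^ k) ^ 2 := by
      rw [mul_pow]; gcongr
      exact_mod_cast Nat.le_self_pow two_ne_zero d

/-- Dyadic cubes never cross the coordinate hyperplanes, so the cubes around `x` need not ever reach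
`y`. Their triples do, once the indices of both points lie in {-1, 0}. -/
theorem exists_mem_tripleCube {d : ℕ} (x y : Rd d) :
    ∃ k₀ : ℤ, ∀ k, k₀ ≤ k → y ∈ tripleCube k (dyadicIdx k x) := by
  obtain ⟨N, hN⟩ := pow_unbounded_of_one_lt (‖x‖ + ‖y‖) (one_lt_two : (1 : ℝ) < 2)
  refine ⟨N, fun k hk => mem_tripleCube_of_le hk fun i => ?_⟩
  have key : ∀ z : Rd d, ‖z‖ < 2 ^ N → -1 ≤ dyadicIdx N z i ∧ dyadicIdx N z i ≤ 0 := by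
    intro z hz
    have h0 : (0 : ℝ) < 2 ^ N := by positivity
    have hzi := (PiLp.norm_apply_le z i).trans_lt hz
    rw [Real.norm_eq_abs, abs_lt] at hzi
    unfold dyadicIdx
    rw [zpow_natCast]
    constructor
    · rw [Int.le_floor, le_div_iff₀ h0]; push_cast; linarith
    · rw [← Int.lt_add_one_iff, Int.floor_lt, div_lt_iff₀ h0]; push_cast; linarith
  have h1 := key x (by linarith [norm_nonneg y])
  have h2 := key y (by linarith [norm_nonneg x])
  rw [abs_le]; omega

theorem closure_cube_subset {d : ℕ} (a : Rd d) (l : ℝ) :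
    closure (cube a l) ⊆ {x | ∀ i, x i ∈ Set.Icc (a i) (a i + l)} := by
  apply closure_minimal
  · exact fun x hx i => Set.Ico_subset_Icc_self (hx i)
  · simp only [Set.ofPred_forall]
    refine isClosed_iInter fun i => ?_
    exact isClosed_Icc.preimage (by fun_prop)

theorem closure_dyadicCube_subset {d : ℕ} (k : ℤ) (n : Fin d → ℤ) :
    closure (dyadicCube k n) ⊆ tripleCube k n := by
  rw [dyadicCube_eq_cube, tripleCube_eq_cube]
  refine (closure_cube_subset _ _).trans fun x hx i => ?_
  have h0 : (0 : ℝ) < 2 ^ k := by positivity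
  have := hx i
  simp only [Set.mem_Icc, Set.mem_Ico] at *
  constructor <;> nlinarith

theorem tripleCube_mem_nhds {d : ℕ} {k : ℤ} {n : Fin d → ℤ} {x : Rd d}
    (hx : x ∈ dyadicCube k n) : tripleCube k n ∈ 𝓝 x := by
  rw [dyadicCube_eq_cube] at hx
  rw [tripleCube_eq_cube]
  have h0 : (0 : ℝ) < 2 ^ k := by positivity
  have ho : IsOpen {y : Rd d | ∀ i, y i ∈ Set.Ioo (((n i : ℝ) - 1) * 2 ^ k)
      (((n i : ℝ) - 1) * 2 ^ k + 3 * 2 ^ k)} := by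
    simp only [Set.ofPred_forall]
    refine isOpen_iInter_of_finite fun i => ?_
    exact isOpen_Ioo.preimage (by fun_prop)
  refine mem_of_superset (ho.mem_nhds fun i => ?_) fun y hy i => Set.Ioo_subset_Ico_self (hy i)
  have := hx i
  simp only [Set.mem_Ioo, Set.mem_Ico] at *
  constructor <;> nlinarith

theorem isBounded_cube {d : ℕ} (a : Rd d) (l : ℝ) : Bornology.IsBounded (cube a l) := by
  refine (Metric.isBounded_closedBall (x := a) (r := d * |l|)).subset fun x hx => ?_
  rw [mem_closedBall_iff_norm, EuclideanSpace.norm_eq]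
  refine Real.sqrt_le_iff.2 ⟨by positivity, ?_⟩
  have h : ∀ i, ‖(x - a) i‖ ≤ |l| := by
    intro i
    have := hx i
    rw [Set.mem_Ico] at this
    rw [Real.norm_eq_abs, PiLp.sub_apply]
    apply abs_le_abs <;> linarith
  calc ∑ i, ‖(x - a) i‖ ^ 2 ≤ ∑ _i : Fin d, |l| ^ 2 := by gcongr with i; exact h i
    _ = d * |l| ^ 2 := by simp
    _ ≤ (d * |l|) ^ 2 := by
      rw [mul_pow]; gcongr
      exact_mod_cast Nat.le_self_pow two_ne_zero d

theorem isBounded_tripleCube {d : ℕ} (k : ℤ) (n : Fin d → ℤ) :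
    Bornology.IsBounded (tripleCube k n) := by
  rw [tripleCube_eq_cube]; exact isBounded_cube _ _

theorem isBounded_dyadicCube {d : ℕ} (k : ℤ) (n : Fin d → ℤ) :
    Bornology.IsBounded (dyadicCube k n) :=
  (isBounded_tripleCube k n).subset (dyadicCube_subset_tripleCube k n)

theorem exists_mem_dyadicCube {d : ℕ} (k : ℤ) (n : Fin d → ℤ) : (dyadicCube k n).Nonempty :=
  nonempty_of_measure_ne_zero (volume_dyadicCube_pos k n).ne'

/-! ### Stopping cubes -/

/-- A family of dyadic cubes. -/
abbrev CubeFamily (d : ℕ) := Set (ℤ × (Fin d → ℤ))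

/-- The union of a family of dyadic cubes. -/
def CubeFamily.union {d : ℕ} (S : CubeFamily d) : Set (Rd d) := ⋃ s ∈ S, dyadicCube s.1 s.2

/-- The maximal cubes of a family of dyadic cubes whose sizes are bounded at every point. -/
theorem exists_maximal_subfamily {d : ℕ} (S : CubeFamily d)
    (hS : ∀ x : Rd d, ∃ k₀ : ℤ, ∀ k, k₀ ≤ k → (k, dyadicIdx k x) ∉ S) :
    ∃ M : CubeFamily d, M ⊆ S ∧ M.union = S.union ∧
      (M.PairwiseDisjoint fun s => dyadicCube s.1 s.2) ∧
      ∀ s ∈ M, ∀ x ∈ dyadicCube s.1 s.2, ∀ k, s.1 < k → (k, dyadicIdx k x) ∉ S := by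
  refine ⟨{s ∈ S | ∀ x ∈ dyadicCube s.1 s.2, ∀ k, s.1 < k → (k, dyadicIdx k x) ∉ S},
    fun s hs => hs.1, ?_, ?_, fun s hs => hs.2⟩
  · apply Set.Subset.antisymm
    · exact Set.biUnion_subset_biUnion_left fun s hs => hs.1
    · intro x hx
      simp only [CubeFamily.union, Set.mem_iUnion] at hx
      obtain ⟨⟨k, n⟩, hs, hx⟩ := hx
      obtain rfl : dyadicIdx k x = n := hx
      obtain ⟨k₀, hk₀⟩ := hS x
      obtain ⟨K, hK, hmax⟩ := Int.exists_greatest_of_bdd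
        (P := fun k => (k, dyadicIdx k x) ∈ S) ⟨k₀, fun z hz => by
          by_contra! h; exact hk₀ z h.le hz⟩ ⟨k, hs⟩
      simp only [CubeFamily.union, Set.mem_iUnion]
      refine ⟨(K, dyadicIdx K x), ⟨hK, fun y hy k' hk' h => ?_⟩, rfl⟩
      have : dyadicIdx k' y = dyadicIdx k' x := dyadicIdx_eq_of_le hk'.le hy
      rw [this] at h
      exact absurd (hmax k' h) (not_le.2 hk')
  · rintro ⟨k, n⟩ hs ⟨k', n'⟩ hs' hne
    rw [Function.onFun, Set.disjoint_left]
    intro x hx hx'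
    obtain rfl : dyadicIdx k x = n := hx
    obtain rfl : dyadicIdx k' x = n' := hx'
    rcases lt_trichotomy k k' with h | h | h
    · exact hs.2 x rfl k' h hs'.1
    · subst h; exact hne rfl
    · exact hs'.2 x rfl k h hs.1

theorem CubeFamily.measurableSet_union {d : ℕ} (S : CubeFamily d) : MeasurableSet S.union :=
  MeasurableSet.biUnion S.to_countable fun _ _ => measurableSet_dyadicCube _ _

/-- The dyadic maximal inequality with its stopping cubes: the maximal dyadic cubes on which the
average of `g` exceeds `c`. -/
theorem exists_stopping_cubes {d : ℕ} (hd : 0 < d) (g : Rd d → ℝ≥0∞) (hg : ∫⁻ x, g x < ⊤)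
    {c : ℝ≥0∞} (hc : 0 < c) :
    ∃ M : CubeFamily d, (M.PairwiseDisjoint fun s => dyadicCube s.1 s.2) ∧
      (∀ s ∈ M, c * volume (dyadicCube s.1 s.2) < ∫⁻ x in dyadicCube s.1 s.2, g x) ∧
      (∀ s ∈ M, ∀ x ∈ dyadicCube s.1 s.2, ∀ k, s.1 < k →
        ∫⁻ x in dyadicCube k (dyadicIdx k x), g x ≤
          c * volume (dyadicCube k (dyadicIdx k x))) ∧
      (∀ x ∉ M.union, ∀ k, ∫⁻ x in dyadicCube k (dyadicIdx k x), g x ≤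
        c * volume (dyadicCube k (dyadicIdx k x))) := by
  obtain ⟨M, hMS, hMu, hMd, hMm⟩ := exists_maximal_subfamily
    ({s | c * volume (dyadicCube s.1 s.2) < ∫⁻ x in dyadicCube s.1 s.2, g x} : CubeFamily d) (by
      intro x
      -- In positive dimension a cube of side 2^k with k ≥ N has volume at least 2^N, so `c` times
      -- its volume eventually exceeds the total integral of `g` and large cubes are never selected.
      have hlim : Tendsto (fun N : ℕ => c * (2 : ℝ≥0∞) ^ N) atTop (𝓝 ⊤) := by
        have h2 : Tendsto (fun N : ℕ => (2 : ℝ≥0∞) ^ N) atTop (𝓝 ⊤) :=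
          ENNReal.tendsto_pow_atTop_nhds_top_iff.2 (by norm_num)
        have := ENNReal.Tendsto.const_mul (a := c) h2 (Or.inl (by simp))
        rwa [ENNReal.mul_top hc.ne'] at this
      obtain ⟨N, hN⟩ := ((tendsto_order.1 hlim).1 _ hg).exists
      refine ⟨N, fun k hk h => ?_⟩
      have h1 : c * 2 ^ N ≤ c * volume (dyadicCube k (dyadicIdx k x)) := by
        rw [volume_dyadicCube]
        refine mul_le_mul_right ?_ c
        calc (2 : ℝ≥0∞) ^ N ≤ ENNReal.ofReal (2 ^ k) := by
              rw [show (2 : ℝ≥0∞) ^ N = ENNReal.ofReal (2 ^ (N : ℤ)) by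
                rw [zpow_natCast, ENNReal.ofReal_pow (by norm_num)]; simp]
              exact ENNReal.ofReal_le_ofReal (zpow_le_zpow_right₀ (by norm_num) hk)
          _ ≤ _ := le_self_pow₀ (by
              rw [← ENNReal.ofReal_one]; apply ENNReal.ofReal_le_ofReal
              exact one_le_zpow₀ (by norm_num) (by omega)) hd.ne'
      have h2 : ∫⁻ x in dyadicCube k (dyadicIdx k x), g x ≤ ∫⁻ x, g x := setLIntegral_le_lintegral _ _
      exact absurd (h.trans_le h2) (not_lt.2 (hN.le.trans h1)))
  refine ⟨M, hMd, fun s hs => hMS hs, fun s hs x hx k hk => not_lt.1 (hMm s hs x hx k hk), ?_⟩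
  intro x hx k
  rw [hMu] at hx
  by_contra! h
  exact hx (Set.mem_biUnion (x := (k, dyadicIdx k x)) h rfl)

theorem sum_volume_stopping_le {d : ℕ} {g : Rd d → ℝ≥0∞} {c : ℝ≥0∞} {M : CubeFamily d}
    (hM : M.PairwiseDisjoint fun s => dyadicCube s.1 s.2)
    (hc : ∀ s ∈ M, c * volume (dyadicCube s.1 s.2) ≤ ∫⁻ x in dyadicCube s.1 s.2, g x) :
    c * ∑' s : M, volume (dyadicCube s.1.1 s.1.2) ≤ ∫⁻ x, g x := by
  rw [← ENNReal.tsum_mul_left]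
  calc ∑' s : M, c * volume (dyadicCube s.1.1 s.1.2)
      ≤ ∑' s : M, ∫⁻ x in dyadicCube s.1.1 s.1.2, g x := ENNReal.tsum_le_tsum fun s => hc s.1 s.2
    _ = ∫⁻ x in M.union, g x :=
        (lintegral_biUnion M.to_countable (fun _ _ => measurableSet_dyadicCube _ _) hM _).symm
    _ ≤ _ := setLIntegral_le_lintegral _ _

theorem volume_union_eq {d : ℕ} {M : CubeFamily d}
    (hM : M.PairwiseDisjoint fun s => dyadicCube s.1 s.2) :
    volume M.union = ∑' s : M, volume (dyadicCube s.1.1 s.1.2) :=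
  measure_biUnion M.to_countable hM fun _ _ => measurableSet_dyadicCube _ _

/-- Lebesgue differentiation along dyadic cubes. -/
theorem ae_enorm_le_of_average_le {d : ℕ} {f : Rd d → ℂ} (hf : Integrable f volume) (c : ℝ≥0∞) :
    ∀ᵐ x ∂(volume : Measure (Rd d)),
      (∀ k, ∫⁻ y in dyadicCube k (dyadicIdx k x), ‖f y‖ₑ ≤
        c * volume (dyadicCube k (dyadicIdx k x))) → ‖f x‖ₑ ≤ c := by
  -- In dimension zero the space is one point of mass 1; the radii used below would vanish.
  rcases Nat.eq_zero_or_pos d with rfl | hd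
  · refine Eventually.of_forall fun x hx => ?_
    have := hx 0
    have hs : dyadicCube 0 (dyadicIdx 0 x) = Set.univ := by
      ext y; simp [dyadicCube, Subsingleton.elim y x]
    rw [hs, Measure.restrict_univ] at this
    have h2 : ∀ y : Rd 0, ‖f y‖ₑ = ‖f x‖ₑ := fun y => by rw [Subsingleton.elim y x]
    simp only [h2, lintegral_const] at this
    have h1 : volume (Set.univ : Set (Rd 0)) = 1 := by
      rw [← hs, volume_dyadicCube]; simp
    simpa [h1] using this
  filter_upwards [(IsUnifLocDoublingMeasure.vitaliFamily (volume : Measure (Rd d)) 1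
    ).ae_tendsto_lintegral_enorm_sub_div hf.locallyIntegrable] with x hx hle
  -- The ball of radius d·2^{-j} about `x` contains the dyadic cube of side 2^{-j}, and the ratio of
  -- their volumes is the constant `A` below, so differentiation along balls transfers to cubes.
  set δ : ℕ → ℝ := fun j => d * (2 : ℝ) ^ (-(j : ℤ)) with hδ
  have hδpos : ∀ j, 0 < δ j := fun j => by positivity
  have hδlim : Tendsto δ atTop (𝓝[>] 0) := by
    refine tendsto_nhdsWithin_iff.2 ⟨?_, Eventually.of_forall hδpos⟩
    have : Tendsto (fun j : ℕ => (d : ℝ) * (1 / 2) ^ j) atTop (𝓝 (d * 0)) :=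
      (tendsto_pow_atTop_nhds_zero_of_lt_one (by norm_num) (by norm_num)).const_mul _
    rw [mul_zero] at this
    refine this.congr fun j => ?_
    simp [hδ]
  have ht := hx.comp (IsUnifLocDoublingMeasure.tendsto_closedBall_filterAt (K := 1) volume
    (fun _ : ℕ => x) δ hδlim (Eventually.of_forall fun j => by
      simpa using (hδpos j).le))
  set V := volume (Metric.ball (0 : Rd d) 1) with hV
  set A : ℝ≥0∞ := ENNReal.ofReal ((d : ℝ) ^ d) * V with hA
  have hVt : V ≠ ⊤ := measure_ball_lt_top.ne
  have hAt : A ≠ ⊤ := ENNReal.mul_ne_top ENNReal.ofReal_ne_top hVt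
  have hvol : ∀ j, volume (Metric.closedBall x (δ j)) =
      A * volume (dyadicCube (-(j : ℤ)) (dyadicIdx (-(j : ℤ)) x)) := by
    intro j
    rw [Measure.addHaar_closedBall _ _ (hδpos j).le, volume_dyadicCube, finrank_euclideanSpace,
      Fintype.card_fin, hδ, ← ENNReal.ofReal_pow (by positivity), hA, mul_pow,
      ENNReal.ofReal_mul (by positivity)]
    ring
  have hbound : ∀ j, ‖f x‖ₑ ≤ A * ((∫⁻ y in Metric.closedBall x (δ j), ‖f y - f x‖ₑ) /
      volume (Metric.closedBall x (δ j))) + c := by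
    intro j
    set Q := dyadicCube (-(j : ℤ)) (dyadicIdx (-(j : ℤ)) x) with hQ
    have hQ0 : volume Q ≠ 0 := (volume_dyadicCube_pos _ _).ne'
    have hQt : volume Q ≠ ⊤ := (volume_dyadicCube_lt_top _ _).ne
    have hsub : Q ⊆ Metric.closedBall x (δ j) := by
      intro y hy
      rw [mem_closedBall_iff_norm]
      exact norm_sub_le_of_mem_dyadicCube hy (mem_dyadicCube_self _ _)
    have h1 : ‖f x‖ₑ * volume Q ≤ (∫⁻ y in Metric.closedBall x (δ j), ‖f y - f x‖ₑ) +
        c * volume Q := by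
      calc ‖f x‖ₑ * volume Q = ∫⁻ _y in Q, ‖f x‖ₑ := by simp
        _ ≤ ∫⁻ y in Q, (‖f y - f x‖ₑ + ‖f y‖ₑ) := by
          refine lintegral_mono fun y => ?_
          calc ‖f x‖ₑ = ‖f y - (f y - f x)‖ₑ := by congr 1; ring
            _ ≤ ‖f y‖ₑ + ‖f y - f x‖ₑ := enorm_sub_le
            _ = _ := add_comm _ _
        _ = (∫⁻ y in Q, ‖f y - f x‖ₑ) + ∫⁻ y in Q, ‖f y‖ₑ :=
          lintegral_add_left' ((hf.1.sub aestronglyMeasurable_const).enorm.restrict) _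
        _ ≤ _ := add_le_add (lintegral_mono_set hsub) (hle _)
    rw [hvol j]
    have hA0 : A ≠ 0 := by
      refine mul_ne_zero (ENNReal.ofReal_pos.2 (by positivity)).ne' ?_
      exact (Metric.measure_ball_pos _ _ one_pos).ne'
    rw [← ENNReal.mul_le_mul_iff_left hQ0 hQt]
    refine h1.trans (le_of_eq ?_)
    rw [add_mul]
    congr 1
    rw [mul_assoc, ENNReal.div_eq_inv_mul, ENNReal.mul_inv (Or.inl hA0) (Or.inl hAt)]
    rw [show ∀ I : ℝ≥0∞, A * (A⁻¹ * (volume Q)⁻¹ * I * volume Q) =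
      (A * A⁻¹) * ((volume Q)⁻¹ * volume Q) * I from fun I => by ring]
    rw [ENNReal.mul_inv_cancel hA0 hAt, ENNReal.inv_mul_cancel hQ0 hQt]; simp
  have hlim := (ENNReal.Tendsto.const_mul (a := A) ht (Or.inr hAt)).add_const c
  rw [mul_zero, zero_add] at hlim
  exact ge_of_tendsto' hlim hbound

/-! ### Operators on functions -/

/-- The operators on `L²(ℝ^d)`. -/
abbrev LTwoOp (d : ℕ) :=
  Lp ℂ 2 (volume : Measure (Rd d)) →L[ℂ] Lp ℂ 2 (volume : Measure (Rd d))

open Classical in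
/-- `T f` as a function, for a square integrable function `f`. -/
def opFun {d : ℕ} (T : LTwoOp d) (f : Rd d → ℂ) : Rd d → ℂ :=
  if hf : MemLp f 2 volume then T (hf.toLp f) else 0

section opFun

variable {d : ℕ} (T : LTwoOp d) {f g : Rd d → ℂ}

theorem opFun_eq (hf : MemLp f 2 volume) : opFun T f = T (hf.toLp f) := by
  simp [opFun, hf]

theorem opFun_congr (hf : MemLp f 2 volume) (h : f =ᵐ[volume] g) : opFun T f = opFun T g := by
  have hg : MemLp g 2 volume := hf.ae_eq h
  rw [opFun_eq T hf, opFun_eq T hg, (MemLp.toLp_eq_toLp_iff hf hg).2 h]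

theorem opFun_coe (f : Lp ℂ 2 (volume : Measure (Rd d))) : opFun T f = T f := by
  rw [opFun_eq T (Lp.memLp f), Lp.toLp_coeFn]

theorem memLp_opFun : MemLp (opFun T f) 2 volume := by
  by_cases hf : MemLp f 2 volume
  · rw [opFun_eq T hf]; exact Lp.memLp _
  · simp [opFun, hf]

theorem opFun_add (hf : MemLp f 2 volume) (hg : MemLp g 2 volume) :
    opFun T (f + g) =ᵐ[volume] opFun T f + opFun T g := by
  rw [opFun_eq T hf, opFun_eq T hg, opFun_eq T (hf.add hg), MemLp.toLp_add hf hg, map_add]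
  exact Lp.coeFn_add _ _

theorem opFun_sub (hf : MemLp f 2 volume) (hg : MemLp g 2 volume) :
    opFun T (f - g) =ᵐ[volume] opFun T f - opFun T g := by
  rw [opFun_eq T hf, opFun_eq T hg, opFun_eq T (hf.sub hg), MemLp.toLp_sub hf hg, map_sub]
  exact Lp.coeFn_sub _ _

theorem opFun_smul (hf : MemLp f 2 volume) (c : ℂ) :
    opFun T (c • f) =ᵐ[volume] c • opFun T f := by
  rw [opFun_eq T hf, opFun_eq T (hf.const_smul c), MemLp.toLp_const_smul c hf, map_smul]
  exact Lp.coeFn_smul _ _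

theorem opFun_zero : opFun T (0 : Rd d → ℂ) =ᵐ[volume] 0 := by
  have h : MemLp (0 : Rd d → ℂ) 2 volume := MemLp.zero
  rw [opFun_eq T h, MemLp.toLp_zero, map_zero]
  exact Lp.coeFn_zero _ _ _

theorem opFun_finset_sum {ι : Type*} (s : Finset ι) (F : ι → Rd d → ℂ)
    (hF : ∀ i ∈ s, MemLp (F i) 2 volume) :
    opFun T (∑ i ∈ s, F i) =ᵐ[volume] ∑ i ∈ s, opFun T (F i) := by
  classical
  induction s using Finset.induction_on with
  | empty => simpa using opFun_zero T
  | insert a s ha ih =>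
    rw [Finset.sum_insert ha, Finset.sum_insert ha]
    have h1 := hF a (Finset.mem_insert_self _ _)
    have h2 : ∀ i ∈ s, MemLp (F i) 2 volume := fun i hi => hF i (Finset.mem_insert_of_mem hi)
    exact (opFun_add T h1 (memLp_finsetSum' s h2)).trans (EventuallyEq.rfl.add (ih h2))

theorem lintegral_enorm_sq_eq (f : Rd d → ℂ) :
    ∫⁻ x, ‖f x‖ₑ ^ 2 = eLpNorm f 2 volume ^ 2 := by
  have := eLpNorm_nnreal_pow_eq_lintegral (f := f) (μ := volume) (p := 2) (by norm_num)
  have h2 : ((2 : ℝ≥0) : ℝ) = ((2 : ℕ) : ℝ) := by norm_num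
  rw [h2] at this
  simp only [ENNReal.rpow_natCast] at this
  exact this.symm

theorem lintegral_opFun_sq_le (hf : MemLp f 2 volume) :
    ∫⁻ x, ‖opFun T f x‖ₑ ^ 2 ≤ ‖T‖ₑ ^ 2 * ∫⁻ x, ‖f x‖ₑ ^ 2 := by
  rw [lintegral_enorm_sq_eq, lintegral_enorm_sq_eq, ← mul_pow]
  gcongr
  rw [opFun_eq T hf, ← Lp.enorm_def, ← Lp.enorm_toLp hf]
  exact T.le_opENorm _

end opFun

theorem sq_mul_volume_le {d : ℕ} {h : Rd d → ℂ} (hh : AEMeasurable h volume) (ε : ℝ≥0∞) :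
    ε ^ 2 * volume {x | ε < ‖h x‖ₑ} ≤ ∫⁻ x, ‖h x‖ₑ ^ 2 := by
  refine le_trans ?_ (mul_meas_ge_le_lintegral₀ (hh.enorm.pow_const 2) (ε ^ 2))
  gcongr
  intro hx
  gcongr

/-! ### Standard kernels -/

/-- Standard kernels with the constants of the size and Hölder estimates. -/
structure IsStandardKernel {d : ℕ} (K : Rd d → Rd d → ℂ) (c δ : ℝ) : Prop where
  nonneg : 0 ≤ c
  pos : 0 < δ
  size : ∀ x y, x ≠ y → ‖K x y‖ ≤ c / ‖x - y‖ ^ d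
  holder : ∀ x x' y, x ≠ y → ‖x - x'‖ ≤ ‖x - y‖ / 2 →
    ‖K x y - K x' y‖ + ‖K y x - K y x'‖ ≤ c * ‖x - x'‖ ^ δ / ‖x - y‖ ^ ((d : ℝ) + δ)

/-- `T` is represented by the kernel `K` off the support of the argument. -/
def HasKernel {d : ℕ} (T : LTwoOp d) (K : Rd d → Rd d → ℂ) : Prop :=
  ∀ f : Rd d → ℂ, MemLp f 2 volume → HasCompactSupport f →
    ∀ᵐ x ∂(volume : Measure (Rd d)), x ∉ tsupport f → opFun T f x = ∫ y, K x y * f y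

theorem IsCZO.exists_kernel {d : ℕ} {T : LTwoOp d} (hT : IsCZO T) :
    ∃ (K : Rd d → Rd d → ℂ) (c δ : ℝ), IsStandardKernel K c δ ∧ HasKernel T K := by
  obtain ⟨K, c, δ, hδ, -, h1, h2, h3⟩ := hT
  refine ⟨K, |c|, δ, ⟨abs_nonneg c, hδ, fun x y hxy => (h1 x y hxy).trans ?_,
    fun x x' y hxy hx => (h2 x x' y hxy hx).trans ?_⟩, fun f hf hc => ?_⟩
  · rw [Real.rpow_natCast]; gcongr; exact le_abs_self c
  · gcongr; exact le_abs_self c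
  · rw [opFun_eq T hf]; exact h3 f hf hc

theorem IsStandardKernel.swap {d : ℕ} {K : Rd d → Rd d → ℂ} {c δ : ℝ}
    (hK : IsStandardKernel K c δ) : IsStandardKernel (fun x y => K y x) c δ where
  nonneg := hK.nonneg
  pos := hK.pos
  size x y hxy := by rw [norm_sub_rev]; exact hK.size y x hxy.symm
  holder x x' y hxy hx := by rw [add_comm]; exact hK.holder x x' y hxy hx

/-- The kernel is not assumed measurable: its Hölder estimate in the second variable gives
continuity off the diagonal, from which measurability follows. -/
theorem IsStandardKernel.continuousOn {d : ℕ} {K : Rd d → Rd d → ℂ} {c δ : ℝ}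
    (hK : IsStandardKernel K c δ) (x : Rd d) : ContinuousOn (K x) {x}ᶜ := by
  intro y hy
  have hyx : y ≠ x := hy
  refine ContinuousAt.continuousWithinAt ?_
  rw [ContinuousAt, tendsto_iff_norm_sub_tendsto_zero]
  have hpos : 0 < ‖y - x‖ := norm_pos_iff.2 (sub_ne_zero.2 hyx)
  have hlim : Tendsto (fun z => c * ‖y - z‖ ^ δ / ‖y - x‖ ^ ((d : ℝ) + δ)) (𝓝 y) (𝓝 0) := by
    have : ContinuousAt (fun z => c * ‖y - z‖ ^ δ / ‖y - x‖ ^ ((d : ℝ) + δ)) y :=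
      ((continuousAt_const.mul ((by fun_prop : ContinuousAt (fun z => ‖y - z‖) y).rpow_const
        (Or.inr hK.pos.le))).div_const _)
    simpa [ContinuousAt, Real.zero_rpow hK.pos.ne'] using this
  refine squeeze_zero' (Eventually.of_forall fun _ => norm_nonneg _) ?_ hlim
  filter_upwards [Metric.closedBall_mem_nhds y (half_pos hpos)] with z hz
  rw [Metric.mem_closedBall, dist_comm, dist_eq_norm] at hz
  have := hK.holder y z x hyx hz
  rw [norm_sub_rev]
  linarith [norm_nonneg (K y x - K z x)]

theorem IsStandardKernel.aestronglyMeasurable {d : ℕ} (hd : 0 < d) {K : Rd d → Rd d → ℂ} {c δ : ℝ}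
    (hK : IsStandardKernel K c δ) (x : Rd d) : AEStronglyMeasurable (K x) volume := by
  have : Nonempty (Fin d) := ⟨⟨0, hd⟩⟩
  have h := (hK.continuousOn x).aestronglyMeasurable (μ := volume)
    (measurableSet_singleton x).compl
  rwa [Measure.restrict_eq_self_of_ae_mem] at h
  exact compl_mem_ae_iff.2 (measure_singleton x)

/-- One bound without the restriction |x - x'| ≤ |x - y|/2. If that restriction fails, then 2dl/r ≥
1, and the size estimate times (2dl/r)^δ suffices; this is the source of the factor 2c(2d)^δ. -/
theorem IsStandardKernel.norm_sub_le {d : ℕ} {K : Rd d → Rd d → ℂ} {c δ : ℝ}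
    (hK : IsStandardKernel K c δ) {x x' y : Rd d} {r l : ℝ} (hr : 0 < r) (hl : 0 < l)
    (hx : r ≤ ‖x - y‖) (hx' : r ≤ ‖x' - y‖) (hxx' : ‖x - x'‖ ≤ d * l) :
    ‖K x y - K x' y‖ ≤ 2 * c * (2 * d) ^ δ * (l ^ δ / r ^ ((d : ℝ) + δ)) := by
  have hc := hK.nonneg
  have hδ := hK.pos
  have hxy : x ≠ y := by rintro rfl; simp at hx; linarith
  have hxy' : x' ≠ y := by rintro rfl; simp at hx'; linarith
  rcases le_or_gt ‖x - x'‖ (‖x - y‖ / 2) with h | h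
  · have h1 := hK.holder x x' y hxy h
    have h2 : c * ‖x - x'‖ ^ δ / ‖x - y‖ ^ ((d : ℝ) + δ) ≤
        c * (2 * d * l) ^ δ / r ^ ((d : ℝ) + δ) := by
      gcongr
      have : (0 : ℝ) ≤ d * l := by positivity
      linarith
    rw [Real.mul_rpow (by positivity) hl.le] at h2
    have h3 : 0 ≤ c * ((2 * d) ^ δ * l ^ δ) / r ^ ((d : ℝ) + δ) := by positivity
    have h4 : 2 * c * (2 * (d : ℝ)) ^ δ * (l ^ δ / r ^ ((d : ℝ) + δ)) =
      2 * (c * ((2 * d) ^ δ * l ^ δ) / r ^ ((d : ℝ) + δ)) := by ring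
    linarith [norm_nonneg (K y x - K y x')]
  · have h1 : ‖K x y - K x' y‖ ≤ 2 * (c / r ^ d) := by
      have e1 : ‖K x y‖ ≤ c / r ^ d := (hK.size x y hxy).trans (by gcongr)
      have e2 : ‖K x' y‖ ≤ c / r ^ d := (hK.size x' y hxy').trans (by gcongr)
      linarith [_root_.norm_sub_le (K x y) (K x' y)]
    have h2 : 1 ≤ (2 * d * l / r) ^ δ := by
      apply Real.one_le_rpow _ hδ.le
      rw [le_div_iff₀ hr]; linarith
    calc ‖K x y - K x' y‖ ≤ 2 * (c / r ^ d) := h1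
      _ ≤ 2 * (c / r ^ d) * (2 * d * l / r) ^ δ := le_mul_of_one_le_right (by positivity) h2
      _ = _ := by
        rw [Real.div_rpow (by positivity) hr.le, Real.mul_rpow (by positivity) hl.le,
          Real.rpow_add hr, Real.rpow_natCast]
        field_simp

/-- The majorant of the oscillation of a standard kernel over the dyadic cube of side `2^k`
containing `x₀`. -/
def kernelTail {d : ℕ} (A q : ℝ≥0∞) (k : ℤ) (x₀ : Rd d) (y : Rd d) : ℝ≥0∞ :=
  ∑' j : ℕ, A * q ^ j * (volume (dyadicCube (k + j) (dyadicIdx (k + j) x₀)))⁻¹ *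
    (tripleCube (k + (j + 1 : ℕ)) (dyadicIdx (k + (j + 1 : ℕ)) x₀)).indicator 1 y

/-- Each term of the tail is a multiple of an average over the triple of an ancestor cube, so
averages bounded by `B` at all larger scales sum geometrically. The factor 6^d is the volume of the
triple of the parent over the volume of the cube. -/
theorem lintegral_kernelTail_mul_le {d : ℕ} (A q : ℝ≥0∞) (k : ℤ) (x₀ : Rd d) {g : Rd d → ℝ≥0∞}
    (hg : AEMeasurable g volume) (B : ℝ≥0∞)
    (hB : ∀ k', k ≤ k' → ∫⁻ y in tripleCube k' (dyadicIdx k' x₀), g y ≤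
      B * volume (tripleCube k' (dyadicIdx k' x₀))) :
    ∫⁻ y, kernelTail A q k x₀ y * g y ≤ A * (1 - q)⁻¹ * 6 ^ d * B := by
  have hind : ∀ (s : Set (Rd d)) y, s.indicator (1 : Rd d → ℝ≥0∞) y * g y = s.indicator g y := by
    intro s y; by_cases h : y ∈ s <;> simp [h]
  simp only [kernelTail, ← ENNReal.tsum_mul_right, mul_assoc, hind]
  rw [lintegral_tsum]
  · calc _ ≤ ∑' j : ℕ, q ^ j * (A * 6 ^ d * B) := by
          refine ENNReal.tsum_le_tsum fun j => ?_
          set Q := dyadicCube (k + j) (dyadicIdx (k + j) x₀)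
          have hQ0 : volume Q ≠ 0 := (volume_dyadicCube_pos _ _).ne'
          have hQt : volume Q ≠ ⊤ := (volume_dyadicCube_lt_top _ _).ne
          have hm := measurableSet_tripleCube (k + (j + 1 : ℕ)) (dyadicIdx (k + (j + 1 : ℕ)) x₀)
          have hgi : AEMeasurable ((tripleCube (k + (j + 1 : ℕ))
            (dyadicIdx (k + (j + 1 : ℕ)) x₀)).indicator g) volume := hg.indicator hm
          rw [lintegral_const_mul'' _ (by fun_prop), lintegral_const_mul'' _ (by fun_prop),
            lintegral_const_mul'' _ hgi, lintegral_indicator hm]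
          have h1 := hB (k + (j + 1 : ℕ)) (by omega)
          have h2 : volume (tripleCube (k + (j + 1 : ℕ)) (dyadicIdx (k + (j + 1 : ℕ)) x₀)) =
              6 ^ d * volume Q := by
            rw [volume_tripleCube]
            have : k + ((j + 1 : ℕ) : ℤ) = (k + j) + 1 := by push_cast; ring
            rw [this, volume_dyadicCube_add_one _ _ (dyadicIdx (k + j) x₀), ← mul_assoc, ← mul_pow]
            norm_num
            rfl
          rw [h2] at h1
          calc A * (q ^ j * ((volume Q)⁻¹ * _))
              ≤ A * (q ^ j * ((volume Q)⁻¹ * (B * (6 ^ d * volume Q)))) := by gcongr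
            _ = q ^ j * (A * 6 ^ d * B) * ((volume Q)⁻¹ * volume Q) := by ring
            _ = _ := by rw [ENNReal.inv_mul_cancel hQ0 hQt, mul_one]
      _ = _ := by rw [ENNReal.tsum_mul_right, ENNReal.tsum_geometric]; ring
  · intro j
    have hm := measurableSet_tripleCube (k + (j + 1 : ℕ)) (dyadicIdx (k + (j + 1 : ℕ)) x₀)
    have hgi : AEMeasurable ((tripleCube (k + (j + 1 : ℕ))
      (dyadicIdx (k + (j + 1 : ℕ)) x₀)).indicator g) volume := hg.indicator hm
    fun_prop

theorem lintegral_kernelTail_le {d : ℕ} (A q : ℝ≥0∞) (k : ℤ) (x₀ : Rd d) :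
    ∫⁻ y, kernelTail A q k x₀ y ≤ A * (1 - q)⁻¹ * 6 ^ d := by
  have := lintegral_kernelTail_mul_le A q k x₀ (g := fun _ => 1) aemeasurable_const 1 (by simp)
  simpa using this

/-- Let j be the scale at which `y` first enters the triple of the ancestor of generation j + 1.
Then `y` is at distance at least 2^{k+j} from both points, and the Hölder bound equals 2^{-jδ} over
the volume of the ancestor of generation j, which is one term of the series. -/
theorem IsStandardKernel.enorm_sub_le_kernelTail {d : ℕ} {K : Rd d → Rd d → ℂ} {c δ : ℝ}
    (hK : IsStandardKernel K c δ) {k : ℤ} {x₀ x x' y : Rd d}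
    (hx : x ∈ dyadicCube k (dyadicIdx k x₀)) (hx' : x' ∈ dyadicCube k (dyadicIdx k x₀))
    (hy : y ∉ tripleCube k (dyadicIdx k x₀)) :
    ‖K x y - K x' y‖ₑ ≤ kernelTail (ENNReal.ofReal (2 * c * (2 * d) ^ δ))
      (ENNReal.ofReal ((2 : ℝ) ^ (-δ))) k x₀ y := by
  classical
  have hc := hK.nonneg
  have hex : ∃ j : ℕ, y ∈ tripleCube (k + j) (dyadicIdx (k + j) x₀) := by
    obtain ⟨k₀, hk₀⟩ := exists_mem_tripleCube x₀ y
    exact ⟨(k₀ - k).toNat, hk₀ _ (by omega)⟩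
  obtain ⟨j, hj⟩ : ∃ j, Nat.find hex = j + 1 := by
    refine Nat.exists_eq_succ_of_ne_zero fun h => ?_
    have := Nat.find_spec hex
    rw [h] at this; simp at this; exact hy this
  have hj1 := Nat.find_spec hex
  rw [hj] at hj1
  have hj2 : y ∉ tripleCube (k + j) (dyadicIdx (k + j) x₀) := Nat.find_min hex (by omega)
  refine le_trans ?_ (ENNReal.le_tsum j)
  rw [Set.indicator_of_mem hj1, Pi.one_apply, mul_one, volume_dyadicCube]
  have hkj : k ≤ k + j := by omega
  have hxj : dyadicIdx (k + j) x = dyadicIdx (k + j) x₀ := dyadicIdx_eq_of_le hkj hx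
  have hxj' : dyadicIdx (k + j) x' = dyadicIdx (k + j) x₀ := dyadicIdx_eq_of_le hkj hx'
  have h2k : (0 : ℝ) < 2 ^ k := by positivity
  have h2kj : (0 : ℝ) < 2 ^ (k + j) := by positivity
  have key := hK.norm_sub_le h2kj h2k (le_norm_of_notMem_tripleCube (hxj ▸ hj2))
    (le_norm_of_notMem_tripleCube (hxj' ▸ hj2)) (norm_sub_le_of_mem_dyadicCube hx hx')
  rw [← ofReal_norm]
  have e : ((2 : ℝ) ^ k) ^ δ / ((2 : ℝ) ^ (k + j)) ^ ((d : ℝ) + δ) =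
      ((2 : ℝ) ^ (-δ)) ^ j * (((2 : ℝ) ^ (k + j)) ^ d)⁻¹ := by
    rw [Real.rpow_add h2kj, Real.rpow_natCast]
    have : ((2 : ℝ) ^ (k + (j : ℤ))) ^ δ = (2 ^ k) ^ δ * ((2 : ℝ) ^ δ) ^ j := by
      rw [zpow_add₀ (by norm_num), Real.mul_rpow h2k.le (by positivity), zpow_natCast,
        ← Real.rpow_natCast, ← Real.rpow_natCast, ← Real.rpow_mul (by norm_num),
        ← Real.rpow_mul (by norm_num), mul_comm (j : ℝ)]
    rw [this, Real.rpow_neg (by norm_num)]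
    have h3 : ((2 : ℝ) ^ k) ^ δ ≠ 0 := by positivity
    have h4 : ((2 : ℝ) ^ δ) ^ j ≠ 0 := by positivity
    rw [inv_pow]
    field_simp
  rw [e] at key
  refine (ENNReal.ofReal_le_ofReal key).trans (le_of_eq ?_)
  rw [ENNReal.ofReal_mul (p := 2 * c * (2 * d) ^ δ) (by positivity),
    ENNReal.ofReal_mul (p := ((2 : ℝ) ^ (-δ)) ^ j) (by positivity), ENNReal.ofReal_pow (by positivity), ENNReal.ofReal_inv_of_pos (by positivity),
    ENNReal.ofReal_pow (by positivity), ← mul_assoc]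

theorem integrable_of_bounded_support {d : ℕ} {f : Rd d → ℂ} (hf : MemLp f 2 volume)
    {s : Set (Rd d)} (hs : MeasurableSet s) (hsb : Bornology.IsBounded s)
    (h : ∀ x ∉ s, f x = 0) : Integrable f volume := by
  have h1 : MemLp f 2 (volume.restrict s) := hf.restrict s
  have : IsFiniteMeasure (volume.restrict s) := ⟨by simpa using hsb.measure_lt_top⟩
  have h2 : IntegrableOn f s volume := h1.integrable (by norm_num)
  have h3 := (integrable_indicator_iff hs).2 h2
  rwa [Set.indicator_eq_self.2 (fun x hx => by by_contra h'; exact hx (h x h'))] at h3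

theorem hasCompactSupport_of_bounded {d : ℕ} {f : Rd d → ℂ}
    {s : Set (Rd d)} (hsb : Bornology.IsBounded s)
    (h : ∀ x ∉ s, f x = 0) : HasCompactSupport f := by
  have : Function.support f ⊆ s := fun x hx => by by_contra h'; exact hx (h x h')
  exact Metric.isCompact_of_isClosed_isBounded isClosed_closure
    ((hsb.subset this).closure)

theorem IsStandardKernel.integrable_mul {d : ℕ} (hd : 0 < d) {K : Rd d → Rd d → ℂ} {c δ : ℝ}
    (hK : IsStandardKernel K c δ) {f : Rd d → ℂ} (hf : Integrable f volume) (x : Rd d)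
    {r : ℝ} (hr : 0 < r) (h : ∀ y, f y ≠ 0 → r ≤ ‖x - y‖) :
    Integrable (fun y => K x y * f y) volume := by
  have hc := hK.nonneg
  refine Integrable.mono' (hf.norm.const_mul (c / r ^ d))
    ((hK.aestronglyMeasurable hd x).mul hf.1) (Eventually.of_forall fun y => ?_)
  by_cases hy : f y = 0
  · simp [hy]
  · rw [norm_mul]
    have h1 := h y hy
    have hxy : x ≠ y := by rintro rfl; simp at h1; linarith
    gcongr
    exact (hK.size x y hxy).trans (by gcongr)

/-- The decay of `T b` for a function `b` of mean zero supported in a dyadic cube. -/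
theorem HasKernel.enorm_opFun_le {d : ℕ} (hd : 0 < d) {T : LTwoOp d} {K : Rd d → Rd d → ℂ}
    {c δ : ℝ} (hK : IsStandardKernel K c δ) (hT : HasKernel T K) {b : Rd d → ℂ}
    (hb : MemLp b 2 volume) (k : ℤ) (x₀ : Rd d)
    (hsupp : ∀ x ∉ dyadicCube k (dyadicIdx k x₀), b x = 0) (h0 : ∫ x, b x = 0) :
    ∀ᵐ x ∂(volume : Measure (Rd d)), x ∉ tripleCube k (dyadicIdx k x₀) →
      ‖opFun T b x‖ₑ ≤ kernelTail (ENNReal.ofReal (2 * c * (2 * d) ^ δ))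
      (ENNReal.ofReal ((2 : ℝ) ^ (-δ))) k x₀ x * ∫⁻ y, ‖b y‖ₑ := by
  have hbi : Integrable b volume := integrable_of_bounded_support hb
    (measurableSet_dyadicCube k (dyadicIdx k x₀)) (isBounded_dyadicCube _ _) hsupp
  filter_upwards [hT b hb (hasCompactSupport_of_bounded (isBounded_dyadicCube _ _) hsupp)]
    with x hx hxn
  have hts : x ∉ tsupport b := fun h => hxn (closure_dyadicCube_subset _ _
    (closure_mono (fun y hy => by by_contra h'; exact hy (hsupp y h')) h))
  rw [hx hts]
  have hint : Integrable (fun y => K x y * b y) volume := by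
    refine hK.integrable_mul hd hbi x (r := 2 ^ k) (by positivity) fun y hy => ?_
    have hyd : y ∈ dyadicCube k (dyadicIdx k x₀) := by by_contra h'; exact hy (hsupp y h')
    have hyd' : dyadicIdx k y = dyadicIdx k x₀ := hyd
    rw [norm_sub_rev]
    exact le_norm_of_notMem_tripleCube (hyd' ▸ hxn)
  -- The mean zero of `b` allows the constant K(x, x₀) to be subtracted.
  have heq : ∫ y, K x y * b y = ∫ y, (K x y - K x x₀) * b y := by
    simp only [sub_mul]
    rw [integral_sub hint (hbi.const_mul _), integral_const_mul, h0, mul_zero, sub_zero]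
  rw [heq, ← lintegral_const_mul'' _ hbi.1.enorm]
  refine (enorm_integral_le_lintegral_enorm _).trans (lintegral_mono fun y => ?_)
  by_cases hy : b y = 0
  · simp [hy]
  · rw [enorm_mul]
    gcongr
    have hyd : y ∈ dyadicCube k (dyadicIdx k x₀) := by by_contra h'; exact hy (hsupp y h')
    exact hK.swap.enorm_sub_le_kernelTail hyd (mem_dyadicCube_self _ _) hxn

/-- The oscillation of `T f` on a dyadic cube `Q` for a function `f` vanishing on `3Q`. -/
theorem HasKernel.exists_oscillation_le {d : ℕ} (hd : 0 < d) {T : LTwoOp d}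
    {K : Rd d → Rd d → ℂ} {c δ : ℝ} (hK : IsStandardKernel K c δ) (hT : HasKernel T K)
    {f : Rd d → ℂ} (hf : MemLp f 2 volume) {s : Set (Rd d)} (hs : MeasurableSet s)
    (hsb : Bornology.IsBounded s) (hfs : ∀ x ∉ s, f x = 0) (k : ℤ) (x₀ : Rd d)
    (h0 : ∀ x ∈ tripleCube k (dyadicIdx k x₀), f x = 0) :
    ∃ G : Rd d → ℂ, (∀ᵐ x ∂(volume : Measure (Rd d)), x ∈ dyadicCube k (dyadicIdx k x₀) →
      opFun T f x = G x) ∧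
      ∀ x ∈ dyadicCube k (dyadicIdx k x₀), ∀ x' ∈ dyadicCube k (dyadicIdx k x₀),
        ‖G x - G x'‖ₑ ≤ ∫⁻ y, kernelTail (ENNReal.ofReal (2 * c * (2 * d) ^ δ))
          (ENNReal.ofReal ((2 : ℝ) ^ (-δ))) k x₀ y * ‖f y‖ₑ := by
  have hfi := integrable_of_bounded_support hf hs hsb hfs
  have hout : ∀ y, f y ≠ 0 → y ∉ tripleCube k (dyadicIdx k x₀) := fun y hy h => hy (h0 y h)
  -- `opFun T f` is fixed only up to null sets; the kernel integral is a pointwise representative on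
  -- the cube, for which the oscillation is meaningful at all pairs of points. Since `f` vanishes on
  -- the triple, a neighbourhood of each point of the cube, the kernel formula applies there.
  refine ⟨fun x => ∫ y, K x y * f y, ?_, fun x hx x' hx' => ?_⟩
  · filter_upwards [hT f hf (hasCompactSupport_of_bounded hsb hfs)] with x hx hxd
    refine hx fun h => ?_
    rw [tsupport, mem_closure_iff_nhds] at h
    obtain ⟨y, hy, hy'⟩ := h _ (tripleCube_mem_nhds hxd)
    exact hy' (h0 y hy)
  · have hint : ∀ z ∈ dyadicCube k (dyadicIdx k x₀), Integrable (fun y => K z y * f y) volume := by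
      intro z hz
      refine hK.integrable_mul hd hfi z (r := 2 ^ k) (by positivity) fun y hy => ?_
      have hz' : dyadicIdx k z = dyadicIdx k x₀ := hz
      exact le_norm_of_notMem_tripleCube (hz' ▸ hout y hy)
    rw [← integral_sub (hint x hx) (hint x' hx')]
    refine (enorm_integral_le_lintegral_enorm _).trans (lintegral_mono fun y => ?_)
    by_cases hy : f y = 0
    · simp [hy]
    · dsimp only
      rw [← sub_mul, enorm_mul]
      gcongr
      exact hK.enorm_sub_le_kernelTail hx hx' (hout y hy)

/-! ### The weak type `(1,1)` inequality -/

/-- The weak type `(1,1)` inequality on `L¹ ∩ L²`. -/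
def HasWeakType {d : ℕ} (T : LTwoOp d) (C : ℝ≥0∞) : Prop :=
  ∀ f : Rd d → ℂ, MemLp f 2 volume → ∀ a : ℝ≥0∞, a ≠ 0 → a ≠ ⊤ →
    a * volume {x | a < ‖opFun T f x‖ₑ} ≤ C * ∫⁻ x, ‖f x‖ₑ

/-- The part of `f` on a cube, with its mean subtracted. -/
def badPart {d : ℕ} (f : Rd d → ℂ) (s : ℤ × (Fin d → ℤ)) : Rd d → ℂ :=
  (dyadicCube s.1 s.2).indicator fun x => f x - ⨍ y in dyadicCube s.1 s.2, f y

section badPart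

variable {d : ℕ} {f : Rd d → ℂ} (s : ℤ × (Fin d → ℤ))

theorem memLp_badPart (hf : MemLp f 2 volume) : MemLp (badPart f s) 2 volume := by
  have h : badPart f s = (dyadicCube s.1 s.2).indicator f -
      (dyadicCube s.1 s.2).indicator fun _ => ⨍ y in dyadicCube s.1 s.2, f y := by
    ext x
    by_cases hx : x ∈ dyadicCube s.1 s.2 <;> simp [badPart, hx]
  rw [h]
  exact (hf.indicator (measurableSet_dyadicCube _ _)).sub
    (memLp_indicator_const _ (measurableSet_dyadicCube _ _) _
      (Or.inr (volume_dyadicCube_lt_top _ _).ne))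

theorem integral_badPart : ∫ x, badPart f s x = 0 := by
  rw [badPart, integral_indicator (measurableSet_dyadicCube _ _)]
  have : IsFiniteMeasure (volume.restrict (dyadicCube s.1 s.2)) :=
    ⟨by simpa using volume_dyadicCube_lt_top _ _⟩
  exact integral_sub_average _ _

theorem enorm_average_mul_le :
    ‖⨍ y in dyadicCube s.1 s.2, f y‖ₑ * volume (dyadicCube s.1 s.2) ≤
      ∫⁻ x in dyadicCube s.1 s.2, ‖f x‖ₑ := by
  have hQ0 : volume (dyadicCube s.1 s.2) ≠ 0 := (volume_dyadicCube_pos _ _).ne'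
  have hQt : volume (dyadicCube s.1 s.2) ≠ ⊤ := (volume_dyadicCube_lt_top _ _).ne
  rw [setAverage_eq, enorm_smul, measureReal_def]
  have : ‖(volume (dyadicCube s.1 s.2)).toReal⁻¹‖ₑ = (volume (dyadicCube s.1 s.2))⁻¹ := by
    rw [Real.enorm_eq_ofReal (by positivity), ENNReal.ofReal_inv_of_pos
      (ENNReal.toReal_pos hQ0 hQt), ENNReal.ofReal_toReal hQt]
  rw [this, mul_comm, ← mul_assoc, ENNReal.mul_inv_cancel hQ0 hQt, one_mul]
  exact enorm_integral_le_lintegral_enorm _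

theorem lintegral_badPart_le (hf : AEStronglyMeasurable f volume) :
    ∫⁻ x, ‖badPart f s x‖ₑ ≤ 2 * ∫⁻ x in dyadicCube s.1 s.2, ‖f x‖ₑ := by
  have hm := measurableSet_dyadicCube s.1 s.2
  calc ∫⁻ x, ‖badPart f s x‖ₑ
      ≤ ∫⁻ x in dyadicCube s.1 s.2, (‖f x‖ₑ + ‖⨍ y in dyadicCube s.1 s.2, f y‖ₑ) := by
        rw [← lintegral_indicator hm]
        refine lintegral_mono fun x => ?_
        rw [badPart, enorm_indicator_eq_indicator_enorm]
        exact Set.indicator_le_indicator enorm_sub_le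
    _ = (∫⁻ x in dyadicCube s.1 s.2, ‖f x‖ₑ) +
        ‖⨍ y in dyadicCube s.1 s.2, f y‖ₑ * volume (dyadicCube s.1 s.2) := by
        rw [lintegral_add_left' hf.enorm.restrict]; simp
    _ ≤ _ := by rw [two_mul]; gcongr; exact enorm_average_mul_le s

end badPart

/-- The Calderón–Zygmund decomposition, with finitely many bad parts and a remainder that is
small in `L²`. -/
theorem exists_cz_decomposition {d : ℕ} (hd : 0 < d) {f : Rd d → ℂ} (hf : Integrable f volume)
    (hf2 : MemLp f 2 volume) {a : ℝ≥0∞} (ha0 : a ≠ 0)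
    (hf0 : ∫⁻ x, ‖f x‖ₑ ≠ 0) :
    ∃ (M : CubeFamily d) (F : Finset (ℤ × (Fin d → ℤ))) (g r : Rd d → ℂ),
      (M.PairwiseDisjoint fun s => dyadicCube s.1 s.2) ∧ (↑F ⊆ M) ∧
      (a * ∑' s : M, volume (dyadicCube s.1.1 s.1.2) ≤ ∫⁻ x, ‖f x‖ₑ) ∧
      MemLp g 2 volume ∧ MemLp r 2 volume ∧ f = g + r + ∑ s ∈ F, badPart f s ∧
      (∫⁻ x, ‖g x‖ₑ ^ 2 ≤ 2 ^ d * a * (4 * ∫⁻ x, ‖f x‖ₑ)) ∧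
      ∫⁻ x, ‖r x‖ₑ ^ 2 ≤ a * ∫⁻ x, ‖f x‖ₑ := by
  classical
  obtain ⟨M, hMd, hM1, hM2, hM3⟩ := exists_stopping_cubes hd (fun x => ‖f x‖ₑ)
    hf.2 (pos_iff_ne_zero.2 ha0)
  have hMm : ∀ s ∈ M, MeasurableSet (dyadicCube s.1 s.2) := fun _ _ => measurableSet_dyadicCube _ _
  -- a finite subfamily outside of which `f` is small in `L²`
  have hsum : ∑' s : M, ∫⁻ x in dyadicCube s.1.1 s.1.2, ‖f x‖ₑ ^ 2 ≠ ⊤ := by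
    rw [← lintegral_biUnion M.to_countable hMm hMd]
    refine ((setLIntegral_le_lintegral _ _).trans_lt ?_).ne
    rw [lintegral_enorm_sq_eq]
    exact ENNReal.pow_lt_top hf2.2
  have htail := ENNReal.tendsto_tsum_compl_atTop_zero hsum
  have hpos : 0 < a * ∫⁻ x, ‖f x‖ₑ := ENNReal.mul_pos ha0 hf0
  obtain ⟨F₀, hF₀⟩ := ((tendsto_order.1 htail).2 _ hpos).exists
  set F : Finset (ℤ × (Fin d → ℤ)) := F₀.map (Function.Embedding.subtype _) with hF
  have hFM : ↑F ⊆ M := by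
    intro s hs
    simp only [hF, Finset.coe_map, Set.mem_image] at hs
    obtain ⟨t, -, rfl⟩ := hs
    exact t.2
  -- On the remaining stopping cubes `f` goes unchanged into `r`. Thus T meets only a finite sum of
  -- bad parts, and no convergence of an infinite series has to be proved; `r` is disposed of by L²
  -- boundedness.
  set R : CubeFamily d := M \ F with hR
  set r : Rd d → ℂ := R.union.indicator f with hr
  have hrm : MemLp r 2 volume := hf2.indicator R.measurableSet_union
  have hRd : R.PairwiseDisjoint fun s => dyadicCube s.1 s.2 := hMd.subset Set.sdiff_subset
  have hsF2 : MemLp (∑ s ∈ F, badPart f s) 2 volume :=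
    memLp_finsetSum' F fun s _ => memLp_badPart s hf2
  set g : Rd d → ℂ := f - r - ∑ s ∈ F, badPart f s with hg
  refine ⟨M, F, g, r, hMd, hFM, sum_volume_stopping_le hMd fun s hs => (hM1 s hs).le,
    (hf2.sub hrm).sub hsF2, hrm, by rw [hg]; ring, ?_, ?_⟩
  · have hone : ∀ s ∈ M, ∀ x ∈ dyadicCube s.1 s.2, ∀ t ∈ M, t ≠ s → x ∉ dyadicCube t.1 t.2 := by
      intro s hs x hx t ht hts hx'
      exact Set.disjoint_left.1 (hMd ht hs hts) hx' hx
    have hgb : ∀ᵐ x ∂(volume : Measure (Rd d)), ‖g x‖ₑ ≤ 2 ^ d * a := by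
      filter_upwards [ae_enorm_le_of_average_le hf a] with x hx
      have hgx : g x = f x - r x - ∑ s ∈ F, badPart f s x := by simp [hg]
      rw [hgx]
      by_cases hxM : x ∈ M.union
      · simp only [CubeFamily.union, Set.mem_iUnion] at hxM
        obtain ⟨s, hs, hxs⟩ := hxM
        by_cases hsF : s ∈ F
        · have hr0 : r x = 0 := by
            refine Set.indicator_of_notMem (fun h => ?_) _
            simp only [CubeFamily.union, Set.mem_iUnion] at h
            obtain ⟨t, ht, hxt⟩ := h
            exact hone s hs x hxs t ht.1 (fun h => ht.2 (h ▸ hsF)) hxt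
          rw [Finset.sum_eq_single_of_mem s hsF fun t ht hts => ?_, hr0]
          · simp only [badPart, Set.indicator_of_mem hxs, sub_zero, sub_sub_cancel]
            have h1 := enorm_average_mul_le (f := f) s
            have hQ0 : volume (dyadicCube s.1 s.2) ≠ 0 := (volume_dyadicCube_pos _ _).ne'
            have hQt : volume (dyadicCube s.1 s.2) ≠ ⊤ := (volume_dyadicCube_lt_top _ _).ne
            rw [← ENNReal.mul_le_mul_iff_left hQ0 hQt]
            refine h1.trans ?_
            -- By maximality the parent cube was not selected, so the average over the cube is at
            -- most 2^d · a.
            have h2 := hM2 s hs x hxs (s.1 + 1) (by omega)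
            rw [volume_dyadicCube_add_one _ _ s.2] at h2
            calc _ ≤ ∫⁻ x in dyadicCube (s.1 + 1) (dyadicIdx (s.1 + 1) x), ‖f x‖ₑ := by
                  refine lintegral_mono_set ?_
                  exact dyadicCube_subset_of_mem (by omega) hxs (mem_dyadicCube_self _ _)
              _ ≤ _ := h2
              _ = _ := by ring
          · exact Set.indicator_of_notMem (hone s hs x hxs t (hFM ht) hts) _
        · have hr1 : r x = f x := Set.indicator_of_mem (Set.mem_biUnion
            (show s ∈ R from ⟨hs, hsF⟩) hxs) _
          rw [hr1, sub_self, Finset.sum_eq_zero fun t ht => ?_]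
          · simp
          · exact Set.indicator_of_notMem (hone s hs x hxs t (hFM ht)
              fun h => hsF (h ▸ ht)) _
      · have hnot : ∀ s ∈ M, x ∉ dyadicCube s.1 s.2 := fun s hs h =>
          hxM (Set.mem_biUnion hs h)
        have hr0 : r x = 0 := by
          refine Set.indicator_of_notMem (fun h => ?_) _
          simp only [CubeFamily.union, Set.mem_iUnion] at h
          obtain ⟨t, ht, hxt⟩ := h
          exact hnot t ht.1 hxt
        have hb0 : ∀ s ∈ F, badPart f s x = 0 := fun t ht =>
          Set.indicator_of_notMem (hnot t (hFM ht)) _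
        rw [hr0, Finset.sum_eq_zero hb0, sub_zero, sub_zero]
        refine (hx (hM3 x hxM)).trans ?_
        exact le_mul_of_one_le_left (zero_le) (one_le_pow₀ (by norm_num))
    -- 4 = 1 + 1 + 2: the function `f`, the remainder, and the bad parts, each of which at most
    -- doubles the mass of `f` on its cube.
    have hg1 : ∫⁻ x, ‖g x‖ₑ ≤ 4 * ∫⁻ x, ‖f x‖ₑ := by
      have hm1 : AEMeasurable (fun x => ‖f x‖ₑ) volume := hf.1.enorm
      have hm2 : AEMeasurable (fun x => ‖r x‖ₑ) volume := hrm.1.enorm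
      calc ∫⁻ x, ‖g x‖ₑ ≤ ∫⁻ x, (‖f x‖ₑ + ‖r x‖ₑ + ∑ s ∈ F, ‖badPart f s x‖ₑ) := by
            refine lintegral_mono fun x => ?_
            have hgx : g x = f x - r x - ∑ s ∈ F, badPart f s x := by simp [hg]
            rw [hgx]
            exact enorm_sub_le.trans (add_le_add enorm_sub_le (enorm_sum_le _ _))
        _ = (∫⁻ x, ‖f x‖ₑ) + (∫⁻ x, ‖r x‖ₑ) + ∑ s ∈ F, ∫⁻ x, ‖badPart f s x‖ₑ := by
            rw [lintegral_add_left' (f := fun x => ‖f x‖ₑ + ‖r x‖ₑ) (hm1.add hm2), lintegral_add_left' hm1,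
              lintegral_finsetSum' _ fun s _ => (memLp_badPart s hf2).1.enorm]
        _ ≤ (∫⁻ x, ‖f x‖ₑ) + (∫⁻ x, ‖f x‖ₑ) + 2 * ∫⁻ x, ‖f x‖ₑ := by
            gcongr with x
            · rw [hr, enorm_indicator_eq_indicator_enorm]
              exact Set.indicator_le_self _ _ _
            · calc _ ≤ ∑ s ∈ F, 2 * ∫⁻ x in dyadicCube s.1 s.2, ‖f x‖ₑ :=
                    Finset.sum_le_sum fun s _ => lintegral_badPart_le s hf.1
                _ = 2 * ∫⁻ x in ⋃ s ∈ F, dyadicCube s.1 s.2, ‖f x‖ₑ := by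
                    rw [lintegral_biUnion_finset (fun s hs t ht => hMd (hFM hs) (hFM ht))
                      fun s _ => measurableSet_dyadicCube _ _, Finset.mul_sum]
                _ ≤ _ := mul_le_mul_right (setLIntegral_le_lintegral _ _) _
        _ = _ := by ring
    calc ∫⁻ x, ‖g x‖ₑ ^ 2 ≤ ∫⁻ x, 2 ^ d * a * ‖g x‖ₑ := by
          refine lintegral_mono_ae ?_
          filter_upwards [hgb] with x hx
          rw [sq]; gcongr
      _ = 2 ^ d * a * ∫⁻ x, ‖g x‖ₑ :=
          lintegral_const_mul'' _ ((hf2.sub hrm).sub hsF2).1.enorm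
      _ ≤ _ := by gcongr
  · have : ∀ x, ‖r x‖ₑ ^ 2 = R.union.indicator (fun x => ‖f x‖ₑ ^ 2) x := by
      intro x
      by_cases h : x ∈ R.union <;> simp [hr, h]
    simp only [this]
    rw [lintegral_indicator R.measurableSet_union, CubeFamily.union,
      lintegral_biUnion R.to_countable (fun _ _ => measurableSet_dyadicCube _ _) hRd]
    refine le_trans (le_of_eq ?_) hF₀.le
    have hmem : ∀ s : M, s ∉ F₀ ↔ s.1 ∈ R := by
      intro s
      simp [hR, hF]
    exact Equiv.tsum_eq (⟨fun s => ⟨⟨s.1, s.2.1⟩, (hmem ⟨s.1, s.2.1⟩).2 s.2⟩,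
      fun s => ⟨s.1.1, (hmem s.1).1 s.2⟩, fun _ => rfl, fun _ => rfl⟩ : R ≃ {s : M // s ∉ F₀})
      (fun s : {s : M // s ∉ F₀} => ∫⁻ x in dyadicCube s.1.1.1 s.1.1.2, ‖f x‖ₑ ^ 2)

/-- Calderón–Zygmund decomposition at height a. The good part and the small remainder obey
Chebyshev's inequality in L². The triples of the stopping cubes have measure O(‖f‖₁/a) and are
discarded. Off them the mean-zero bad parts are integrable after T, by the decay of the kernel tail.
-/
theorem HasKernel.hasWeakType {d : ℕ} (hd : 0 < d) {T : LTwoOp d} {K : Rd d → Rd d → ℂ}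
    {c δ : ℝ} (hK : IsStandardKernel K c δ) (hT : HasKernel T K) :
    ∃ C : ℝ≥0, HasWeakType T C := by
  set A : ℝ≥0∞ := ENNReal.ofReal (2 * c * (2 * d) ^ δ) with hA
  set q : ℝ≥0∞ := ENNReal.ofReal ((2 : ℝ) ^ (-δ)) with hq
  set A' : ℝ≥0∞ := A * (1 - q)⁻¹ * 6 ^ d with hA'
  have hq1 : q < 1 := by
    rw [hq, ENNReal.ofReal_lt_one]
    exact Real.rpow_lt_one_of_one_lt_of_neg (by norm_num) (by linarith [hK.pos])
  have hA't : A' ≠ ⊤ := by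
    refine ENNReal.mul_ne_top (ENNReal.mul_ne_top ENNReal.ofReal_ne_top ?_) (by simp)
    exact ENNReal.inv_ne_top.2 (tsub_pos_of_lt hq1).ne'
  -- The summands belong to the good part, the remainder, the triples of the stopping cubes, and the
  -- bad parts off those triples. The factors 9 and 6 = 3 · 2 contain the thresholds a/3.
  set C : ℝ≥0∞ := 9 * ‖T‖ₑ ^ 2 * (2 ^ d * 4) + 9 * ‖T‖ₑ ^ 2 + 3 ^ d + 6 * A' with hC
  have hCt : C ≠ ⊤ := by
    simp [hC, ENNReal.mul_eq_top, ENNReal.add_eq_top, hA't]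
  refine ⟨C.toNNReal, fun f hf2 a ha0 hat => ?_⟩
  rw [ENNReal.coe_toNNReal hCt]
  rcases eq_or_ne (∫⁻ x, ‖f x‖ₑ) ⊤ with hft | hft
  · rw [hft, ENNReal.mul_top]
    · exact le_top
    · have h3 : (0 : ℝ≥0∞) < 3 ^ d := by positivity
      refine (h3.trans_le ?_).ne'
      rw [hC]
      exact le_add_right le_add_self
  rcases eq_or_ne (∫⁻ x, ‖f x‖ₑ) 0 with hf0 | hf0
  · have h0 : f =ᵐ[volume] 0 := by
      rw [lintegral_eq_zero_iff' hf2.1.enorm] at hf0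
      filter_upwards [hf0] with x hx using by simpa using hx
    rw [opFun_congr T hf2 h0]
    have h1 : volume {x | a < ‖opFun T (0 : Rd d → ℂ) x‖ₑ} = 0 := by
      rw [← compl_mem_ae_iff]
      filter_upwards [opFun_zero T] with x hx
      simp [hx]
    simp [h1]
  have hf : Integrable f volume := ⟨hf2.1, lt_top_iff_ne_top.2 hft⟩
  obtain ⟨M, F, g, r, hMd, hFM, hMsum, hg, hr, hfeq, hgI, hrI⟩ :=
    exists_cz_decomposition hd hf hf2 ha0 hf0
  set I := ∫⁻ x, ‖f x‖ₑ with hI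
  have hsF2 : MemLp (∑ s ∈ F, badPart f s) 2 volume :=
    memLp_finsetSum' F fun s _ => memLp_badPart s hf2
  have h3 : a / 3 ≠ 0 := ENNReal.div_ne_zero.2 ⟨ha0, by simp⟩
  have h3t : a / 3 ≠ ⊤ := ENNReal.div_ne_top hat (by simp)
  set G : Set (Rd d) := ⋃ s ∈ M, tripleCube s.1 s.2 with hG
  set u : Rd d → ℂ := opFun T (∑ s ∈ F, badPart f s) with hu
  set E₁ := {x | a / 3 < ‖opFun T g x‖ₑ} with hE₁
  set E₂ := {x | a / 3 < ‖opFun T r x‖ₑ} with hE₂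
  set E₃ := {x | a / 3 ≤ Gᶜ.indicator (fun x => ‖u x‖ₑ) x} with hE₃
  have hGm : MeasurableSet G :=
    MeasurableSet.biUnion M.to_countable fun s _ => measurableSet_tripleCube _ _
  have hsub : ({x | a < ‖opFun T f x‖ₑ} : Set (Rd d)) ≤ᵐ[volume]
      (E₁ ∪ E₂ ∪ (G ∪ E₃) : Set (Rd d)) := by
    have e1 := opFun_add T (hg.add hr) hsF2
    rw [← hfeq] at e1
    filter_upwards [e1, opFun_add T hg hr] with x h1 h2 hx
    have hx' : a < ‖opFun T f x‖ₑ := hx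
    by_contra hcon
    have hcon' : x ∉ E₁ ∪ E₂ ∪ (G ∪ E₃) := hcon
    simp only [Set.mem_union, not_or] at hcon'
    obtain ⟨⟨c1, c2⟩, c3, c4⟩ := hcon'
    simp only [hE₁, hE₂, hE₃, Set.mem_ofPred_eq, not_lt, not_le] at c1 c2 c4
    rw [Set.indicator_of_mem (show x ∈ Gᶜ from c3)] at c4
    rw [h1, Pi.add_apply, h2, Pi.add_apply] at hx'
    have : ‖opFun T g x + opFun T r x + u x‖ₑ ≤ a / 3 + a / 3 + a / 3 :=
      (enorm_add_le _ _).trans (add_le_add ((enorm_add_le _ _).trans (add_le_add c1 c2)) c4.le)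
    rw [ENNReal.add_thirds] at this
    exact absurd hx' (not_lt.2 this)
  have sq_bound : ∀ (h : Rd d → ℂ) (D : ℝ≥0∞), MemLp h 2 volume →
      ∫⁻ x, ‖h x‖ₑ ^ 2 ≤ D * a * I →
      a * volume {x | a / 3 < ‖opFun T h x‖ₑ} ≤ 9 * ‖T‖ₑ ^ 2 * D * I := by
    intro h D hh hD
    have h1 := sq_mul_volume_le (memLp_opFun T (f := h)).1.aemeasurable (a / 3)
    have h2 := h1.trans ((lintegral_opFun_sq_le T hh).trans (mul_le_mul_right hD _))
    rw [← ENNReal.mul_le_mul_iff_right ha0 hat]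
    calc a * (a * volume {x | a / 3 < ‖opFun T h x‖ₑ})
        = 9 * ((a / 3) ^ 2 * volume {x | a / 3 < ‖opFun T h x‖ₑ}) := by
          have : a = 3 * (a / 3) := (ENNReal.mul_div_cancel (by norm_num) (by norm_num)).symm
          nth_rewrite 1 [this]
          nth_rewrite 2 [this]
          ring
      _ ≤ 9 * (‖T‖ₑ ^ 2 * (D * a * I)) := by gcongr
      _ = _ := by ring
  have hb1 := sq_bound g (2 ^ d * 4) hg (hgI.trans (le_of_eq (by ring)))
  have hb2 := sq_bound r 1 hr (hrI.trans (le_of_eq (by ring)))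
  have hb3 : a * volume G ≤ 3 ^ d * I := by
    calc a * volume G ≤ a * ∑' s : M, volume (tripleCube s.1.1 s.1.2) := by
          gcongr; exact measure_biUnion_le _ M.to_countable _
      _ = 3 ^ d * (a * ∑' s : M, volume (dyadicCube s.1.1 s.1.2)) := by
          simp only [volume_tripleCube, ENNReal.tsum_mul_left]; ring
      _ ≤ _ := by gcongr
  have hb4 : a * volume E₃ ≤ 6 * A' * I := by
    have hae : ∀ᵐ x ∂(volume : Measure (Rd d)), Gᶜ.indicator (fun x => ‖u x‖ₑ) x ≤
        ∑ s ∈ F, kernelTail A q s.1 (exists_mem_dyadicCube s.1 s.2).some x *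
          ∫⁻ y, ‖badPart f s y‖ₑ := by
      have e1 : ∀ᵐ x ∂(volume : Measure (Rd d)), ∀ s ∈ F, x ∉ tripleCube s.1 s.2 →
          ‖opFun T (badPart f s) x‖ₑ ≤
            kernelTail A q s.1 (exists_mem_dyadicCube s.1 s.2).some x *
            ∫⁻ y, ‖badPart f s y‖ₑ := by
        refine (ae_ball_iff F.countable_toSet).2 fun s _ => ?_
        have hs : dyadicIdx s.1 (exists_mem_dyadicCube s.1 s.2).some = s.2 :=
          (exists_mem_dyadicCube s.1 s.2).some_mem
        have := hT.enorm_opFun_le hd hK (memLp_badPart s hf2) s.1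
          (exists_mem_dyadicCube s.1 s.2).some
          (fun x hx => Set.indicator_of_notMem (by rwa [hs] at hx) _) (integral_badPart s)
        rwa [hs] at this
      filter_upwards [e1, opFun_finset_sum T F _ fun s _ => memLp_badPart s hf2] with x h1 h2
      by_cases hx : x ∈ G
      · simp [hx]
      · rw [Set.indicator_of_mem (show x ∈ Gᶜ from hx), hu, h2, Finset.sum_apply]
        refine (enorm_sum_le _ _).trans (Finset.sum_le_sum fun s hs => h1 s hs fun h => hx ?_)
        exact Set.mem_biUnion (hFM hs) h
    have hmeas : AEMeasurable (Gᶜ.indicator fun x => ‖u x‖ₑ) volume :=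
      (memLp_opFun T).1.enorm.indicator hGm.compl
    have hch := mul_meas_ge_le_lintegral₀ hmeas (a / 3)
    have hint : ∫⁻ x, Gᶜ.indicator (fun x => ‖u x‖ₑ) x ≤ 2 * A' * I := by
      calc _ ≤ ∫⁻ x, ∑ s ∈ F, kernelTail A q s.1 (exists_mem_dyadicCube s.1 s.2).some x *
              ∫⁻ y, ‖badPart f s y‖ₑ := lintegral_mono_ae hae
        _ ≤ ∑ s ∈ F, A' * (2 * ∫⁻ x in dyadicCube s.1 s.2, ‖f x‖ₑ) := by
            have hkm : ∀ s : ℤ × (Fin d → ℤ), Measurable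
                (kernelTail A q s.1 (exists_mem_dyadicCube s.1 s.2).some) := by
              intro s
              refine Measurable.tsum fun j => Measurable.const_mul ?_ _
              exact measurable_one.indicator (measurableSet_tripleCube _ _)
            rw [lintegral_finsetSum _ fun s _ => (hkm s).mul_const _]
            refine Finset.sum_le_sum fun s _ => ?_
            rw [lintegral_mul_const _ (hkm s)]
            gcongr
            · exact lintegral_kernelTail_le A q _ _
            · exact lintegral_badPart_le s hf.1
        _ = 2 * A' * ∫⁻ x in ⋃ s ∈ F, dyadicCube s.1 s.2, ‖f x‖ₑ := by
            rw [lintegral_biUnion_finset (fun s hs t ht => hMd (hFM hs) (hFM ht))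
              fun s _ => measurableSet_dyadicCube _ _, Finset.mul_sum]
            exact Finset.sum_congr rfl fun s _ => by ring
        _ ≤ _ := mul_le_mul_right (setLIntegral_le_lintegral _ _) _
    calc a * volume E₃ = 3 * (a / 3 * volume E₃) := by
          rw [← mul_assoc, ENNReal.mul_div_cancel (by norm_num) (by norm_num)]
      _ ≤ 3 * (2 * A' * I) := mul_le_mul_right (hch.trans hint) _
      _ = _ := by ring
  calc a * volume {x | a < ‖opFun T f x‖ₑ}
      ≤ a * (volume E₁ + volume E₂ + (volume G + volume E₃)) := by
        gcongr
        refine (measure_mono_ae hsub).trans ((measure_union_le _ _).trans ?_)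
        exact add_le_add (measure_union_le _ _) (measure_union_le _ _)
    _ = a * volume E₁ + a * volume E₂ + (a * volume G + a * volume E₃) := by ring
    _ ≤ 9 * ‖T‖ₑ ^ 2 * (2 ^ d * 4) * I + 9 * ‖T‖ₑ ^ 2 * 1 * I + (3 ^ d * I + 6 * A' * I) := by
        gcongr
    _ = C * I := by rw [hC]; ring

/-! ### The extension of the operator to `L¹` -/

section values

variable {d : ℕ} {T : LTwoOp d} {C : ℝ≥0} {f g : Rd d → ℂ}

theorem HasWeakType.volume_le (hT : HasWeakType T C) (hf : MemLp f 2 volume) {a : ℝ≥0∞}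
    (ha0 : a ≠ 0) (hat : a ≠ ⊤) :
    volume {x | a < ‖opFun T f x‖ₑ} ≤ C * (∫⁻ x, ‖f x‖ₑ) / a := by
  rw [ENNReal.le_div_iff_mul_le (Or.inl ha0) (Or.inl hat), mul_comm]
  exact hT f hf a ha0 hat

theorem HasWeakType.tendsto_volume (hT : HasWeakType T C) {h : ℕ → Rd d → ℂ}
    (hh : ∀ n, MemLp (h n) 2 volume)
    (hlim : Tendsto (fun n => ∫⁻ x, ‖h n x‖ₑ) atTop (𝓝 0)) {a : ℝ≥0∞} (ha0 : a ≠ 0)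
    (hat : a ≠ ⊤) : Tendsto (fun n => volume {x | a < ‖opFun T (h n) x‖ₑ}) atTop (𝓝 0) := by
  have h1 : Tendsto (fun n => C * (∫⁻ x, ‖h n x‖ₑ) / a) atTop (𝓝 (C * 0 / a)) :=
    ENNReal.Tendsto.div_const (ENNReal.Tendsto.const_mul hlim (Or.inr ENNReal.coe_ne_top))
      (Or.inr ha0)
  rw [mul_zero, ENNReal.zero_div] at h1
  exact tendsto_of_tendsto_of_tendsto_of_le_of_le tendsto_const_nhds h1 (fun _ => zero_le)
    fun n => hT.volume_le (hh n) ha0 hat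

/-- The operators converge in measure along every approximation in `L¹`. -/
theorem IsValue.tendstoInMeasure (hT : HasWeakType T C) (hfg : IsValue T f g)
    {h : ℕ → Rd d → ℂ} (hh : ∀ n, MemLp (h n) 2 volume)
    (hlim : Tendsto (fun n => ∫⁻ x, ‖h n x - f x‖ₑ) atTop (𝓝 0))
    (hm : AEStronglyMeasurable f volume) :
    TendstoInMeasure volume (fun n => opFun T (h n)) atTop g := by
  obtain ⟨φ, hφi, hφ, hTφ⟩ := hfg
  simp only [eLpNorm_one_eq_lintegral_enorm] at hφ
  have hd : Tendsto (fun n => ∫⁻ x, ‖(h n - φ n) x‖ₑ) atTop (𝓝 0) := by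
    have hs := hlim.add hφ
    rw [add_zero] at hs
    refine tendsto_of_tendsto_of_tendsto_of_le_of_le tendsto_const_nhds hs (fun _ => zero_le)
      fun n => ?_
    have hle : ∀ x, ‖(h n - φ n) x‖ₑ ≤ ‖h n x - f x‖ₑ + ‖φ n x - f x‖ₑ := fun x => by
      rw [Pi.sub_apply, show h n x - φ n x = (h n x - f x) - (φ n x - f x) by ring]
      exact enorm_sub_le
    exact (lintegral_mono hle).trans
      (lintegral_add_left' ((hh n).1.sub hm).enorm _).le
  rw [tendstoInMeasure_iff_enorm] at hTφ ⊢
  intro ε hε hεt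
  have hε2 : ε / 2 ≠ 0 := (ENNReal.half_pos hε.ne').ne'
  have hε2t : ε / 2 ≠ ⊤ := ENNReal.div_ne_top hεt (by simp)
  -- The weak type bound controls strict superlevel sets only; the smaller threshold ε/4 restores a
  -- strict inequality in the sum.
  have hε4 : ε / 2 / 2 ≠ 0 := (ENNReal.half_pos hε2).ne'
  have hε4t : ε / 2 / 2 ≠ ⊤ := ENNReal.div_ne_top hε2t (by simp)
  have h1 := hTφ (ε / 2) (pos_iff_ne_zero.2 hε2) hε2t
  have h2 := hT.tendsto_volume (fun n => (hh n).sub (Lp.memLp (φ n))) hd hε4 hε4t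
  have hs := h1.add h2
  rw [add_zero] at hs
  refine tendsto_of_tendsto_of_tendsto_of_le_of_le tendsto_const_nhds hs (fun _ => zero_le)
    fun n => ?_
  refine le_trans (measure_mono_ae ?_) (measure_union_le _ _)
  filter_upwards [opFun_sub T (hh n) (Lp.memLp (φ n))] with x hx hmem
  have hmem' : ε ≤ ‖opFun T (h n) x - g x‖ₑ := hmem
  by_contra hcon
  have hcon' : ¬ ((ε / 2 ≤ ‖T (φ n) x - g x‖ₑ) ∨ (ε / 2 / 2 < ‖opFun T (h n - φ n) x‖ₑ)) := hcon
  rw [not_or, not_le, not_lt, hx, Pi.sub_apply, opFun_coe] at hcon'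
  have : ‖opFun T (h n) x - g x‖ₑ < ε / 2 + ε / 2 := by
    calc ‖opFun T (h n) x - g x‖ₑ
        = ‖(T (φ n) x - g x) + (opFun T (h n) x - T (φ n) x)‖ₑ := by congr 1; ring
      _ ≤ ‖T (φ n) x - g x‖ₑ + ‖opFun T (h n) x - T (φ n) x‖ₑ := enorm_add_le _ _
      _ < ε / 2 + ε / 2 := ENNReal.add_lt_add hcon'.1
          (hcon'.2.trans_lt (ENNReal.half_lt_self hε2 hε2t))
  rw [ENNReal.add_halves] at this
  exact absurd hmem' (not_le.2 this)

theorem IsValue.ae_eq (hT : HasWeakType T C) (hm : AEStronglyMeasurable f volume) {g' : Rd d → ℂ}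
    (h : IsValue T f g) (h' : IsValue T f g') : g =ᵐ[volume] g' := by
  obtain ⟨φ, hφi, hφ, hTφ⟩ := h'
  simp only [eLpNorm_one_eq_lintegral_enorm] at hφ
  have := h.tendstoInMeasure hT (fun n => Lp.memLp (φ n)) hφ hm
  simp only [opFun_coe] at this
  exact tendstoInMeasure_ae_unique this hTφ

theorem exists_memLp_two_near (hf : Integrable f volume) {ε : ℝ≥0∞} (hε : ε ≠ 0) :
    ∃ h : Rd d → ℂ, MemLp h 2 volume ∧ Integrable h volume ∧ ∫⁻ x, ‖h x - f x‖ₑ < ε := by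
  obtain ⟨h, h1, h2⟩ := (memLp_one_iff_integrable.2 hf).exists_simpleFunc_eLpNorm_sub_lt
    (by simp) hε
  refine ⟨h, ?_, memLp_one_iff_integrable.1 h2, ?_⟩
  · rw [SimpleFunc.memLp_iff_finMeasSupp (by simp) (by simp)] at h2 ⊢
    exact h2
  · rw [eLpNorm_one_eq_lintegral_enorm] at h1
    refine lt_of_eq_of_lt (lintegral_congr fun x => ?_) h1
    rw [Pi.sub_apply, ← enorm_neg, neg_sub]

theorem isValue_of_tendstoInMeasure {h : ℕ → Rd d → ℂ} (hh : ∀ n, MemLp (h n) 2 volume)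
    (hi : ∀ n, Integrable (h n) volume)
    (hlim : Tendsto (fun n => ∫⁻ x, ‖h n x - f x‖ₑ) atTop (𝓝 0))
    (hg : TendstoInMeasure volume (fun n => opFun T (h n)) atTop g) : IsValue T f g := by
  refine ⟨fun n => (hh n).toLp (h n), fun n => (hi n).congr (hh n).coeFn_toLp.symm, ?_, ?_⟩
  · simp only [eLpNorm_one_eq_lintegral_enorm]
    refine hlim.congr fun n => lintegral_congr_ae ?_
    filter_upwards [(hh n).coeFn_toLp] with x hx
    rw [hx]
  · refine hg.congr_left fun n => ?_
    rw [opFun_eq T (hh n)]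

/-- Approximations with L¹ error 4^{-n} make consecutive images differ by more than 2^{-n} only on
sets of summable measure, by the weak type inequality. Borel–Cantelli gives a pointwise limit.
Convergence in measure does not follow from that alone, as the space has infinite measure; it comes
from the explicit bound 2 · 2^{-n} off the union of the tail sets. -/
theorem exists_isValue (hT : HasWeakType T C) (hf : Integrable f volume) :
    ∃ g, IsValue T f g := by
  have h4 : ∀ n : ℕ, ((4 : ℝ≥0∞) ^ n)⁻¹ ≠ 0 := fun n => by simp
  choose h hh2 hhi hhε using fun n => exists_memLp_two_near hf (h4 n)
  set u : ℕ → Rd d → ℂ := fun n => opFun T (h n) with hu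
  have h2pos : ∀ n : ℕ, ((2 : ℝ≥0∞) ^ n)⁻¹ ≠ 0 := fun n => by simp
  have h2top : ∀ n : ℕ, ((2 : ℝ≥0∞) ^ n)⁻¹ ≠ ⊤ := fun n => by simp
  set s : ℕ → Set (Rd d) := fun n => {x | ((2 : ℝ≥0∞) ^ n)⁻¹ < ‖u (n + 1) x - u n x‖ₑ} with hs
  have hsm : ∀ n, volume (s n) ≤ 2 * C * (2⁻¹) ^ n := by
    intro n
    have hle : ∫⁻ x, ‖(h (n + 1) - h n) x‖ₑ ≤ 2 * (4 ^ n)⁻¹ := by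
      calc ∫⁻ x, ‖(h (n + 1) - h n) x‖ₑ
          ≤ ∫⁻ x, (‖h (n + 1) x - f x‖ₑ + ‖h n x - f x‖ₑ) := by
            refine lintegral_mono fun x => ?_
            rw [Pi.sub_apply, show h (n + 1) x - h n x = (h (n + 1) x - f x) - (h n x - f x) by ring]
            exact enorm_sub_le
        _ = (∫⁻ x, ‖h (n + 1) x - f x‖ₑ) + ∫⁻ x, ‖h n x - f x‖ₑ :=
            lintegral_add_left' ((hhi (n + 1)).1.sub hf.1).enorm _
        _ ≤ (4 ^ (n + 1))⁻¹ + (4 ^ n)⁻¹ := add_le_add (hhε _).le (hhε _).le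
        _ ≤ (4 ^ n)⁻¹ + (4 ^ n)⁻¹ := by
            gcongr <;> norm_num
        _ = _ := (two_mul _).symm
    have h1 := hT.volume_le ((hh2 (n + 1)).sub (hh2 n)) (h2pos n) (h2top n)
    have h2 : volume (s n) ≤ volume {x | ((2 : ℝ≥0∞) ^ n)⁻¹ < ‖opFun T (h (n + 1) - h n) x‖ₑ} := by
      refine measure_mono_ae ?_
      filter_upwards [opFun_sub T (hh2 (n + 1)) (hh2 n)] with x hx hmem
      have hmem' : ((2 : ℝ≥0∞) ^ n)⁻¹ < ‖u (n + 1) x - u n x‖ₑ := hmem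
      change ((2 : ℝ≥0∞) ^ n)⁻¹ < ‖opFun T (h (n + 1) - h n) x‖ₑ
      rwa [hx]
    refine h2.trans (h1.trans ?_)
    rw [div_eq_mul_inv, inv_inv]
    calc C * (∫⁻ x, ‖(h (n + 1) - h n) x‖ₑ) * 2 ^ n ≤ C * (2 * (4 ^ n)⁻¹) * 2 ^ n := by gcongr
      _ = 2 * C * (((2 : ℝ≥0∞) ^ n)⁻¹ * (((2 : ℝ≥0∞) ^ n)⁻¹ * 2 ^ n)) := by
          rw [show (4 : ℝ≥0∞) = 2 * 2 by norm_num, mul_pow, ENNReal.mul_inv (by simp) (by simp)]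
          ring
      _ = _ := by
          rw [ENNReal.inv_mul_cancel (by simp) (by simp), mul_one, ENNReal.inv_pow]
  have hsum : ∑' n, volume (s n) ≠ ⊤ := by
    refine ((ENNReal.tsum_le_tsum hsm).trans_lt ?_).ne
    rw [ENNReal.tsum_mul_left, ENNReal.tsum_geometric]
    refine ENNReal.mul_lt_top (ENNReal.mul_lt_top (by simp) (by simp)) ?_
    simp
  have hgeom : ∀ (n : ℕ) (x : Rd d), (∀ k ≥ n, x ∉ s k) →
      ∀ k, edist (u (n + k) x) (u (n + (k + 1)) x) ≤ 2 * (2 ^ n)⁻¹ / 2 / 2 ^ k := by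
    intro n x hx k
    have := hx (n + k) (by omega)
    simp only [hs, Set.mem_ofPred_eq, not_lt] at this
    rw [edist_comm, edist_eq_enorm_sub]
    refine this.trans (le_of_eq ?_)
    rw [pow_add, ENNReal.mul_inv (by simp) (by simp), div_eq_mul_inv, div_eq_mul_inv]
    rw [mul_comm 2 ((2 : ℝ≥0∞) ^ n)⁻¹, mul_assoc ((2 : ℝ≥0∞) ^ n)⁻¹ 2,
      ENNReal.mul_inv_cancel (by simp) (by simp), mul_one]
  have hev := ae_eventually_notMem hsum
  have hconv : ∀ᵐ x ∂(volume : Measure (Rd d)), ∃ l, Tendsto (fun n => u n x) atTop (𝓝 l) := by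
    filter_upwards [hev] with x hx
    obtain ⟨n, hn⟩ := eventually_atTop.1 hx
    have := hgeom n x hn
    have hc : CauchySeq fun k => u (n + k) x :=
      cauchySeq_of_edist_le_geometric_two _
        (ENNReal.div_ne_top (ENNReal.mul_ne_top (by simp) (h2top n)) (by simp)) this
    obtain ⟨l, hl⟩ := cauchySeq_tendsto_of_complete hc
    refine ⟨l, ?_⟩
    rw [← tendsto_add_atTop_iff_nat n]
    simpa only [add_comm] using hl
  classical
  set g : Rd d → ℂ := fun x => if hx : ∃ l, Tendsto (fun n => u n x) atTop (𝓝 l) then hx.choose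
    else 0 with hgdef
  have hg : ∀ᵐ x ∂(volume : Measure (Rd d)), Tendsto (fun n => u n x) atTop (𝓝 (g x)) := by
    filter_upwards [hconv] with x hx
    simp only [hgdef, hx, dif_pos]
    exact hx.choose_spec
  refine ⟨g, isValue_of_tendstoInMeasure hh2 hhi ?_ ?_⟩
  · have : Tendsto (fun n : ℕ => ((4 : ℝ≥0∞) ^ n)⁻¹) atTop (𝓝 0) := by
      simp only [ENNReal.inv_pow]
      exact ENNReal.tendsto_pow_atTop_nhds_zero_of_lt_one (by simp)
    exact tendsto_of_tendsto_of_tendsto_of_le_of_le tendsto_const_nhds this (fun _ => zero_le)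
      fun n => (hhε n).le
  · rw [tendstoInMeasure_iff_enorm]
    intro ε hε hεt
    have htail : Tendsto (fun n => ∑' k, volume (s (k + n))) atTop (𝓝 0) :=
      ENNReal.tendsto_sum_nat_add _ hsum
    refine tendsto_of_tendsto_of_tendsto_of_le_of_le' tendsto_const_nhds htail
      (Eventually.of_forall fun _ => zero_le) ?_
    have h2lim : Tendsto (fun n : ℕ => 2 * ((2 : ℝ≥0∞) ^ n)⁻¹) atTop (𝓝 0) := by
      have : Tendsto (fun n : ℕ => ((2 : ℝ≥0∞) ^ n)⁻¹) atTop (𝓝 0) := by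
        simp only [ENNReal.inv_pow]
        exact ENNReal.tendsto_pow_atTop_nhds_zero_of_lt_one (by simp)
      simpa using ENNReal.Tendsto.const_mul (a := 2) this (Or.inr (by simp))
    filter_upwards [(tendsto_order.1 h2lim).2 ε hε] with n hn
    refine le_trans (measure_mono_ae ?_) (measure_iUnion_le _)
    filter_upwards [hg] with x hx hmem
    have hmem' : ε ≤ ‖u n x - g x‖ₑ := hmem
    by_contra hcon
    have hcon' : x ∉ ⋃ k, s (k + n) := hcon
    simp only [Set.mem_iUnion, not_exists] at hcon'
    have hxk : ∀ k ≥ n, x ∉ s k := fun k hk => by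
      have := hcon' (k - n)
      rwa [Nat.sub_add_cancel hk] at this
    have hxt : Tendsto (fun k => u (n + k) x) atTop (𝓝 (g x)) := by
      simp only [add_comm n]
      exact (tendsto_add_atTop_iff_nat (f := fun n => u n x) n).2 hx
    have := edist_le_of_edist_le_geometric_two_of_tendsto₀ _ (hgeom n x hxk) hxt
    rw [add_zero, edist_eq_enorm_sub, ENNReal.mul_div_cancel (by simp) (by simp)] at this
    exact absurd (hmem'.trans this) (not_le.2 hn)

end values

/-! ### Auerbach bases -/

/-- Maximize |det| over n-tuples in the unit ball. By Cramer's rule the i-th coordinate of `w` is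
the determinant with `w` in place i divided by the maximal one, hence at most ‖w‖. -/
theorem exists_auerbach_basis (W : Type*) [NormedAddCommGroup W] [NormedSpace ℂ W]
    [FiniteDimensional ℂ W] :
    ∃ b : Module.Basis (Fin (Module.finrank ℂ W)) ℂ W,
      (∀ i, ‖b i‖ ≤ 1) ∧ ∀ i w, ‖b.repr w i‖ ≤ ‖w‖ := by
  classical
  set n := Module.finrank ℂ W
  have : ProperSpace W := FiniteDimensional.proper ℂ W
  set e : Module.Basis (Fin n) ℂ W := Module.finBasis ℂ W
  have hcont : Continuous fun v : Fin n → W => ‖e.det v‖ := by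
    refine Continuous.norm ?_
    change Continuous fun v : Fin n → W => (e.toMatrix v).det
    refine Continuous.matrix_det (continuous_matrix fun i j => ?_)
    exact (LinearMap.continuous_of_finiteDimensional (e.coord i)).comp (continuous_apply j)
  obtain ⟨v, hv, hmax⟩ := (isCompact_closedBall (0 : Fin n → W) 1).exists_isMaxOn
    ⟨0, by simp⟩ hcont.continuousOn
  have hmem : ∀ w : Fin n → W, w ∈ Metric.closedBall (0 : Fin n → W) 1 ↔ ∀ i, ‖w i‖ ≤ 1 := by
    intro w
    rw [mem_closedBall_zero_iff, pi_norm_le_iff_of_nonneg zero_le_one]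
  have hpos : 0 < ‖e.det v‖ := by
    have hw : (fun i => ((‖e i‖ : ℂ)⁻¹) • e i) ∈ Metric.closedBall (0 : Fin n → W) 1 := by
      rw [hmem]
      intro i
      rw [norm_smul, norm_inv, Complex.norm_real, norm_norm,
        inv_mul_cancel₀ (norm_ne_zero_iff.2 (e.ne_zero i))]
    refine lt_of_lt_of_le ?_ (hmax hw)
    have h1 := e.det.toMultilinearMap.map_smul_univ (fun i => ((‖e i‖ : ℂ)⁻¹)) e
    have h2 : e.det (fun i => ((‖e i‖ : ℂ)⁻¹) • e i) = ∏ i, (‖e i‖ : ℂ)⁻¹ := by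
      simpa [e.det_self] using h1
    change 0 < ‖e.det (fun i => ((‖e i‖ : ℂ)⁻¹) • e i)‖
    rw [h2, norm_pos_iff]
    exact Finset.prod_ne_zero_iff.2 fun i _ => inv_ne_zero (by
      exact_mod_cast norm_ne_zero_iff.2 (e.ne_zero i))
  obtain ⟨hli, hsp⟩ := (Module.Basis.is_basis_iff_det e).2 (isUnit_iff_ne_zero.2 (norm_pos_iff.1 hpos))
  refine ⟨Module.Basis.mk hli hsp.ge, fun i => ?_, fun i w => ?_⟩
  · rw [Module.Basis.mk_apply]; exact (hmem v).1 hv i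
  · have key : ∀ w, e.det v * (Module.Basis.mk hli hsp.ge).repr w i =
        e.det (Function.update v i w) := by
      intro w
      have := Module.Basis.det_smul_mk_coord_eq_det_update (e := e) hli hsp.ge i
      have := LinearMap.congr_fun this w
      simpa [smul_eq_mul] using this
    rcases eq_or_ne w 0 with rfl | hw
    · rw [map_zero]; simp
    have hw0 : 0 < ‖w‖ := norm_pos_iff.2 hw
    have hu : Function.update v i ((‖w‖ : ℂ)⁻¹ • w) ∈ Metric.closedBall (0 : Fin n → W) 1 := by
      rw [hmem]
      intro j
      rcases eq_or_ne j i with rfl | hj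
      · rw [Function.update_self, norm_smul, norm_inv, Complex.norm_real, norm_norm,
          inv_mul_cancel₀ hw0.ne']
      · rw [Function.update_of_ne hj]; exact (hmem v).1 hv j
    have h1 : ‖e.det (Function.update v i ((‖w‖ : ℂ)⁻¹ • w))‖ ≤ ‖e.det v‖ := hmax hu
    rw [← key, norm_mul, map_smul, Finsupp.smul_apply, norm_smul, norm_inv, Complex.norm_real,
      norm_norm] at h1
    have h2 := le_of_mul_le_mul_left (h1.trans_eq (mul_one _).symm) hpos
    rwa [inv_mul_le_iff₀ hw0, mul_one] at h2

/-- A well-conditioned spanning family for the image of a linear map. -/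
theorem exists_auerbach_family {ι E : Type*} [Fintype ι] [NormedAddCommGroup E] [NormedSpace ℂ E]
    (L : (ι → ℂ) →ₗ[ℂ] E) :
    ∃ (n : ℕ) (β : Fin n → ι → ℂ) (c : Fin n → (ι → ℂ) →ₗ[ℂ] ℂ), n ≤ Fintype.card ι ∧
      (∀ j, ‖L (β j)‖ ≤ 1) ∧ (∀ j w, ‖c j w‖ ≤ ‖L w‖) ∧ ∀ w, L w = ∑ j, c j w • L (β j) := by
  obtain ⟨b, hb1, hb2⟩ := exists_auerbach_basis (LinearMap.range L)
  choose β hβ using fun j => (b j).2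
  refine ⟨_, β, fun j => (b.coord j) ∘ₗ L.rangeRestrict, ?_, fun j => ?_, fun j w => ?_,
    fun w => ?_⟩
  · exact (LinearMap.finrank_range_le L).trans (by simp)
  · rw [hβ]; exact hb1 j
  · exact hb2 j _
  · have := b.sum_repr (L.rangeRestrict w)
    have h2 := congrArg (LinearMap.range L).subtype this
    simp only [map_sum, map_smul, Submodule.subtype_apply] at h2
    refine Eq.trans (show L w = (L.rangeRestrict w : E) from rfl) ?_
    rw [← h2]
    simp [hβ]

theorem memLp_dotProduct {ι : Type*} [Fintype ι] {d : ℕ} {μ : Measure (Rd d)} {q : ℝ≥0∞}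
    {F : Rd d → ι → ℂ} (hF : ∀ i, MemLp (fun x => F x i) q μ) (w : ι → ℂ) :
    MemLp (fun x => dotProduct w (F x)) q μ :=
  memLp_finsetSum _ fun i _ => (hF i).const_mul (w i)

/-- The seminorm w ↦ ‖w·F‖ in L¹(μ) may be degenerate, so the Auerbach basis is taken in the image
of w ↦ w·F and lifted. It reduces estimates for all covectors to the functions β_j·F of L¹ norm at
most one, whose number is bounded independently of `F` and `μ`. -/
theorem exists_auerbach_functions {ι : Type*} [Fintype ι] {d : ℕ} {μ : Measure (Rd d)}
    {F : Rd d → ι → ℂ} (hF : ∀ i, Integrable (fun x => F x i) μ) :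
    ∃ (n : ℕ) (β : Fin n → ι → ℂ) (c : Fin n → (ι → ℂ) →ₗ[ℂ] ℂ), n ≤ Fintype.card ι ∧
      (∀ j, ∫⁻ x, ‖dotProduct (β j) (F x)‖ₑ ∂μ ≤ 1) ∧
      (∀ j w, ‖c j w‖ₑ ≤ ∫⁻ x, ‖dotProduct w (F x)‖ₑ ∂μ) ∧
      ∀ w, ∀ᵐ x ∂μ, dotProduct w (F x) = ∑ j, c j w * dotProduct (β j) (F x) := by
  have hm : ∀ w, MemLp (fun x => dotProduct w (F x)) 1 μ :=
    memLp_dotProduct fun i => memLp_one_iff_integrable.2 (hF i)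
  set L : (ι → ℂ) →ₗ[ℂ] Lp ℂ 1 μ :=
    { toFun := fun w => (hm w).toLp _
      map_add' := fun v w => by
        rw [← MemLp.toLp_add]
        congr 1
        ext x; simp [add_dotProduct]
      map_smul' := fun a w => by
        rw [← MemLp.toLp_const_smul]
        congr 1
        ext x; simp [smul_dotProduct] } with hL
  have hLn : ∀ w, ‖L w‖ₑ = ∫⁻ x, ‖dotProduct w (F x)‖ₑ ∂μ := fun w => by
    change ‖(hm w).toLp _‖ₑ = _
    rw [Lp.enorm_toLp, eLpNorm_one_eq_lintegral_enorm]
  obtain ⟨n, β, c, hn, h1, h2, h3⟩ := exists_auerbach_family L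
  refine ⟨n, β, c, hn, fun j => ?_, fun j w => ?_, fun w => ?_⟩
  · rw [← hLn, ← ofReal_norm, ENNReal.ofReal_le_one]; exact h1 j
  · rw [← hLn]; exact enorm_le_iff_norm_le.2 (h2 j w)
  · have e : L w =ᵐ[μ] fun x => ∑ j, c j w * dotProduct (β j) (F x) := by
      rw [h3 w]
      have h4 : ∀ᵐ x ∂μ, ∀ j, (c j w • L (β j) : Lp ℂ 1 μ) x =
          c j w * dotProduct (β j) (F x) := by
        refine ae_all_iff.2 fun j => ?_
        filter_upwards [Lp.coeFn_smul (c j w) (L (β j)), (hm (β j)).coeFn_toLp] with x h5 h6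
        rw [h5, Pi.smul_apply, smul_eq_mul]
        congr 1
      filter_upwards [Lp.coeFn_finsetSum Finset.univ fun j => (c j w • L (β j) : Lp ℂ 1 μ), h4]
        with x h5 h6
      rw [h5, Finset.sum_apply]
      exact Finset.sum_congr rfl fun j _ => h6 j
    filter_upwards [e, (hm w).coeFn_toLp] with x h5 h6
    rw [← h5, ← h6]
    rfl

/-! ### The maximal function over tripled dyadic cubes -/

theorem tripleCube_eq_biUnion {d : ℕ} (k : ℤ) (n : Fin d → ℤ) :
    tripleCube k n = ⋃ n' ∈ Fintype.piFinset fun i => Finset.Icc (n i - 1) (n i + 1),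
      dyadicCube k n' := by
  ext x
  simp only [tripleCube, Set.mem_ofPred_eq, Set.mem_iUnion, Fintype.mem_piFinset, Finset.mem_Icc,
    abs_le]
  constructor
  · exact fun h => ⟨dyadicIdx k x, fun i => by have := h i; omega, rfl⟩
  · rintro ⟨n', h, rfl⟩ i
    have := h i
    omega

/-- A triple is a disjoint union of dyadic cubes of the same size. If the average over it exceeds
`a`, it does so on one of these, which lies in a stopping cube; the triple of that stopping cube
then contains `x`. -/
theorem maximal_weak_type {d : ℕ} (hd : 0 < d) (g : Rd d → ℝ≥0∞) (hg : ∫⁻ x, g x < ⊤)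
    {a : ℝ≥0∞} (ha : 0 < a) :
    a * volume {x | ∃ k, a * volume (tripleCube k (dyadicIdx k x)) <
      ∫⁻ y in tripleCube k (dyadicIdx k x), g y} ≤ 3 ^ d * ∫⁻ x, g x := by
  obtain ⟨M, hMd, hM1, hM2, hM3⟩ := exists_stopping_cubes hd g hg ha
  have hsub : {x | ∃ k, a * volume (tripleCube k (dyadicIdx k x)) <
      ∫⁻ y in tripleCube k (dyadicIdx k x), g y} ⊆ ⋃ s ∈ M, tripleCube s.1 s.2 := by
    rintro x ⟨k, hk⟩
    set N := Fintype.piFinset fun i => Finset.Icc (dyadicIdx k x i - 1) (dyadicIdx k x i + 1)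
      with hN
    have hdisj : (N : Set (Fin d → ℤ)).PairwiseDisjoint (dyadicCube k) := by
      intro n _ n' _ hne
      rw [Function.onFun, Set.disjoint_left]
      rintro y rfl rfl
      exact hne rfl
    rw [tripleCube_eq_biUnion, lintegral_biUnion_finset hdisj
      (fun _ _ => measurableSet_dyadicCube _ _), measure_biUnion_finset hdisj
      (fun _ _ => measurableSet_dyadicCube _ _), Finset.mul_sum] at hk
    obtain ⟨n', hn', hlt⟩ := Finset.exists_lt_of_sum_lt hk
    obtain ⟨y, rfl⟩ := exists_mem_dyadicCube k n'
    have hxy : x ∈ tripleCube k (dyadicIdx k y) := by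
      intro i
      have := Fintype.mem_piFinset.1 hn' i
      rw [Finset.mem_Icc] at this
      rw [abs_le]; omega
    have hyM : y ∈ M.union := by
      by_contra h
      exact absurd hlt (not_lt.2 (hM3 y h k))
    simp only [CubeFamily.union, Set.mem_iUnion] at hyM ⊢
    obtain ⟨s, hs, hys⟩ := hyM
    have hks : k ≤ s.1 := by
      by_contra! h
      exact absurd hlt (not_lt.2 (hM2 s hs y hys k h))
    refine ⟨s, hs, ?_⟩
    have hy2 : dyadicIdx s.1 y = s.2 := hys
    rw [← hy2]
    exact mem_tripleCube_of_le hks hxy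
  calc _ ≤ a * ∑' s : M, volume (tripleCube s.1.1 s.1.2) := by
        gcongr; exact (measure_mono hsub).trans (measure_biUnion_le _ M.to_countable _)
    _ = 3 ^ d * (a * ∑' s : M, volume (dyadicCube s.1.1 s.1.2)) := by
        simp only [volume_tripleCube, ENNReal.tsum_mul_left]; ring
    _ ≤ _ := by
        gcongr
        exact sum_volume_stopping_le hMd fun s hs => (hM1 s hs).le

/-! ### The sparse recursion -/

/-- `(T ⊗ I)(F 1_s)` for a vector function `F`. -/
def opVec {d : ℕ} {ι : Type*} (T : LTwoOp d) (F : Rd d → ι → ℂ) (s : Set (Rd d)) :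
    Rd d → ι → ℂ :=
  fun x i => opFun T (s.indicator fun y => F y i) x

/-- The expansion in the Auerbach functions commutes with T. Proving it for coordinate covectors
first gives a null set independent of `w`, which is essential since `w` will later vary with `x`. -/
theorem dotProduct_opVec_eq {d : ℕ} {ι : Type*} [Fintype ι] (T : LTwoOp d) {F : Rd d → ι → ℂ}
    (hF : ∀ i, MemLp (fun x => F x i) 2 volume) {s s₀ : Set (Rd d)} (hs : MeasurableSet s)
    (hss : s ⊆ s₀) {n : ℕ} {β : Fin n → ι → ℂ} {c : Fin n → (ι → ℂ) →ₗ[ℂ] ℂ}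
    (h : ∀ w, ∀ᵐ x ∂(volume.restrict s₀), dotProduct w (F x) =
      ∑ j, c j w * dotProduct (β j) (F x)) :
    ∀ᵐ x ∂(volume : Measure (Rd d)), ∀ w, dotProduct w (opVec T F s x) =
      ∑ j, c j w * opFun T (s.indicator fun y => dotProduct (β j) (F y)) x := by
  classical
  have hb : ∀ j, MemLp (s.indicator fun y => dotProduct (β j) (F y)) 2 volume := fun j =>
    (memLp_dotProduct hF (β j)).indicator hs
  have key : ∀ i, ∀ᵐ x ∂(volume : Measure (Rd d)), opVec T F s x i =
      ∑ j, c j (fun i' => if i = i' then 1 else 0) *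
        opFun T (s.indicator fun y => dotProduct (β j) (F y)) x := by
    intro i
    set e : ι → ℂ := fun i' => if i = i' then 1 else 0
    have h1 : (s.indicator fun y => F y i) =ᵐ[volume]
        ∑ j, c j e • (s.indicator fun y => dotProduct (β j) (F y)) := by
      have h2 := (ae_restrict_iff' hs).1 (ae_restrict_of_ae_restrict_of_subset hss (h e))
      filter_upwards [h2] with x hx
      by_cases hxs : x ∈ s
      · have := hx hxs
        simp only [Set.indicator_of_mem hxs, Finset.sum_apply, Pi.smul_apply, smul_eq_mul]
        rw [← this]
        simp [e, dotProduct]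
      · simp [hxs]
    have h3 := opFun_finset_sum T Finset.univ
      (fun j => c j e • (s.indicator fun y => dotProduct (β j) (F y)))
      (fun j _ => (hb j).const_smul _)
    have h4 : ∀ᵐ x ∂(volume : Measure (Rd d)), ∀ j,
        opFun T (c j e • (s.indicator fun y => dotProduct (β j) (F y))) x =
        c j e * opFun T (s.indicator fun y => dotProduct (β j) (F y)) x :=
      ae_all_iff.2 fun j => opFun_smul T (hb j) (c j e)
    filter_upwards [h3, h4] with x hx3 hx4
    rw [opVec, opFun_congr T ((hF i).indicator hs) h1, hx3, Finset.sum_apply]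
    exact Finset.sum_congr rfl fun j _ => hx4 j
  filter_upwards [ae_all_iff.2 key] with x hx w
  simp only [dotProduct]
  calc ∑ i, w i * opVec T F s x i
      = ∑ i, ∑ j, w i * (c j (fun i' => if i = i' then 1 else 0) *
        opFun T (s.indicator fun y => dotProduct (β j) (F y)) x) := by
        refine Finset.sum_congr rfl fun i _ => ?_
        rw [hx i, Finset.mul_sum]
    _ = ∑ j, ∑ i, w i * (c j (fun i' => if i = i' then 1 else 0) *
        opFun T (s.indicator fun y => dotProduct (β j) (F y)) x) := Finset.sum_comm
    _ = _ := by
        refine Finset.sum_congr rfl fun j _ => ?_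
        rw [LinearMap.pi_apply_eq_sum_univ (c j) w, Finset.sum_mul]
        exact Finset.sum_congr rfl fun i _ => by rw [smul_eq_mul]; ring_nf; rfl

theorem lintegral_enorm_indicator_one {d : ℕ} {E : Set (Rd d)} (hE : MeasurableSet E)
    (s : Set (Rd d)) : ∫⁻ x in s, ‖E.indicator (1 : Rd d → ℂ) x‖ₑ = volume (E ∩ s) := by
  have : ∀ x, ‖E.indicator (1 : Rd d → ℂ) x‖ₑ = E.indicator 1 x := fun x => by
    by_cases h : x ∈ E <;> simp [h]
  simp only [this]
  rw [lintegral_indicator_one hE, Measure.restrict_apply hE]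

/-- The stopping cubes of a small subset of a dyadic cube. -/
theorem exists_local_stopping_cubes {d : ℕ} (hd : 0 < d) {k : ℤ} {n : Fin d → ℤ}
    {E : Set (Rd d)} (hE : MeasurableSet E) (hEQ : E ⊆ dyadicCube k n)
    (hsmall : 2 ^ (d + 2) * volume E ≤ volume (dyadicCube k n)) :
    ∃ M : CubeFamily d, (M.PairwiseDisjoint fun s => dyadicCube s.1 s.2) ∧
      (∀ s ∈ M, s.1 ≤ k ∧ dyadicCube s.1 s.2 ⊆ dyadicCube k n) ∧
      2 * volume M.union ≤ volume (dyadicCube k n) ∧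
      (∀ s ∈ M, 2 * volume (E ∩ dyadicCube s.1 s.2) ≤ volume (dyadicCube s.1 s.2)) ∧
      ∀ᵐ x ∂(volume : Measure (Rd d)), x ∉ M.union → x ∉ E := by
  have hEt : volume E < ⊤ := (measure_mono hEQ).trans_lt (volume_dyadicCube_lt_top _ _)
  have hg : ∫⁻ x, ‖E.indicator (1 : Rd d → ℂ) x‖ₑ = volume E := by
    have := lintegral_enorm_indicator_one hE Set.univ
    rwa [Measure.restrict_univ, Set.inter_univ] at this
  -- At this height the stopping cubes have total measure at most |E|/c ≤ |Q|/2, and since parents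
  -- are not selected, `E` fills at most 2^d · c = 1/2 of each stopping cube.
  set c : ℝ≥0∞ := (2 ^ (d + 1))⁻¹ with hc
  have hc0 : 0 < c := by simp [hc]
  have hcc : c * 2 ^ (d + 1) = 1 := ENNReal.inv_mul_cancel (by simp) (by simp)
  have hsmall' : 2 * volume E ≤ c * volume (dyadicCube k n) := by
    calc 2 * volume E = (c * 2 ^ (d + 1)) * (2 * volume E) := by rw [hcc, one_mul]
      _ = c * (2 ^ (d + 2) * volume E) := by ring
      _ ≤ _ := by gcongr
  obtain ⟨M, hMd, hM1, hM2, hM3⟩ := exists_stopping_cubes hd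
    (fun x => ‖E.indicator (1 : Rd d → ℂ) x‖ₑ) (hg ▸ hEt) hc0
  simp only [lintegral_enorm_indicator_one hE] at hM1 hM2 hM3
  refine ⟨M, hMd, fun s hs => ?_, ?_, fun s hs => ?_, ?_⟩
  · have hlt := hM1 s hs
    have hne : (E ∩ dyadicCube s.1 s.2).Nonempty := nonempty_of_measure_ne_zero
      ((zero_le).trans_lt hlt).ne'
    obtain ⟨y, hyE, hys⟩ := hne
    rcases le_or_gt s.1 k with h | h
    · exact ⟨h, dyadicCube_subset_of_mem h hys (hEQ hyE)⟩
    · exfalso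
      have h1 : volume (dyadicCube k n) ≤ volume (dyadicCube s.1 s.2) :=
        measure_mono (dyadicCube_subset_of_mem h.le (hEQ hyE) hys)
      have h2 : c * volume (dyadicCube s.1 s.2) < c * volume (dyadicCube s.1 s.2) := by
        calc _ < volume (E ∩ dyadicCube s.1 s.2) := hlt
          _ ≤ volume E := measure_mono Set.inter_subset_left
          _ ≤ 2 * volume E := le_mul_of_one_le_left (zero_le) (by norm_num)
          _ ≤ _ := hsmall'.trans (by gcongr)
      exact lt_irrefl _ h2
  · have h1 : c * volume M.union ≤ volume E := by
      rw [volume_union_eq hMd, ← hg]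
      refine sum_volume_stopping_le hMd fun s hs => ?_
      rw [lintegral_enorm_indicator_one hE]
      exact (hM1 s hs).le
    rw [← ENNReal.mul_le_mul_iff_right hc0.ne' (by simp [hc])]
    calc c * (2 * volume M.union) = 2 * (c * volume M.union) := by ring
      _ ≤ 2 * volume E := by gcongr
      _ ≤ _ := hsmall'
  · obtain ⟨x, hx⟩ := exists_mem_dyadicCube s.1 s.2
    have h := hM2 s hs x hx (s.1 + 1) (by omega)
    rw [volume_dyadicCube_add_one _ _ s.2] at h
    calc 2 * volume (E ∩ dyadicCube s.1 s.2)
        ≤ 2 * (c * (2 ^ d * volume (dyadicCube s.1 s.2))) := by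
          gcongr
          refine (measure_mono (Set.inter_subset_inter_right _ ?_)).trans h
          exact dyadicCube_subset_of_mem (by omega) hx (mem_dyadicCube_self _ _)
      _ = (c * 2 ^ (d + 1)) * volume (dyadicCube s.1 s.2) := by ring
      _ = _ := by rw [hcc, one_mul]
  · have hint : Integrable (E.indicator (1 : Rd d → ℂ)) volume :=
      (integrable_indicator_iff hE).2 (integrableOn_const hEt.ne)
    filter_upwards [ae_enorm_le_of_average_le hint c] with x hx hxM hxE
    have h := hx fun k => by
      rw [lintegral_enorm_indicator_one hE]; exact hM3 x hxM k
    rw [Set.indicator_of_mem hxE, Pi.one_apply, enorm_one] at h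
    have : c < 1 := by
      rw [hc, ENNReal.inv_lt_one]
      exact one_lt_pow₀ (by norm_num) (by omega)
    exact absurd h (not_le.2 this)

/-- The exceptional set consists of the points of Q where, for some Auerbach function b_j cut to 3Q,
either |T b_j| or the maximal function of b_j is large. On a stopping cube S the difference T b_j -
T(b_j 1_{3S}) comes from a function vanishing on 3S, so it has small oscillation on S, by the
maximal bound at one good point. Its size is then fixed by one point of S at which both T b_j and
T(b_j 1_{3S}) are small. No maximal truncation of T is needed. -/
theorem exists_sparse_step {d : ℕ} (hd : 0 < d) {ι : Type*} [Fintype ι] {T : LTwoOp d}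
    {K : Rd d → Rd d → ℂ} {c δ : ℝ} (hK : IsStandardKernel K c δ) (hT : HasKernel T K) :
    ∃ A : ℝ≥0, ∀ F : Rd d → ι → ℂ, (∀ i, MemLp (fun x => F x i) 2 volume) →
      ∀ (k : ℤ) (n : Fin d → ℤ), ∃ M : CubeFamily d,
        (M.PairwiseDisjoint fun s => dyadicCube s.1 s.2) ∧
        (∀ s ∈ M, s.1 ≤ k ∧ dyadicCube s.1 s.2 ⊆ dyadicCube k n) ∧
        2 * volume M.union ≤ volume (dyadicCube k n) ∧
        (∀ᵐ x ∂(volume : Measure (Rd d)), x ∈ dyadicCube k n → x ∉ M.union →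
          ∀ w, ‖dotProduct w (opVec T F (tripleCube k n) x)‖ₑ * volume (tripleCube k n) ≤
            A * ∫⁻ y in tripleCube k n, ‖dotProduct w (F y)‖ₑ) ∧
        ∀ s ∈ M, ∀ᵐ x ∂(volume : Measure (Rd d)), x ∈ dyadicCube s.1 s.2 →
          ∀ w, ‖dotProduct w (opVec T F (tripleCube k n) x) -
              dotProduct w (opVec T F (tripleCube s.1 s.2) x)‖ₑ * volume (tripleCube k n) ≤
            A * ∫⁻ y in tripleCube k n, ‖dotProduct w (F y)‖ₑ := by
  obtain ⟨C, hC⟩ := hT.hasWeakType hd hK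
  set N : ℝ≥0 := (Fintype.card ι : ℝ≥0) with hN
  set t₀ : ℝ≥0∞ := ENNReal.ofReal (2 * c * (2 * d) ^ δ) with ht₀
  set q : ℝ≥0∞ := ENNReal.ofReal ((2 : ℝ) ^ (-δ)) with hq
  have hq1 : q < 1 := by
    rw [hq, ENNReal.ofReal_lt_one]
    exact Real.rpow_lt_one_of_one_lt_of_neg (by norm_num) (by linarith [hK.pos])
  have hA3t : t₀ * (1 - q)⁻¹ * 6 ^ d ≠ ⊤ := by
    refine ENNReal.mul_ne_top (ENNReal.mul_ne_top ENNReal.ofReal_ne_top ?_) (by simp)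
    exact ENNReal.inv_ne_top.2 (tsub_pos_of_lt hq1).ne'
  obtain ⟨A₃, hA₃⟩ : ∃ A₃ : ℝ≥0, (A₃ : ℝ≥0∞) = t₀ * (1 - q)⁻¹ * 6 ^ d :=
    ⟨_, ENNReal.coe_toNNReal hA3t⟩
  -- `A₁` makes the exceptional set at most 2^{-(d+2)}|Q|, where C + 3^d collects the two weak type
  -- constants and the last 3^d is |3Q|/|Q|. `A₂` makes the set where T(b_j 1_{3S}) is large at most
  -- |S|/4. The added 1 keeps both nonzero.
  set A₁ : ℝ≥0 := 2 ^ (d + 2) * (N * (C + 3 ^ d) * 3 ^ d) + 1 with hA₁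
  set A₂ : ℝ≥0 := 4 * (N * (C * A₁ * 3 ^ d)) + 1 with hA₂
  refine ⟨N * (A₁ + A₂ + A₃ * A₁), fun F hF k n => ?_⟩
  set Q := dyadicCube k n with hQ
  set V := volume (tripleCube k n) with hV
  have hV0 : V ≠ 0 := (volume_tripleCube_pos k n).ne'
  have hVt : V ≠ ⊤ := (volume_tripleCube_lt_top k n).ne
  have hm3 := measurableSet_tripleCube k n
  have hfin : IsFiniteMeasure (volume.restrict (tripleCube k n)) :=
    ⟨by simpa using volume_tripleCube_lt_top k n⟩
  obtain ⟨l, β, cf, hl, hβ, hcf, hexp⟩ := exists_auerbach_functions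
    (μ := volume.restrict (tripleCube k n)) (F := F)
    (fun i => ((hF i).restrict _).integrable (by norm_num))
  have hlN : (l : ℝ≥0∞) ≤ (N : ℝ≥0∞) := by rw [hN]; exact_mod_cast hl
  set f : Fin l → Rd d → ℂ := fun j x => dotProduct (β j) (F x) with hf
  have hf2 : ∀ j, MemLp (f j) 2 volume := fun j => memLp_dotProduct hF (β j)
  set b : Fin l → Rd d → ℂ := fun j => (tripleCube k n).indicator (f j) with hb
  have hb2 : ∀ j, MemLp (b j) 2 volume := fun j => (hf2 j).indicator hm3
  have hb1 : ∀ j, ∫⁻ x, ‖b j x‖ₑ ≤ 1 := fun j => by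
    refine le_trans (le_of_eq ?_) (hβ j)
    simp only [hb, enorm_indicator_eq_indicator_enorm]
    exact lintegral_indicator hm3 _
  set u : Fin l → Rd d → ℂ := fun j => opFun T (b j) with hu
  set a₁ : ℝ≥0∞ := A₁ / V with ha₁
  have hA₁0 : (A₁ : ℝ≥0∞) ≠ 0 := by
    rw [ENNReal.coe_ne_zero, hA₁]; positivity
  have hA₂0 : (A₂ : ℝ≥0∞) ≠ 0 := by
    rw [ENNReal.coe_ne_zero, hA₂]; positivity
  have ha₁0 : a₁ ≠ 0 := ENNReal.div_ne_zero.2 ⟨hA₁0, hVt⟩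
  have ha₁t : a₁ ≠ ⊤ := ENNReal.div_ne_top ENNReal.coe_ne_top hV0
  have hVa₁ : V * a₁ = A₁ := ENNReal.mul_div_cancel hV0 hVt
  -- the exceptional set
  set E₀ : Set (Rd d) := ⋃ j, ({x | a₁ < ‖u j x‖ₑ} ∪
    {x | ∃ k, a₁ * volume (tripleCube k (dyadicIdx k x)) <
      ∫⁻ y in tripleCube k (dyadicIdx k x), ‖b j y‖ₑ}) with hE₀
  set E : Set (Rd d) := toMeasurable volume E₀ ∩ Q with hEdef
  have hEm : MeasurableSet E :=
    (measurableSet_toMeasurable _ _).inter (measurableSet_dyadicCube _ _)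
  have hE₀v : a₁ * volume E₀ ≤ N * (C + 3 ^ d) := by
    calc a₁ * volume E₀ ≤ a₁ * ∑ j : Fin l, (volume {x | a₁ < ‖u j x‖ₑ} +
          volume {x | ∃ k, a₁ * volume (tripleCube k (dyadicIdx k x)) <
            ∫⁻ y in tripleCube k (dyadicIdx k x), ‖b j y‖ₑ}) := by
          gcongr
          exact (measure_iUnion_fintype_le _ _).trans
            (Finset.sum_le_sum fun j _ => measure_union_le _ _)
      _ ≤ ∑ _j : Fin l, ((C : ℝ≥0∞) + 3 ^ d) := by
          rw [Finset.mul_sum]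
          refine Finset.sum_le_sum fun j _ => ?_
          rw [mul_add]
          refine add_le_add ?_ ?_
          · refine (hC (b j) (hb2 j) a₁ ha₁0 ha₁t).trans ?_
            calc _ ≤ (C : ℝ≥0∞) * 1 := by gcongr; exact hb1 j
              _ = _ := mul_one _
          · refine (maximal_weak_type hd _ ((hb1 j).trans_lt (by simp))
              (pos_iff_ne_zero.2 ha₁0)).trans ?_
            calc _ ≤ (3 ^ d : ℝ≥0∞) * 1 := by gcongr; exact hb1 j
              _ = _ := mul_one _
      _ = l * (C + 3 ^ d) := by rw [Finset.sum_const, Finset.card_univ, Fintype.card_fin, nsmul_eq_mul]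
      _ ≤ _ := by gcongr
  have hEv : 2 ^ (d + 2) * volume E ≤ volume Q := by
    rw [← ENNReal.mul_le_mul_iff_right hA₁0 ENNReal.coe_ne_top]
    have h1 : (A₁ : ℝ≥0∞) * volume E ≤ V * (N * (C + 3 ^ d)) := by
      calc (A₁ : ℝ≥0∞) * volume E ≤ V * a₁ * volume E₀ := by
            rw [hVa₁]
            refine mul_le_mul_right ?_ _
            exact (measure_mono Set.inter_subset_left).trans (measure_toMeasurable _).le
        _ = V * (a₁ * volume E₀) := by ring
        _ ≤ _ := by gcongr
    calc (A₁ : ℝ≥0∞) * (2 ^ (d + 2) * volume E) = 2 ^ (d + 2) * (A₁ * volume E) := by ring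
      _ ≤ 2 ^ (d + 2) * (V * (N * (C + 3 ^ d))) := by gcongr
      _ = (2 ^ (d + 2) * (N * (C + 3 ^ d) * 3 ^ d)) * volume Q := by
          rw [hV, volume_tripleCube]; ring
      _ ≤ A₁ * volume Q := by
          gcongr
          rw [hA₁]; push_cast
          exact le_self_add
  obtain ⟨M, hMd, hMQ, hMv, hMs, hMae⟩ := exists_local_stopping_cubes hd hEm
    Set.inter_subset_right hEv
  have hgood : ∀ x ∈ Q, x ∉ E → ∀ j, ‖u j x‖ₑ ≤ a₁ ∧
      ∀ k, ∫⁻ y in tripleCube k (dyadicIdx k x), ‖b j y‖ₑ ≤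
        a₁ * volume (tripleCube k (dyadicIdx k x)) := by
    intro x hxQ hxE j
    have hx : x ∉ E₀ := fun h => hxE ⟨subset_toMeasurable _ _ h, hxQ⟩
    simp only [hE₀, Set.mem_iUnion, Set.mem_union, Set.mem_ofPred_eq, not_exists, not_or,
      not_lt] at hx
    exact hx j
  -- the passage from the basis to arbitrary functionals
  have hfinal : ∀ (D : ℝ≥0) (z : Fin l → ℂ) (w : ι → ℂ), D ≤ A₁ + A₂ + A₃ * A₁ →
      (∀ j, ‖z j‖ₑ ≤ D / V) → ‖∑ j, cf j w * z j‖ₑ * V ≤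
      ((N * (A₁ + A₂ + A₃ * A₁) : ℝ≥0) : ℝ≥0∞) *
        ∫⁻ y in tripleCube k n, ‖dotProduct w (F y)‖ₑ := by
    intro D z w hD hz
    set I := ∫⁻ y in tripleCube k n, ‖dotProduct w (F y)‖ₑ
    calc ‖∑ j, cf j w * z j‖ₑ * V ≤ (∑ j : Fin l, I * (D / V)) * V := by
          gcongr
          refine (enorm_sum_le _ _).trans (Finset.sum_le_sum fun j _ => ?_)
          rw [enorm_mul]
          gcongr
          · exact hcf j w
          · exact hz j
      _ = l * I * (V * (D / V)) := by simp; ring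
      _ = l * D * I := by rw [ENNReal.mul_div_cancel hV0 hVt]; ring
      _ ≤ _ := by
          push_cast
          gcongr
          exact_mod_cast hD
  refine ⟨M, hMd, hMQ, hMv, ?_, fun s hs => ?_⟩
  · filter_upwards [hMae, dotProduct_opVec_eq T hF hm3 subset_rfl hexp] with x hx1 hx2 hxQ hxM w
    rw [hx2 w]
    refine hfinal A₁ _ w ?_ fun j => (hgood x hxQ (hx1 hxM) j).1
    rw [add_assoc]; exact le_self_add
  · obtain ⟨hsk, hsQ⟩ := hMQ s hs
    set S := dyadicCube s.1 s.2 with hS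
    have hS0 : volume S ≠ 0 := (volume_dyadicCube_pos _ _).ne'
    have hSt : volume S ≠ ⊤ := (volume_dyadicCube_lt_top _ _).ne
    have hms := measurableSet_tripleCube s.1 s.2
    have hsub3 : tripleCube s.1 s.2 ⊆ tripleCube k n := by
      obtain ⟨y, hy⟩ := exists_mem_dyadicCube s.1 s.2
      exact tripleCube_subset_of_mem hsk hy (hsQ hy)
    -- `E` fills at most half of S. The maximal bound at a point of S outside `E` controls the mass
    -- of b_j on 3S and on the triples of all larger cubes around it.
    obtain ⟨x₀, hx₀S, hx₀E⟩ : ∃ x₀ ∈ S, x₀ ∉ E := by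
      by_contra! hcon
      have h1 : volume S ≤ volume (E ∩ S) := measure_mono fun x hx => ⟨hcon x hx, hx⟩
      have h2 := (mul_le_mul_right h1 2).trans (hMs s hs)
      rw [two_mul] at h2
      have h3 : volume S < volume S + volume S := ENNReal.lt_add_right hSt hS0
      exact absurd h2 (not_le.2 h3)
    have hx₀i : dyadicIdx s.1 x₀ = s.2 := hx₀S
    have hx₀ := hgood x₀ (hsQ hx₀S) hx₀E
    set b' : Fin l → Rd d → ℂ := fun j => (tripleCube s.1 s.2).indicator (f j) with hb'
    have hb'2 : ∀ j, MemLp (b' j) 2 volume := fun j => (hf2 j).indicator hms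
    have hb'1 : ∀ j, ∫⁻ x, ‖b' j x‖ₑ ≤ a₁ * (3 ^ d * volume S) := fun j => by
      have h1 := (hx₀ j).2 s.1
      rw [hx₀i, volume_tripleCube] at h1
      refine le_trans (le_of_eq ?_) h1
      rw [← lintegral_indicator hms]
      refine lintegral_congr fun x => ?_
      by_cases hx : x ∈ tripleCube s.1 s.2
      · simp [hb', hb, hx, hsub3 hx]
      · simp [hb', hx]
    set v : Fin l → Rd d → ℂ := fun j => opFun T (b' j) with hv
    set a₂ : ℝ≥0∞ := A₂ / V with ha₂
    have ha₂0 : a₂ ≠ 0 := ENNReal.div_ne_zero.2 ⟨hA₂0, hVt⟩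
    have ha₂t : a₂ ≠ ⊤ := ENNReal.div_ne_top ENNReal.coe_ne_top hV0
    have hVa₂ : V * a₂ = A₂ := ENNReal.mul_div_cancel hV0 hVt
    have hvv : 4 * volume (⋃ j, {x | a₂ < ‖v j x‖ₑ}) ≤ volume S := by
      rw [← ENNReal.mul_le_mul_iff_right hA₂0 ENNReal.coe_ne_top]
      calc (A₂ : ℝ≥0∞) * (4 * volume (⋃ j, {x | a₂ < ‖v j x‖ₑ}))
          ≤ (V * a₂) * (4 * ∑ j : Fin l, volume {x | a₂ < ‖v j x‖ₑ}) := by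
            rw [hVa₂]; gcongr; exact measure_iUnion_fintype_le _ _
        _ = 4 * V * ∑ j : Fin l, a₂ * volume {x | a₂ < ‖v j x‖ₑ} := by
            rw [← Finset.mul_sum]; ring
        _ ≤ 4 * V * ∑ _j : Fin l, C * (a₁ * (3 ^ d * volume S)) := by
            refine mul_le_mul_right (Finset.sum_le_sum fun j _ => ?_) _
            exact (hC (b' j) (hb'2 j) a₂ ha₂0 ha₂t).trans (mul_le_mul_right (hb'1 j) _)
        _ = 4 * (l * (C * (V * a₁) * 3 ^ d)) * volume S := by simp; ring
        _ ≤ A₂ * volume S := by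
            rw [hVa₁]
            gcongr
            rw [hA₂]; push_cast
            refine le_trans ?_ le_self_add
            gcongr
    set r : Fin l → Rd d → ℂ := fun j => b j - b' j with hr
    have hrz : ∀ j, ∀ x ∉ tripleCube k n, r j x = 0 := fun j x hx => by
      have hx' : x ∉ tripleCube s.1 s.2 := fun h => hx (hsub3 h)
      simp [hr, hb, hb', hx, hx']
    have hrz' : ∀ j, ∀ x ∈ tripleCube s.1 (dyadicIdx s.1 x₀), r j x = 0 := fun j x hx => by
      rw [hx₀i] at hx
      simp [hr, hb, hb', hx, hsub3 hx]
    have hrle : ∀ j x, ‖r j x‖ₑ ≤ ‖b j x‖ₑ := fun j x => by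
      by_cases hx : x ∈ tripleCube s.1 s.2
      · simp [hr, hb, hb', hx, hsub3 hx]
      · simp [hr, hb', hx]
    choose G hG1 hG2 using fun j => hT.exists_oscillation_le hd hK ((hb2 j).sub (hb'2 j)) hm3
      (isBounded_tripleCube k n) (hrz j) s.1 x₀ (hrz' j)
    have hosc : ∀ j, ∀ x ∈ S, ∀ x' ∈ S, ‖G j x - G j x'‖ₑ ≤ A₃ * a₁ := by
      intro j x hx x' hx'
      have hSi : S = dyadicCube s.1 (dyadicIdx s.1 x₀) := by rw [hx₀i]
      rw [hSi] at hx hx'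
      refine (hG2 j x hx x' hx').trans ?_
      rw [hA₃]
      refine lintegral_kernelTail_mul_le _ _ _ _ ((hb2 j).sub (hb'2 j)).1.enorm a₁
        fun k' _ => ?_
      exact (lintegral_mono fun y => hrle j y).trans ((hx₀ j).2 k')
    have hae : ∀ᵐ x ∂(volume : Measure (Rd d)), ∀ j, x ∈ S → u j x - v j x = G j x := by
      refine ae_all_iff.2 fun j => ?_
      filter_upwards [hG1 j, opFun_sub T (hb2 j) (hb'2 j)] with x h1 h2 hx
      rw [← h1 (by rw [hx₀i]; exact hx), h2]
      rfl
    -- The excluded points of S make up at most |S|/2 + |S|/4, so a common good point survives.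
    obtain ⟨x', hx'S, hx'E, hx'v, hx'G⟩ : ∃ x' ∈ S, x' ∉ E ∧ (∀ j, ‖v j x'‖ₑ ≤ a₂) ∧
        ∀ j, u j x' - v j x' = G j x' := by
      by_contra! hcon
      have h1 : volume S ≤ volume (E ∩ S) + volume (⋃ j, {x | a₂ < ‖v j x‖ₑ}) := by
        refine le_trans (measure_mono_ae ?_) (measure_union_le _ _)
        filter_upwards [hae] with x hx hxS
        by_contra hx'
        have hx'' : ¬ (x ∈ E ∩ S ∨ x ∈ ⋃ j, {x | a₂ < ‖v j x‖ₑ}) := hx'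
        simp only [not_or, Set.mem_iUnion, Set.mem_ofPred_eq, not_exists, not_lt] at hx''
        obtain ⟨j, hj⟩ := hcon x hxS (fun h => hx''.1 ⟨h, hxS⟩) hx''.2
        exact hj (hx j hxS)
      have h2 : 4 * volume S ≤ 3 * volume S := by
        calc 4 * volume S ≤ 4 * (volume (E ∩ S) + volume (⋃ j, {x | a₂ < ‖v j x‖ₑ})) := by gcongr
          _ = 2 * (2 * volume (E ∩ S)) + 4 * volume (⋃ j, {x | a₂ < ‖v j x‖ₑ}) := by ring
          _ ≤ 2 * volume S + volume S := by gcongr; exact hMs s hs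
          _ = _ := by ring
      rw [ENNReal.mul_le_mul_iff_left hS0 hSt] at h2
      norm_num at h2
    filter_upwards [hae, dotProduct_opVec_eq T hF hm3 subset_rfl hexp,
      dotProduct_opVec_eq T hF hms hsub3 hexp] with x hx1 hx2 hx3 hxS w
    rw [hx2 w, hx3 w, ← Finset.sum_sub_distrib]
    simp only [← mul_sub]
    refine hfinal (A₁ + A₂ + A₃ * A₁) _ w le_rfl fun j => ?_
    have e : u j x - v j x = (G j x - G j x') + (u j x' - v j x') := by
      rw [hx1 j hxS, hx'G j]; ring
    change ‖u j x - v j x‖ₑ ≤ _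
    rw [e]
    calc _ ≤ A₃ * a₁ + (a₁ + a₂) := by
          refine (enorm_add_le _ _).trans (add_le_add (hosc j x hxS x' hx'S) ?_)
          exact enorm_sub_le.trans (add_le_add (hgood x' (hsQ hx'S) hx'E j).1 (hx'v j))
      _ = _ := by
          rw [ha₁, ha₂]; push_cast
          simp only [div_eq_mul_inv]; ring

theorem aemeasurable_dotProduct_opVec {d : ℕ} {ι : Type*} [Fintype ι] (T : LTwoOp d)
    (F : Rd d → ι → ℂ) (s : Set (Rd d)) {w : Rd d → ι → ℂ}
    (hw : ∀ i, AEMeasurable (fun x => w x i) volume) :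
    AEMeasurable (fun x => dotProduct (w x) (opVec T F s x)) volume :=
  Finset.aemeasurable_fun_sum _ fun i _ => (hw i).mul (memLp_opFun T).1.aemeasurable

/-- The measures of the sets G are summable, so almost every point lies in only finitely many of
them, and Fatou's lemma removes them. Nothing is assumed about the integral of φ over the sets G. -/
theorem lintegral_le_of_small_exceptional_sets {d : ℕ} {Q : Set (Rd d)}
    (hQt : volume Q ≠ ⊤) {φ : Rd d → ℝ≥0∞} (hφ : AEMeasurable φ volume) (R : ℝ≥0∞)
    (h : ∀ j : ℕ, ∃ G : Set (Rd d), MeasurableSet G ∧ 2 ^ j * volume G ≤ volume Q ∧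
      ∫⁻ x in Q \ G, φ x ≤ R) : ∫⁻ x in Q, φ x ≤ R := by
  choose G hGm hGv hGR using h
  have hGv' : ∀ j, volume (G j) ≤ volume Q * 2⁻¹ ^ j := by
    intro j
    have h2 : ((2 : ℝ≥0∞) ^ j)⁻¹ * 2 ^ j = 1 := ENNReal.inv_mul_cancel (by simp) (by simp)
    calc volume (G j) = (2 ^ j)⁻¹ * (2 ^ j * volume (G j)) := by rw [← mul_assoc, h2, one_mul]
      _ ≤ (2 ^ j)⁻¹ * volume Q := by gcongr; exact hGv j
      _ = _ := by rw [ENNReal.inv_pow, mul_comm]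
  have hsum : ∑' j, volume (G j) ≠ ⊤ := by
    refine ((ENNReal.tsum_le_tsum hGv').trans_lt ?_).ne
    rw [ENNReal.tsum_mul_left, ENNReal.tsum_geometric]
    exact ENNReal.mul_lt_top (lt_top_iff_ne_top.2 hQt) (by simp)
  have hev := ae_eventually_notMem hsum
  calc ∫⁻ x in Q, φ x ≤ ∫⁻ x in Q, liminf (fun j => (G j)ᶜ.indicator φ x) atTop := by
        refine lintegral_mono_ae (ae_restrict_of_ae ?_)
        filter_upwards [hev] with x hx
        refine le_of_eq (Tendsto.liminf_eq ?_).symm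
        refine tendsto_const_nhds.congr' ?_
        filter_upwards [hx] with j hj
        rw [Set.indicator_of_mem (show x ∈ (G j)ᶜ from hj)]
    _ ≤ liminf (fun j => ∫⁻ x in Q, (G j)ᶜ.indicator φ x) atTop :=
        lintegral_liminf_le' fun j => (hφ.indicator (hGm j).compl).restrict
    _ ≤ R := by
        refine liminf_le_of_le (by isBoundedDefault) fun b hb => ?_
        obtain ⟨j, hj⟩ := hb.exists
        refine hj.trans (le_trans (le_of_eq ?_) (hGR j))
        rw [lintegral_indicator (hGm j).compl, Measure.restrict_restrict (hGm j).compl,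
          Set.inter_comm, Set.sdiff_eq]

/-- The sparse form bound, in integrated form: a bound of the averaged forms on all dyadic cubes
by the values of a function `N` implies the bound by the integral of `N`. -/
theorem exists_sparse_form_bound {d : ℕ} (hd : 0 < d) (ι : Type*) [Fintype ι] {T : LTwoOp d}
    {K : Rd d → Rd d → ℂ} {c δ : ℝ} (hK : IsStandardKernel K c δ) (hT : HasKernel T K) :
    ∃ A : ℝ≥0, ∀ F : Rd d → ι → ℂ, (∀ i, MemLp (fun x => F x i) 2 volume) →
      ∀ w : Rd d → ι → ℂ, (∀ i, AEMeasurable (fun x => w x i) volume) →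
      ∀ g N : Rd d → ℝ≥0∞, AEMeasurable g volume →
      (∀ (k : ℤ) (n : Fin d → ℤ), ∀ x ∈ dyadicCube k n,
        ∫⁻ x' in dyadicCube k n, (∫⁻ y in tripleCube k n, ‖dotProduct (w x') (F y)‖ₑ) * g x' ≤
          volume (tripleCube k n) * volume (dyadicCube k n) * N x) →
      ∀ (k : ℤ) (n : Fin d → ℤ),
        ∫⁻ x in dyadicCube k n, ‖dotProduct (w x) (opVec T F (tripleCube k n) x)‖ₑ * g x ≤
          A * ∫⁻ x in dyadicCube k n, N x := by
  obtain ⟨A, hA⟩ := exists_sparse_step hd (ι := ι) hK hT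
  refine ⟨2 * A, fun F hF w hw g N hg hN => ?_⟩
  set φ : ℤ → (Fin d → ℤ) → Rd d → ℝ≥0∞ := fun k n x =>
    ‖dotProduct (w x) (opVec T F (tripleCube k n) x)‖ₑ * g x with hφ
  have hφm : ∀ k n, AEMeasurable (φ k n) volume := fun k n =>
    (aemeasurable_dotProduct_opVec T F _ hw).enorm.mul hg
  -- After j generations the bound holds off a set of measure at most 2^{-j}|Q|; for j = 0 the whole
  -- cube is discarded. The constant does not grow with j, since each generation is charged only to
  -- the integral of `N` over the part of the cube outside its stopping cubes.
  have main : ∀ (j : ℕ) (k : ℤ) (n : Fin d → ℤ), ∃ G : Set (Rd d), MeasurableSet G ∧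
      2 ^ j * volume G ≤ volume (dyadicCube k n) ∧
      ∫⁻ x in dyadicCube k n \ G, φ k n x ≤ ((2 * A : ℝ≥0) : ℝ≥0∞) * ∫⁻ x in dyadicCube k n, N x := by
    intro j
    induction j with
    | zero =>
      intro k n
      exact ⟨dyadicCube k n, measurableSet_dyadicCube k n, by simp, by simp⟩
    | succ j ih =>
      intro k n
      choose G hGm hGv hGI using ih
      obtain ⟨M, hMd, hMQ, hMv, hM1, hM2⟩ := hA F hF k n
      set Q := dyadicCube k n with hQ
      set V := volume (tripleCube k n) with hV
      have hV0 : V ≠ 0 := (volume_tripleCube_pos k n).ne'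
      have hVt : V ≠ ⊤ := (volume_tripleCube_lt_top k n).ne
      have hQ0 : volume Q ≠ 0 := (volume_dyadicCube_pos k n).ne'
      have hQt : volume Q ≠ ⊤ := (volume_dyadicCube_lt_top k n).ne
      set U := M.union with hU
      have hUm : MeasurableSet U := M.measurableSet_union
      have hUQ : U ⊆ Q := Set.iUnion₂_subset fun s hs => (hMQ s hs).2
      set ψ : Rd d → ℝ≥0∞ := fun x =>
        A / V * ((∫⁻ y in tripleCube k n, ‖dotProduct (w x) (F y)‖ₑ) * g x) with hψ
      have hMm : ∀ s ∈ M, MeasurableSet (dyadicCube s.1 s.2) :=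
        fun _ _ => measurableSet_dyadicCube _ _
      have hcancel : ∀ a b : ℝ≥0∞, a * V ≤ A * b → a ≤ A / V * b := by
        intro a b h
        rw [← ENNReal.mul_le_mul_iff_left hV0 hVt]
        refine h.trans (le_of_eq ?_)
        rw [mul_right_comm, ENNReal.div_mul_cancel hV0 hVt]
      have hout : ∫⁻ x in Q \ U, φ k n x ≤ ∫⁻ x in Q \ U, ψ x := by
        refine setLIntegral_mono_ae' ((measurableSet_dyadicCube k n).diff hUm) ?_
        filter_upwards [hM1] with x hx hxQ
        have := hcancel _ _ (hx hxQ.1 hxQ.2 (w x))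
        simp only [hφ, hψ]
        rw [← mul_assoc]
        gcongr
      have hin : ∀ s ∈ M, ∫⁻ x in dyadicCube s.1 s.2 \ G s.1 s.2, φ k n x ≤
          ((2 * A : ℝ≥0) : ℝ≥0∞) * (∫⁻ x in dyadicCube s.1 s.2, N x) +
            ∫⁻ x in dyadicCube s.1 s.2, ψ x := by
        intro s hs
        calc ∫⁻ x in dyadicCube s.1 s.2 \ G s.1 s.2, φ k n x
            ≤ ∫⁻ x in dyadicCube s.1 s.2 \ G s.1 s.2, (φ s.1 s.2 x + ψ x) := by
              refine setLIntegral_mono_ae' ((hMm s hs).diff (hGm _ _)) ?_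
              filter_upwards [hM2 s hs] with x hx hxs
              have h1 := hcancel _ _ (hx hxs.1 (w x))
              simp only [hφ, hψ]
              rw [← mul_assoc, ← add_mul]
              gcongr
              calc ‖dotProduct (w x) (opVec T F (tripleCube k n) x)‖ₑ
                  = ‖dotProduct (w x) (opVec T F (tripleCube s.1 s.2) x) +
                    (dotProduct (w x) (opVec T F (tripleCube k n) x) -
                    dotProduct (w x) (opVec T F (tripleCube s.1 s.2) x))‖ₑ := by congr 1; ring
                _ ≤ _ := (enorm_add_le _ _).trans (add_le_add le_rfl h1)
          _ = (∫⁻ x in dyadicCube s.1 s.2 \ G s.1 s.2, φ s.1 s.2 x) +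
              ∫⁻ x in dyadicCube s.1 s.2 \ G s.1 s.2, ψ x :=
              lintegral_add_left' (hφm _ _).restrict _
          _ ≤ _ := add_le_add (hGI s.1 s.2) (lintegral_mono_set Set.sdiff_subset)
      -- This is where sparseness enters: the hypothesis holds at every point of Q, so it may be
      -- averaged over Q \ U alone, which carries at least half of the measure.
      have hX : ∫⁻ x in Q, ψ x ≤ ((2 * A : ℝ≥0) : ℝ≥0∞) * ∫⁻ x in Q \ U, N x := by
        set X := ∫⁻ x in Q, ψ x with hXdef
        have h1 : ∀ x ∈ Q, X ≤ A * volume Q * N x := by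
          intro x hx
          calc X = A / V * ∫⁻ x in Q,
                ((∫⁻ y in tripleCube k n, ‖dotProduct (w x) (F y)‖ₑ) * g x) :=
                lintegral_const_mul' _ _ (ENNReal.div_ne_top ENNReal.coe_ne_top hV0)
            _ ≤ A / V * (V * volume Q * N x) := by gcongr; exact hN k n x hx
            _ = (A / V * V) * volume Q * N x := by ring
            _ = _ := by rw [ENNReal.div_mul_cancel hV0 hVt]
        have hvol : volume Q ≤ 2 * volume (Q \ U) := by
          have h2 : volume Q ≤ volume U + volume (Q \ U) := by
            rw [add_comm]
            have := measure_sdiff_add_inter (μ := volume) Q hUm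
            rw [← this]
            gcongr
            exact Set.inter_subset_right
          have h3 : volume U ≠ ⊤ := ((measure_mono hUQ).trans_lt (lt_top_iff_ne_top.2 hQt)).ne
          have h4 : volume U + volume U ≤ volume U + volume (Q \ U) := by
            rw [← two_mul]; exact hMv.trans h2
          have h5 := (ENNReal.add_le_add_iff_left h3).1 h4
          calc volume Q ≤ volume U + volume (Q \ U) := h2
            _ ≤ volume (Q \ U) + volume (Q \ U) := by gcongr
            _ = _ := (two_mul _).symm
        rw [← ENNReal.mul_le_mul_iff_left hQ0 hQt]
        calc X * volume Q ≤ X * (2 * volume (Q \ U)) := by gcongr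
          _ = 2 * ∫⁻ _x in Q \ U, X := by rw [setLIntegral_const]; ring
          _ ≤ 2 * ∫⁻ x in Q \ U, A * volume Q * N x := by
              refine mul_le_mul_right (setLIntegral_mono' ?_ fun x hx => h1 x hx.1) _
              exact (measurableSet_dyadicCube k n).diff hUm
          _ = _ := by
              rw [lintegral_const_mul' _ _ (ENNReal.mul_ne_top ENNReal.coe_ne_top hQt)]
              push_cast; ring
      have hsplit : ∀ f : Rd d → ℝ≥0∞, ∫⁻ x in Q, f x = (∫⁻ x in Q \ U, f x) +
          ∑' s : M, ∫⁻ x in dyadicCube s.1.1 s.1.2, f x := by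
        intro f
        rw [← lintegral_biUnion M.to_countable hMm hMd]
        have := lintegral_inter_add_sdiff (μ := volume) f Q hUm
        rw [Set.inter_eq_self_of_subset_right hUQ] at this
        rw [add_comm]; exact this.symm
      refine ⟨⋃ s ∈ M, G s.1 s.2, MeasurableSet.biUnion M.to_countable fun s _ => hGm _ _, ?_, ?_⟩
      · calc 2 ^ (j + 1) * volume (⋃ s ∈ M, G s.1 s.2)
            ≤ 2 ^ (j + 1) * ∑' s : M, volume (G s.1.1 s.1.2) := by
              gcongr; exact measure_biUnion_le _ M.to_countable _
          _ = 2 * ∑' s : M, 2 ^ j * volume (G s.1.1 s.1.2) := by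
              rw [ENNReal.tsum_mul_left]; ring
          _ ≤ 2 * ∑' s : M, volume (dyadicCube s.1.1 s.1.2) := by
              refine mul_le_mul_right (ENNReal.tsum_le_tsum fun s => hGv _ _) _
          _ = 2 * volume U := by rw [hU, volume_union_eq hMd]
          _ ≤ _ := hMv
      · have hsub : Q \ (⋃ s ∈ M, G s.1 s.2) ⊆
            (Q \ U) ∪ ⋃ s ∈ M, (dyadicCube s.1 s.2 \ G s.1 s.2) := by
          intro x hx
          by_cases hxU : x ∈ U
          · right
            simp only [hU, CubeFamily.union, Set.mem_iUnion] at hxU ⊢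
            obtain ⟨s, hs, hxs⟩ := hxU
            exact ⟨s, hs, hxs, fun h => hx.2 (Set.mem_biUnion hs h)⟩
          · exact Or.inl ⟨hx.1, hxU⟩
        calc ∫⁻ x in Q \ (⋃ s ∈ M, G s.1 s.2), φ k n x
            ≤ (∫⁻ x in Q \ U, φ k n x) +
              ∫⁻ x in ⋃ s ∈ M, (dyadicCube s.1 s.2 \ G s.1 s.2), φ k n x :=
              (lintegral_mono_set hsub).trans (lintegral_union_le _ _ _)
          _ ≤ (∫⁻ x in Q \ U, φ k n x) +
              ∑' s : M, ∫⁻ x in dyadicCube s.1.1 s.1.2 \ G s.1.1 s.1.2, φ k n x := by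
              refine add_le_add le_rfl (le_of_eq ?_)
              refine lintegral_biUnion M.to_countable (fun s hs => (hMm s hs).diff (hGm _ _)) ?_ _
              exact hMd.mono fun s => Set.sdiff_subset
          _ ≤ (∫⁻ x in Q \ U, ψ x) +
              ∑' s : M, (((2 * A : ℝ≥0) : ℝ≥0∞) * (∫⁻ x in dyadicCube s.1.1 s.1.2, N x) +
                ∫⁻ x in dyadicCube s.1.1 s.1.2, ψ x) :=
              add_le_add hout (ENNReal.tsum_le_tsum fun s => hin s.1 s.2)
          _ = (∫⁻ x in Q, ψ x) + ((2 * A : ℝ≥0) : ℝ≥0∞) *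
                ∑' s : M, ∫⁻ x in dyadicCube s.1.1 s.1.2, N x := by
              rw [ENNReal.tsum_add, ENNReal.tsum_mul_left, hsplit ψ]; ring
          _ ≤ ((2 * A : ℝ≥0) : ℝ≥0∞) * (∫⁻ x in Q \ U, N x) + ((2 * A : ℝ≥0) : ℝ≥0∞) *
                ∑' s : M, ∫⁻ x in dyadicCube s.1.1 s.1.2, N x := by gcongr
          _ = _ := by rw [hsplit N]; ring
  intro k n
  exact lintegral_le_of_small_exceptional_sets
    (volume_dyadicCube_lt_top k n).ne (hφm k n) _ fun j => main j k n

/-! ### Conjugate functions on `[0,∞]` and Luxemburg norms -/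

/-- The conjugate function on `[0,∞]`. -/
def conjE (A : ℝ≥0 → ℝ≥0) (t : ℝ≥0∞) : ℝ≥0∞ := ⨆ s : ℝ≥0, (s : ℝ≥0∞) * t - A s

theorem conjE_coe (A : ℝ≥0 → ℝ≥0) (t : ℝ≥0) : conjE A t = conj A t := by
  simp [conjE, conj]

theorem monotone_conjE (A : ℝ≥0 → ℝ≥0) : Monotone (conjE A) := fun t t' h =>
  iSup_mono fun s => by gcongr

theorem measurable_conjE (A : ℝ≥0 → ℝ≥0) : Measurable (conjE A) := (monotone_conjE A).measurable

theorem young_inequality (A : ℝ≥0 → ℝ≥0) (a b : ℝ≥0∞) : a * b ≤ ext A a + conjE A b := by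
  rcases eq_or_ne a ⊤ with rfl | ha
  · simp [ext]
  lift a to ℝ≥0 using ha
  have : ext A a = A a := by simp [ext]
  rw [this, add_comm]
  exact tsub_le_iff_right.1 (le_iSup (fun s : ℝ≥0 => (s : ℝ≥0∞) * b - A s) a)

/-- Convexity together with the value 0 at 0, read off from the supremum. -/
theorem conjE_mul_le (A : ℝ≥0 → ℝ≥0) {a : ℝ≥0∞} (ha : a ≤ 1) (t : ℝ≥0∞) :
    conjE A (a * t) ≤ a * conjE A t := by
  refine iSup_le fun s => ?_
  calc (s : ℝ≥0∞) * (a * t) - A s ≤ a * (s * t) - a * A s := by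
        rw [mul_left_comm]
        exact tsub_le_tsub le_rfl (mul_le_of_le_one_left (zero_le) ha)
    _ = a * (s * t - A s) := by
        rw [ENNReal.mul_sub]
        intro _ _
        exact (ha.trans_lt ENNReal.one_lt_top).ne
    _ ≤ _ := by
        gcongr
        exact le_iSup (fun s : ℝ≥0 => (s : ℝ≥0∞) * t - A s) s

/-- The Luxemburg norm for a function on `[0,∞]`. -/
def luxNormE {d : ℕ} (Φ : ℝ≥0∞ → ℝ≥0∞) (Q : Set (Rd d)) (g : Rd d → ℝ≥0∞) : ℝ≥0∞ :=
  ⨅ (l : ℝ≥0) (_ : 0 < l) (_ : ⨍⁻ x in Q, Φ (g x / l) ∂volume ≤ 1), (l : ℝ≥0∞)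

theorem luxNormE_le {d : ℕ} {Φ : ℝ≥0∞ → ℝ≥0∞} {Q : Set (Rd d)} {g : Rd d → ℝ≥0∞} {l : ℝ≥0}
    (hl : 0 < l) (h : ⨍⁻ x in Q, Φ (g x / l) ∂volume ≤ 1) : luxNormE Φ Q g ≤ l :=
  iInf_le_of_le l (iInf_le_of_le hl (iInf_le_of_le h le_rfl))

/-- Passes to the infimum over admissible levels. When c = 0 and no level is admissible the premise
is empty while 0 · ∞ = 0, so finiteness must be required in that case. -/
theorem le_mul_luxNormE {d : ℕ} {Φ : ℝ≥0∞ → ℝ≥0∞} {Q : Set (Rd d)} {g : Rd d → ℝ≥0∞}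
    {X c : ℝ≥0∞} (hc : c ≠ ⊤) (hg : c = 0 → luxNormE Φ Q g ≠ ⊤)
    (h : ∀ l : ℝ≥0, 0 < l → ⨍⁻ x in Q, Φ (g x / l) ∂volume ≤ 1 → X ≤ c * l) :
    X ≤ c * luxNormE Φ Q g := by
  rcases eq_or_ne c 0 with rfl | hc0
  · have hg := hg rfl
    by_contra! hcon
    apply hg
    refine iInf_eq_top.2 fun l => iInf_eq_top.2 fun hl => iInf_eq_top.2 fun hle => ?_
    have := h l hl hle
    simp only [zero_mul] at this hcon
    exact absurd this (not_le.2 hcon)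
  · rw [mul_comm, ← ENNReal.div_le_iff hc0 hc]
    refine le_iInf fun l => le_iInf fun hl => le_iInf fun hle => ?_
    rw [ENNReal.div_le_iff hc0 hc, mul_comm]
    exact h l hl hle

section holder

variable {d : ℕ} {Q : Set (Rd d)}

theorem setLAverage_le_one_iff (hQ0 : volume Q ≠ 0) (hQt : volume Q ≠ ⊤) {f : Rd d → ℝ≥0∞} :
    ⨍⁻ x in Q, f x ∂volume ≤ 1 ↔ ∫⁻ x in Q, f x ≤ volume Q := by
  rw [setLAverage_eq, ENNReal.div_le_iff hQ0 hQt, one_mul]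

/-- Hölder's inequality in Orlicz spaces. -/
theorem lintegral_mul_le_luxNorm (hQ0 : volume Q ≠ 0) (hQt : volume Q ≠ ⊤) {A : ℝ≥0 → ℝ≥0}
    (N : Rd d → ℝ≥0∞) {h : Rd d → ℝ≥0∞} (hh : AEMeasurable h volume) {H : ℝ≥0} (hH : 0 < H)
    (hle : ⨍⁻ x in Q, conjE A (h x / H) ∂volume ≤ 1) :
    ∫⁻ x in Q, N x * h x ≤ 2 * volume Q * H * luxNorm A Q N := by
  change _ ≤ _ * luxNormE (ext A) Q N
  have hH0 : (H : ℝ≥0∞) ≠ 0 := by exact_mod_cast hH.ne'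
  have hc : 2 * volume Q * H ≠ ⊤ :=
    ENNReal.mul_ne_top (ENNReal.mul_ne_top (by simp) hQt) ENNReal.coe_ne_top
  have hc0 : 2 * volume Q * H ≠ 0 := mul_ne_zero (mul_ne_zero (by simp) hQ0) hH0
  refine le_mul_luxNormE hc (fun h => absurd h hc0) fun l hl hl1 => ?_
  have hl0 : (l : ℝ≥0∞) ≠ 0 := by exact_mod_cast hl.ne'
  rw [setLAverage_le_one_iff hQ0 hQt] at hle hl1
  calc ∫⁻ x in Q, N x * h x
      ≤ ∫⁻ x in Q, (l * H) * (ext A (N x / l) + conjE A (h x / H)) := by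
        refine lintegral_mono fun x => ?_
        calc N x * h x = (l * H) * (N x / l * (h x / H)) := by
              nth_rewrite 1 [← ENNReal.mul_div_cancel (b := N x) hl0 ENNReal.coe_ne_top,
                ← ENNReal.mul_div_cancel (b := h x) hH0 ENNReal.coe_ne_top]
              ring
          _ ≤ _ := by gcongr; exact young_inequality A _ _
    _ = (l * H) * ((∫⁻ x in Q, ext A (N x / l)) + ∫⁻ x in Q, conjE A (h x / H)) := by
        -- Only the conjugate term has to be measurable, so `N` may be arbitrary; it will itself be
        -- an inner Luxemburg norm.
        rw [lintegral_const_mul' _ _ (ENNReal.mul_ne_top ENNReal.coe_ne_top ENNReal.coe_ne_top),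
          lintegral_add_right']
        exact ((measurable_conjE A).comp_aemeasurable (hh.div_const _)).restrict
    _ ≤ (l * H) * (volume Q + volume Q) := by gcongr
    _ = _ := by ring

/-- The two-variable Hölder inequality with mixed Luxemburg norms. -/
theorem lintegral_lintegral_mul_le (hQ0 : volume Q ≠ 0) (hQt : volume Q ≠ ⊤) {C D : ℝ≥0 → ℝ≥0}
    (N : Rd d → Rd d → ℝ≥0∞) {g h : Rd d → ℝ≥0∞} (hg : AEMeasurable g volume)
    (hh : AEMeasurable h volume) {κ : ℝ≥0∞} (hκ : κ ≠ ⊤)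
    (hN : luxNorm D Q (fun y => luxNorm C Q fun x => N x y) ≤ κ)
    (hgl : luxNormE (conjE C) Q g ≠ ⊤) (hhl : luxNormE (conjE D) Q h ≠ ⊤) :
    ∫⁻ y in Q, (∫⁻ x in Q, N x y * g x) * h y ≤
      4 * volume Q ^ 2 * κ * luxNormE (conjE C) Q g * luxNormE (conjE D) Q h := by
  have hV : 4 * volume Q ^ 2 * κ ≠ ⊤ :=
    ENNReal.mul_ne_top (ENNReal.mul_ne_top (by simp) (by simp [hQt])) hκ
  refine le_mul_luxNormE (ENNReal.mul_ne_top hV hgl) (fun _ => hhl) fun H hH hH1 => ?_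
  rw [mul_right_comm]
  refine le_mul_luxNormE (ENNReal.mul_ne_top hV ENNReal.coe_ne_top) (fun _ => hgl)
    fun G hG hG1 => ?_
  calc ∫⁻ y in Q, (∫⁻ x in Q, N x y * g x) * h y
      ≤ ∫⁻ y in Q, (2 * volume Q * G) * ((luxNorm C Q fun x => N x y) * h y) := by
        refine lintegral_mono fun y => ?_
        dsimp only
        rw [← mul_assoc]
        gcongr
        exact lintegral_mul_le_luxNorm hQ0 hQt _ hg hG hG1
    _ = (2 * volume Q * G) * ∫⁻ y in Q, (luxNorm C Q fun x => N x y) * h y :=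
        lintegral_const_mul' _ _
          (ENNReal.mul_ne_top (ENNReal.mul_ne_top (by simp) hQt) ENNReal.coe_ne_top)
    _ ≤ (2 * volume Q * G) * (2 * volume Q * H * κ) := by
        gcongr
        exact (lintegral_mul_le_luxNorm hQ0 hQt _ hh hH hH1).trans (by gcongr)
    _ = _ := by ring

end holder

/-! ### The Orlicz maximal function -/

/-- The Orlicz maximal function over tripled dyadic cubes. -/
def maxFn {d : ℕ} (Φ : ℝ≥0∞ → ℝ≥0∞) (h : Rd d → ℝ≥0∞) (x : Rd d) : ℝ≥0∞ :=
  ⨆ k : ℤ, luxNormE Φ (tripleCube k (dyadicIdx k x)) h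

theorem measurable_maxFn {d : ℕ} (Φ : ℝ≥0∞ → ℝ≥0∞) (h : Rd d → ℝ≥0∞) :
    Measurable (maxFn Φ h) := by
  refine Measurable.iSup fun k => ?_
  have : Measurable fun n : Fin d → ℤ => luxNormE Φ (tripleCube k n) h := Measurable.of_discrete
  exact this.comp (measurable_dyadicIdx k)

theorem luxNormE_le_maxFn {d : ℕ} {Φ : ℝ≥0∞ → ℝ≥0∞} {h : Rd d → ℝ≥0∞} {k : ℤ} {n : Fin d → ℤ}
    {x : Rd d} (hx : x ∈ dyadicCube k n) : luxNormE Φ (tripleCube k n) h ≤ maxFn Φ h x := by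
  obtain rfl : dyadicIdx k x = n := hx
  exact le_iSup (fun k => luxNormE Φ (tripleCube k (dyadicIdx k x)) h) k

section maximal

variable {A : ℝ≥0 → ℝ≥0} {q : ℝ}

/-- An infinite value at t would persist on the whole half-line beyond t, against the integrability
in the class `B_q`. -/
theorem conjE_lt_top (hB : MemB (conj A) q) {t : ℝ≥0∞} (ht : t ≠ ⊤) : conjE A t < ⊤ := by
  obtain ⟨c, hc, hI⟩ := hB
  lift t to ℝ≥0 using ht
  by_contra! h
  have htop : conj A t = ⊤ := by rw [← conjE_coe]; exact top_le_iff.1 h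
  have hmono : Monotone (conj A) := fun a b hab => by
    rw [← conjE_coe, ← conjE_coe]; exact monotone_conjE A (by exact_mod_cast hab)
  have h1 : ∫⁻ _x in Set.Ioi (max c t), (⊤ : ℝ≥0∞) ≤
      ∫⁻ t in Set.Ioi c, conj A t.toNNReal / ENNReal.ofReal (t ^ q) / ENNReal.ofReal t := by
    refine (setLIntegral_mono' measurableSet_Ioi fun x hx => ?_).trans
      (lintegral_mono_set (Set.Ioi_subset_Ioi (le_max_left c (t : ℝ))))
    have hx1 : (t : ℝ) < x := (le_max_right c (t : ℝ)).trans_lt hx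
    have : conj A x.toNNReal = ⊤ := by
      refine top_le_iff.1 (htop ▸ hmono ?_)
      exact (Real.le_toNNReal_iff_coe_le (t.2.trans hx1.le)).2 hx1.le
    rw [this, ENNReal.top_div_of_ne_top ENNReal.ofReal_ne_top,
      ENNReal.top_div_of_ne_top ENNReal.ofReal_ne_top]
  rw [setLIntegral_const, Real.volume_Ioi, ENNReal.top_mul_top] at h1
  exact absurd hI (not_lt.2 h1)

theorem exists_conjE_le_half (hB : MemB (conj A) q) :
    ∃ a : ℝ≥0, 0 < a ∧ conjE A a ≤ 2⁻¹ := by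
  have h1 := conjE_lt_top hB (t := 1) (by simp)
  lift conjE A 1 to ℝ≥0 using h1.ne with b hb
  refine ⟨(2 * (b + 1))⁻¹, by positivity, ?_⟩
  have hne : (2 * ((b : ℝ≥0∞) + 1)) ≠ 0 := by simp
  have hnt : (2 * ((b : ℝ≥0∞) + 1)) ≠ ⊤ := by simp [ENNReal.mul_eq_top]
  have ha : (((2 * (b + 1))⁻¹ : ℝ≥0) : ℝ≥0∞) = (2 * ((b : ℝ≥0∞) + 1))⁻¹ := by
    rw [ENNReal.coe_inv (by positivity)]; push_cast; rfl
  have hle : (((2 * (b + 1))⁻¹ : ℝ≥0) : ℝ≥0∞) ≤ 1 := by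
    rw [ha, ENNReal.inv_le_one]
    calc (1 : ℝ≥0∞) ≤ 2 * 1 := by norm_num
      _ ≤ _ := by gcongr; exact le_add_self
  have h2 := conjE_mul_le A hle 1
  rw [mul_one] at h2
  refine h2.trans ?_
  rw [← hb, ha, ENNReal.mul_inv (by simp) (by simp), mul_assoc]
  refine mul_le_of_le_one_right (zero_le) ?_
  rw [mul_comm, ← div_eq_mul_inv]
  exact ENNReal.div_le_of_le_mul (by rw [one_mul]; exact le_self_add)

/-- Where h ≤ a t the conjugate function of h/t is at most 1/2. A Luxemburg norm above t therefore
forces an average above 1/2 of the part with h > a t, and the maximal weak type inequality applies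
to that part. -/
theorem volume_maxFn_le {d : ℕ} (hd : 0 < d) {a : ℝ≥0} (haA : conjE A a ≤ 2⁻¹)
    {h : Rd d → ℝ≥0∞} {t : ℝ≥0} (ht : 0 < t) :
    volume {x | (t : ℝ≥0∞) < maxFn (conjE A) h x} ≤
      2 * 3 ^ d * ∫⁻ x, {x | (a : ℝ≥0∞) * t < h x}.indicator (fun x => conjE A (h x / t)) x := by
  set φ : Rd d → ℝ≥0∞ := {x | (a : ℝ≥0∞) * t < h x}.indicator fun x => conjE A (h x / t) with hφ
  have ht0 : (t : ℝ≥0∞) ≠ 0 := by exact_mod_cast ht.ne'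
  rcases eq_or_ne (∫⁻ x, φ x) ⊤ with hI | hI
  · rw [hI, ENNReal.mul_top (by positivity)]; exact le_top
  have hsub : {x | (t : ℝ≥0∞) < maxFn (conjE A) h x} ⊆
      {x | ∃ k, 2⁻¹ * volume (tripleCube k (dyadicIdx k x)) <
        ∫⁻ y in tripleCube k (dyadicIdx k x), φ y} := by
    intro x hx
    obtain ⟨k, hk⟩ := lt_iSup_iff.1 (show (t : ℝ≥0∞) < ⨆ k, _ from hx)
    refine ⟨k, ?_⟩
    set R := tripleCube k (dyadicIdx k x)
    have hR0 : volume R ≠ 0 := (volume_tripleCube_pos _ _).ne'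
    have hRt : volume R ≠ ⊤ := (volume_tripleCube_lt_top _ _).ne
    have h1 : ¬ (⨍⁻ x in R, conjE A (h x / t) ∂volume ≤ 1) := fun hle =>
      absurd (luxNormE_le ht hle) (not_le.2 hk)
    rw [setLAverage_le_one_iff hR0 hRt, not_le] at h1
    by_contra! hcon
    refine absurd h1 (not_lt.2 ?_)
    calc ∫⁻ y in R, conjE A (h y / t) ≤ ∫⁻ y in R, (2⁻¹ + φ y) := by
          refine lintegral_mono fun y => ?_
          by_cases hy : (a : ℝ≥0∞) * t < h y
          · simp only [hφ, Set.indicator_of_mem (show y ∈ {x | (a : ℝ≥0∞) * t < h x} from hy)]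
            exact le_add_self
          · refine le_add_right ((monotone_conjE A ?_).trans haA)
            exact ENNReal.div_le_of_le_mul (not_lt.1 hy)
      _ = 2⁻¹ * volume R + ∫⁻ y in R, φ y := by
          rw [lintegral_add_left measurable_const, setLIntegral_const]
      _ ≤ 2⁻¹ * volume R + 2⁻¹ * volume R := by gcongr
      _ = volume R := by rw [← add_mul, ENNReal.inv_two_add_inv_two, one_mul]
  have h2 := maximal_weak_type hd φ (lt_top_iff_ne_top.2 hI) (a := 2⁻¹) (by simp)
  calc _ ≤ 2 * (2⁻¹ * volume {x | ∃ k, 2⁻¹ * volume (tripleCube k (dyadicIdx k x)) <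
        ∫⁻ y in tripleCube k (dyadicIdx k x), φ y}) := by
        rw [← mul_assoc, ENNReal.mul_inv_cancel (by simp) (by simp), one_mul]
        exact measure_mono hsub
    _ ≤ 2 * (3 ^ d * ∫⁻ x, φ x) := by gcongr
    _ = _ := by ring

theorem lintegral_conjE_tail_lt_top (hB : MemB (conj A) q) (hq : 0 < q) {a : ℝ≥0} (ha : 0 < a) :
    ∫⁻ u in Set.Ioi (a : ℝ), conjE A (ENNReal.ofReal u) * ENNReal.ofReal (u ^ (-q - 1)) < ⊤ := by
  have hfin := fun t (ht : t ≠ ⊤) => conjE_lt_top hB (t := t) ht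
  obtain ⟨c, hc, hI⟩ := hB
  have hsub : Set.Ioi (a : ℝ) ⊆ Set.Ioc (a : ℝ) c ∪ Set.Ioi c := by
    intro x hx
    rcases le_or_gt x c with h | h
    · exact Or.inl ⟨hx, h⟩
    · exact Or.inr h
  refine (lintegral_mono_set hsub).trans_lt ((lintegral_union_le _ _ _).trans_lt
    (ENNReal.add_lt_top.2 ⟨?_, ?_⟩))
  · have ha' : (0 : ℝ) < a := ha
    calc _ ≤ ∫⁻ u in Set.Ioc (a : ℝ) c, conjE A (ENNReal.ofReal c) *
          ENNReal.ofReal ((a : ℝ) ^ (-q - 1)) := by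
          refine setLIntegral_mono' measurableSet_Ioc fun u hu => ?_
          refine mul_le_mul' (monotone_conjE A (ENNReal.ofReal_le_ofReal hu.2))
            (ENNReal.ofReal_le_ofReal ?_)
          exact Real.rpow_le_rpow_of_nonpos ha' hu.1.le (by linarith)
      _ < ⊤ := by
          rw [setLIntegral_const]
          exact ENNReal.mul_lt_top (ENNReal.mul_lt_top (hfin _ ENNReal.ofReal_ne_top)
            ENNReal.ofReal_lt_top) (by simp)
  · refine lt_of_le_of_lt (le_of_eq ?_) hI
    refine setLIntegral_congr_fun measurableSet_Ioi fun u hu => ?_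
    have hu0 : 0 < u := hc.trans hu
    change conjE A (u.toNNReal : ℝ≥0∞) * _ = _
    rw [conjE_coe, Real.rpow_sub hu0, Real.rpow_neg hu0.le, Real.rpow_one, div_eq_mul_inv,
      ENNReal.ofReal_mul (by positivity), ENNReal.ofReal_inv_of_pos (by positivity),
      ENNReal.ofReal_inv_of_pos hu0, div_eq_mul_inv, div_eq_mul_inv, mul_assoc]

/-- The substitution u = s/t turns the layer-cake integral at a point with h = s into s^q times the
integral of the `B_q` condition. -/
theorem lintegral_conjE_scaling {a : ℝ≥0} (ha : 0 < a) {s : ℝ} (hs : 0 < s) :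
    ∫⁻ t in Set.Ioo (0 : ℝ) (s / a), conjE A (ENNReal.ofReal (s / t)) *
      ENNReal.ofReal (t ^ (q - 1)) = ENNReal.ofReal (s ^ q) *
      ∫⁻ u in Set.Ioi (a : ℝ), conjE A (ENNReal.ofReal u) * ENNReal.ofReal (u ^ (-q - 1)) := by
  have ha' : (0 : ℝ) < a := ha
  have himg : (fun u : ℝ => s / u) '' Set.Ioi (a : ℝ) = Set.Ioo (0 : ℝ) (s / a) := by
    ext t
    constructor
    · rintro ⟨u, hu, rfl⟩
      have hu' : (a : ℝ) < u := hu
      exact ⟨div_pos hs (ha'.trans hu'), div_lt_div_of_pos_left hs ha' hu'⟩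
    · rintro ⟨h0, h1⟩
      refine ⟨s / t, ?_, by field_simp⟩
      rw [Set.mem_Ioi, lt_div_iff₀ h0, mul_comm]
      exact (lt_div_iff₀ ha').1 h1
  rw [← himg, lintegral_image_eq_lintegral_abs_deriv_mul (f' := fun u => -s / u ^ 2)
    measurableSet_Ioi]
  · rw [← lintegral_const_mul' _ _ ENNReal.ofReal_ne_top]
    refine setLIntegral_congr_fun measurableSet_Ioi fun u hu => ?_
    have hu0 : 0 < u := ha'.trans hu
    rw [show s / (s / u) = u by field_simp, mul_left_comm,
      ← mul_assoc (ENNReal.ofReal (s ^ q)), mul_comm (ENNReal.ofReal (s ^ q)), mul_assoc,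
      ← ENNReal.ofReal_mul (abs_nonneg _), ← ENNReal.ofReal_mul (by positivity)]
    congr 2
    rw [abs_div, abs_neg, abs_of_pos hs, abs_of_pos (by positivity : 0 < u ^ 2),
      Real.div_rpow hs.le hu0.le, Real.rpow_sub hs, Real.rpow_sub hu0, Real.rpow_sub hu0,
      Real.rpow_one, Real.rpow_one, Real.rpow_neg hu0.le]
    have h1 : u ^ q ≠ 0 := by positivity
    field_simp
  · intro u hu
    have hu0 : u ≠ 0 := (ha'.trans hu).ne'
    have := (hasDerivAt_inv hu0).const_mul s
    refine (this.congr_deriv ?_).hasDerivWithinAt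
    rw [mul_neg, ← div_eq_mul_inv, neg_div]
  · intro u hu v hv huv
    have hu0 : 0 < u := ha'.trans hu
    have hv0 : 0 < v := ha'.trans hv
    dsimp only at huv
    rw [div_eq_div_iff hu0.ne' hv0.ne'] at huv
    exact (mul_left_cancel₀ hs.ne' huv).symm

/-- Pérez's theorem: the maximal function of an Orlicz norm in the class `B_q` is bounded
on `L^q`. -/
theorem exists_maxFn_bound {d : ℕ} (hd : 0 < d) (hB : MemB (conj A) q) (hq : 0 < q) :
    ∃ K : ℝ≥0, ∀ h : Rd d → ℝ≥0∞, Measurable h →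
      ∫⁻ x, maxFn (conjE A) h x ^ q ≤ K * ∫⁻ x, h x ^ q := by
  obtain ⟨a, ha, haA⟩ := exists_conjE_le_half hB
  set J := ∫⁻ u in Set.Ioi (a : ℝ), conjE A (ENNReal.ofReal u) * ENNReal.ofReal (u ^ (-q - 1))
    with hJ
  have hJt : J < ⊤ := lintegral_conjE_tail_lt_top hB hq ha
  -- `J + 1` replaces `J` so that the factor is nonzero at points where h is infinite.
  set K : ℝ≥0∞ := ENNReal.ofReal q * (2 * 3 ^ d) * (J + 1) with hK
  have hKt : K ≠ ⊤ := ENNReal.mul_ne_top (ENNReal.mul_ne_top ENNReal.ofReal_ne_top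
    (by simp [ENNReal.mul_eq_top])) (by simp [hJt.ne])
  refine ⟨K.toNNReal, fun h hh => ?_⟩
  rw [ENNReal.coe_toNNReal hKt]
  set M := maxFn (conjE A) h with hM
  have hMm : Measurable M := measurable_maxFn _ _
  set φ : ℝ → Rd d → ℝ≥0∞ := fun t x =>
    {x | (a : ℝ≥0∞) * ENNReal.ofReal t < h x}.indicator
      (fun x => conjE A (h x / ENNReal.ofReal t)) x with hφ
  have hφm : Measurable (Function.uncurry φ) := by
    have hs : MeasurableSet {z : ℝ × Rd d | (a : ℝ≥0∞) * ENNReal.ofReal z.1 < h z.2} :=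
      measurableSet_lt (by fun_prop) (by fun_prop)
    have := ((measurable_conjE A).comp (by fun_prop :
      Measurable fun z : ℝ × Rd d => h z.2 / ENNReal.ofReal z.1)).indicator hs
    exact this
  have hinner : ∀ x, ∫⁻ t in Set.Ioi (0 : ℝ), φ t x * ENNReal.ofReal (t ^ (q - 1)) ≤
      (J + 1) * h x ^ q := by
    intro x
    rcases eq_or_ne (h x) 0 with h0 | h0
    · refine le_trans (le_of_eq ?_) (zero_le)
      rw [lintegral_eq_zero_iff' (by fun_prop)]
      refine Eventually.of_forall fun t => ?_
      simp [hφ, h0]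
    rcases eq_or_ne (h x) ⊤ with ht | ht
    · rw [ht, ENNReal.top_rpow_of_pos hq, ENNReal.mul_top (by simp)]; exact le_top
    set s := (h x).toReal with hs
    have hs0 : 0 < s := ENNReal.toReal_pos h0 ht
    have hsx : h x = ENNReal.ofReal s := (ENNReal.ofReal_toReal ht).symm
    calc ∫⁻ t in Set.Ioi (0 : ℝ), φ t x * ENNReal.ofReal (t ^ (q - 1))
        ≤ ∫⁻ t in Set.Ioi (0 : ℝ), (Set.Ioo (0 : ℝ) (s / a)).indicator (fun t =>
          conjE A (ENNReal.ofReal (s / t)) * ENNReal.ofReal (t ^ (q - 1))) t := by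
          refine setLIntegral_mono' measurableSet_Ioi fun t ht => ?_
          have ht0 : 0 < t := ht
          by_cases hlt : (a : ℝ≥0∞) * ENNReal.ofReal t < h x
          · have hmem : t ∈ Set.Ioo (0 : ℝ) (s / a) := by
              refine ⟨ht0, ?_⟩
              rw [lt_div_iff₀ (show (0 : ℝ) < a from ha)]
              rw [hsx, ← ENNReal.ofReal_coe_nnreal, ← ENNReal.ofReal_mul (NNReal.coe_nonneg a),
                ENNReal.ofReal_lt_ofReal_iff hs0] at hlt
              linarith
            rw [Set.indicator_of_mem hmem]
            simp only [hφ, Set.indicator_of_mem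
              (show x ∈ {x | (a : ℝ≥0∞) * ENNReal.ofReal t < h x} from hlt)]
            rw [hsx, ENNReal.ofReal_div_of_pos ht0]
          · simp only [hφ, Set.indicator_of_notMem
              (show x ∉ {x | (a : ℝ≥0∞) * ENNReal.ofReal t < h x} from hlt)]
            simp
      _ ≤ ∫⁻ t in Set.Ioo (0 : ℝ) (s / a),
          conjE A (ENNReal.ofReal (s / t)) * ENNReal.ofReal (t ^ (q - 1)) := by
          rw [← lintegral_indicator measurableSet_Ioo]
          exact setLIntegral_le_lintegral _ _
      _ = ENNReal.ofReal (s ^ q) * J := lintegral_conjE_scaling ha hs0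
      _ ≤ _ := by
          rw [hsx, ENNReal.ofReal_rpow_of_pos hs0, mul_comm]
          gcongr
          exact le_self_add
  -- The layer-cake formula is for real-valued functions and the maximal function may be infinite;
  -- it is truncated at N, and monotone convergence removes the truncation.
  have hbound : ∀ N : ℕ, ∫⁻ x, (min (M x) N) ^ q ≤ K * ∫⁻ x, h x ^ q := by
    intro N
    have hmt : ∀ x, min (M x) N ≠ ⊤ := fun x =>
      ((min_le_right _ _).trans_lt (ENNReal.natCast_lt_top N)).ne
    have hlc := lintegral_rpow_eq_lintegral_meas_lt_mul (volume : Measure (Rd d))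
      (f := fun x => (min (M x) N).toReal) (Eventually.of_forall fun x => ENNReal.toReal_nonneg)
      (by fun_prop) hq
    calc ∫⁻ x, (min (M x) N) ^ q = ∫⁻ x, ENNReal.ofReal ((min (M x) N).toReal ^ q) := by
          refine lintegral_congr fun x => ?_
          rw [← ENNReal.ofReal_rpow_of_nonneg ENNReal.toReal_nonneg hq.le,
            ENNReal.ofReal_toReal (hmt x)]
      _ = _ := hlc
      _ ≤ ENNReal.ofReal q * ∫⁻ t in Set.Ioi (0 : ℝ),
            2 * 3 ^ d * ∫⁻ x, φ t x * ENNReal.ofReal (t ^ (q - 1)) := by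
          gcongr ENNReal.ofReal q * ?_
          refine setLIntegral_mono' measurableSet_Ioi fun t ht => ?_
          have ht0 : 0 < t := ht
          rw [lintegral_mul_const _ (by fun_prop), ← mul_assoc]
          gcongr
          refine (measure_mono fun x hx => ?_).trans (volume_maxFn_le hd haA
            (t := t.toNNReal) (Real.toNNReal_pos.2 ht0))
          have hx' : t < (min (M x) N).toReal := hx
          change ENNReal.ofReal t < M x
          refine lt_of_lt_of_le ?_ (min_le_left _ (N : ℝ≥0∞))
          exact (ENNReal.ofReal_lt_iff_lt_toReal ht0.le (hmt x)).2 hx'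
      _ = ENNReal.ofReal q * (2 * 3 ^ d) *
            ∫⁻ x, ∫⁻ t in Set.Ioi (0 : ℝ), φ t x * ENNReal.ofReal (t ^ (q - 1)) := by
          rw [lintegral_const_mul' _ _ (by simp [ENNReal.mul_eq_top]),
            lintegral_lintegral_swap (f := fun t x => φ t x * ENNReal.ofReal (t ^ (q - 1)))
              (hφm.mul (by fun_prop)).aemeasurable]
          ring
      _ ≤ ENNReal.ofReal q * (2 * 3 ^ d) * ∫⁻ x, (J + 1) * h x ^ q := by
          gcongr with x; exact hinner x
      _ = _ := by
          rw [lintegral_const_mul' _ _ (by simp [hJt.ne]), hK, mul_assoc]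
          ring
  have hmono : ∫⁻ x, M x ^ q = ⨆ N : ℕ, ∫⁻ x, (min (M x) N) ^ q := by
    rw [← lintegral_iSup (fun N => by fun_prop) (fun i j hij x => by dsimp only; gcongr)]
    refine lintegral_congr fun x => ?_
    have h1 : Tendsto (fun N : ℕ => (min (M x) N) ^ q) atTop (𝓝 ((min (M x) ⊤) ^ q)) :=
      (ENNReal.continuous_rpow_const.tendsto _).comp
        (tendsto_const_nhds.min ENNReal.tendsto_nat_nhds_top)
    rw [min_eq_left le_top] at h1
    refine tendsto_nhds_unique h1 (tendsto_atTop_iSup fun i j hij => ?_)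
    gcongr
  rw [hmono]
  exact iSup_le hbound

end maximal

/-! ### Measurability of real powers of matrix weights -/

section powers

open scoped Matrix.Norms.L2Operator MatrixOrder

variable {m : ℕ}

/-- The positive definite matrices with spectrum in `[1/n, n]`. -/
def pinched (m n : ℕ) : Set (Mat m) :=
  {a | a.PosSemidef ∧ algebraMap ℝ (Mat m) (1 / (n + 1)) ≤ a ∧ a ≤ algebraMap ℝ (Mat m) (n + 1)}

lemma isClosed_posSemidef : IsClosed {a : Mat m | a.PosSemidef} := by
  have : {a : Mat m | a.PosSemidef} =
      {a | a.conjTranspose = a} ∩ ⋂ x : Fin m → ℂ, {a | 0 ≤ dotProduct (star x) (a.mulVec x)} := by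
    ext a
    simp [Matrix.posSemidef_iff_dotProduct_mulVec, Matrix.IsHermitian]
  rw [this]
  refine (isClosed_eq (by fun_prop) continuous_id).inter (isClosed_iInter fun x => ?_)
  exact isClosed_le continuous_const (by fun_prop)

lemma isClosed_pinched (n : ℕ) : IsClosed (pinched m n) := by
  have h1 : IsClosed {a : Mat m | algebraMap ℝ (Mat m) (1 / (n + 1)) ≤ a} := by
    simp only [Matrix.le_iff]
    exact isClosed_posSemidef.preimage (continuous_id.sub continuous_const)
  have h2 : IsClosed {a : Mat m | a ≤ algebraMap ℝ (Mat m) (n + 1)} := by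
    simp only [Matrix.le_iff]
    exact isClosed_posSemidef.preimage (continuous_const.sub continuous_id)
  exact isClosed_posSemidef.inter (h1.inter h2)

lemma spectrum_subset_of_mem_pinched {n : ℕ} {a : Mat m} (ha : a ∈ pinched m n) :
    spectrum ℝ a ⊆ Set.Icc (1 / (n + 1)) (n + 1) := by
  obtain ⟨h0, h1, h2⟩ := ha
  have hsa : IsSelfAdjoint a := h0.isHermitian
  intro t ht
  exact ⟨(algebraMap_le_iff_le_spectrum hsa).1 h1 t ht, (le_algebraMap_iff_spectrum_le hsa).1 h2 t ht⟩

lemma continuousOn_mpow (n : ℕ) (r : ℝ) : ContinuousOn (fun a : Mat m => mpow a r) (pinched m n) := by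
  have := continuousOn_cfc (A := Mat m) (𝕜 := ℝ) (p := IsSelfAdjoint)
    (isCompact_Icc (a := (1 / (n + 1) : ℝ)) (b := n + 1)) (fun t : ℝ => t ^ r)
    (by
      refine continuousOn_id.rpow_const fun x hx => Or.inl ?_
      have : (0 : ℝ) < 1 / (n + 1) := by positivity
      exact (this.trans_le hx.1).ne')
  refine this.mono fun a ha => ⟨ha.1.isHermitian, spectrum_subset_of_mem_pinched ha⟩

lemma spectrum_pos {a : Mat m} (ha : a.PosDef) {t : ℝ} (ht : t ∈ spectrum ℝ a) : 0 < t := by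
  rw [ha.isHermitian.spectrum_real_eq_range_eigenvalues] at ht
  obtain ⟨i, rfl⟩ := ht
  exact ha.eigenvalues_pos i

lemma eventually_mem_pinched {a : Mat m} (ha : a.PosDef) : ∀ᶠ n : ℕ in atTop, a ∈ pinched m n := by
  have hsa : IsSelfAdjoint a := ha.isHermitian
  have hfin : (spectrum ℝ a).Finite := by
    rw [ha.isHermitian.spectrum_real_eq_range_eigenvalues]; exact Set.finite_range _
  have h : ∀ᶠ n : ℕ in atTop, ∀ t ∈ spectrum ℝ a, (1 / (n + 1) : ℝ) ≤ t ∧ t ≤ n + 1 := by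
    rw [eventually_all_finite hfin]
    intro t ht
    have h0 := spectrum_pos ha ht
    have h1 := (tendsto_one_div_add_atTop_nhds_zero_nat (𝕜 := ℝ)).eventually_lt_const h0
    filter_upwards [h1, eventually_ge_atTop ⌈t⌉₊] with n hn hn'
    refine ⟨hn.le, ?_⟩
    have := Nat.ceil_le.1 hn'
    linarith
  filter_upwards [h] with n hn
  exact ⟨ha.posSemidef, (algebraMap_le_iff_le_spectrum hsa).2 fun t ht => (hn t ht).1,
    (le_algebraMap_iff_spectrum_le hsa).2 fun t ht => (hn t ht).2⟩

lemma mpow_mul_mpow_neg {a : Mat m} (ha : a.PosDef) (r : ℝ) : mpow a r * mpow a (-r) = 1 := by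
  have hsa : IsSelfAdjoint a := ha.isHermitian
  have hc : ∀ s : ℝ, ContinuousOn (fun t : ℝ => t ^ s) (spectrum ℝ a) := fun s =>
    continuousOn_id.rpow_const fun x hx => Or.inl (spectrum_pos ha hx).ne'
  rw [mpow, mpow, ← cfc_mul _ _ a (hc _) (hc _)]
  rw [cfc_congr (g := fun _ => (1 : ℝ)), cfc_const_one ℝ a hsa]
  intro t ht
  have := spectrum_pos ha ht
  simp only
  rw [← Real.rpow_add this, add_neg_cancel, Real.rpow_zero]

variable {d : ℕ}

/-- The entries of a real power of a matrix weight are measurable. -/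
lemma IsMatrixWeight.aemeasurable_mpow {W : Rd d → Mat m} (hW : IsMatrixWeight W) (r : ℝ)
    (i j : Fin m) : AEMeasurable (fun x => mpow (W x) r i j) volume := by
  classical
  let _ : MeasurableSpace (Mat m) := borel _
  have _ : BorelSpace (Mat m) := ⟨rfl⟩
  have hWm : AEMeasurable W volume := by
    have h1 : AEMeasurable (fun x => (fun i j => W x i j : Fin m → Fin m → ℂ)) volume :=
      aemeasurable_pi_lambda _ fun i => aemeasurable_pi_lambda _ fun j => hW.aemeasurable i j
    have h2 : Continuous fun u : Fin m → Fin m → ℂ => (Matrix.of u : Mat m) := by fun_prop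
    exact h2.measurable.comp_aemeasurable h1
  -- The power is continuous on each closed set of matrices with spectrum in a compact subinterval
  -- of (0, ∞), and every positive definite matrix eventually belongs to these sets; measurability
  -- follows by a pointwise limit.
  have hmeas : ∀ n, Measurable ((pinched m n).indicator fun a => mpow a r) := by
    intro n
    refine measurable_of_restrict_of_restrict_compl (isClosed_pinched n).measurableSet ?_ ?_
    · have : (pinched m n).domRestrict ((pinched m n).indicator fun a => mpow a r) =
        (pinched m n).domRestrict fun a => mpow a r := by
        ext1 x; simp [Set.domRestrict_apply]
      rw [this]
      exact (continuousOn_mpow n r).domRestrict.measurable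
    · have : (pinched m n)ᶜ.domRestrict ((pinched m n).indicator fun a => mpow a r) =
        fun _ => 0 := by
        ext1 x; exact Set.indicator_of_notMem x.2 _
      rw [this]
      exact measurable_const
  have hentry : Continuous fun a : Mat m => a i j := by fun_prop
  refine aemeasurable_of_tendsto_metrizable_ae atTop
    (f := fun (n : ℕ) x => ((pinched m n).indicator (fun a => mpow a r) (W x)) i j)
    (fun n => (hentry.measurable.comp (hmeas n)).comp_aemeasurable hWm) ?_
  filter_upwards [hW.posDef] with x hx
  refine tendsto_const_nhds.congr' ?_
  filter_upwards [eventually_mem_pinched hx] with n hn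
  rw [Set.indicator_of_mem hn]

end powers

/-! ### Matrices acting on vector functions -/

section action

variable {d m : ℕ}

lemma act_apply (A : Mat m) (v : Cm m) (i : Fin m) : act A v i = ∑ j, A i j * v j := by
  rfl

lemma act_mul (A B : Mat m) (v : Cm m) : act (A * B) v = act A (act B v) := by
  simp [act]

lemma act_one (v : Cm m) : act (1 : Mat m) v = v := by
  simp [act]

lemma aemeasurable_act {A : Rd d → Mat m} {f : Rd d → Cm m}
    (hA : ∀ i j, AEMeasurable (fun x => A x i j) volume)
    (hf : ∀ i, AEMeasurable (fun x => f x i) volume) (i : Fin m) :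
    AEMeasurable (fun x => act (A x) (f x) i) volume := by
  simp only [act_apply]
  exact Finset.aemeasurable_fun_sum _ fun j _ => (hA i j).mul (hf j)

lemma aemeasurable_coord {f : Rd d → Cm m} (hf : AEStronglyMeasurable f volume) (i : Fin m) :
    AEMeasurable (fun x => f x i) volume :=
  ((EuclideanSpace.proj (𝕜 := ℂ) i).continuous.comp_aestronglyMeasurable hf).aemeasurable

lemma aestronglyMeasurable_of_coord {f : Rd d → Cm m}
    (hf : ∀ i, AEMeasurable (fun x => f x i) volume) : AEStronglyMeasurable f volume := by
  have h1 : AEMeasurable (fun x => (fun i => f x i : Fin m → ℂ)) volume :=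
    aemeasurable_pi_lambda _ hf
  exact ((PiLp.continuous_toLp 2 _).measurable.comp_aemeasurable h1).aestronglyMeasurable

/-- A matrix weight with the powers `1 / p` and `-1 / p` acting inversely to each other. -/
lemma IsMatrixWeight.ae_act_mpow_neg {W : Rd d → Mat m} (hW : IsMatrixWeight W) (r : ℝ) :
    ∀ᵐ x ∂(volume : Measure (Rd d)), ∀ v, act (mpow (W x) (-r)) (act (mpow (W x) r) v) = v := by
  filter_upwards [hW.posDef] with x hx v
  have := mpow_mul_mpow_neg hx (-r)
  rw [neg_neg] at this
  rw [← act_mul, this, act_one]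

lemma IsMatrixWeight.aemeasurable_of_weighted {p : ℝ} {U : Rd d → Mat m} (hU : IsMatrixWeight U)
    {f : Rd d → Cm m} (hf : AEStronglyMeasurable (weighted p U f) volume) (i : Fin m) :
    AEMeasurable (fun x => f x i) volume := by
  refine (aemeasurable_act (hU.aemeasurable_mpow (-(1 / p))) (aemeasurable_coord hf) i).congr ?_
  filter_upwards [hU.ae_act_mpow_neg (1 / p)] with x hx
  rw [weighted, hx]

end action

/-! ### Well-definedness of the commutator and density of its domain -/

section welldefined

variable {d m : ℕ} {T : LTwoOp d}

lemma integrable_coord {f : Rd d → Cm m} (hf : Integrable f volume) (i : Fin m) :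
    Integrable (fun x => f x i) volume :=
  (EuclideanSpace.proj (𝕜 := ℂ) i).integrable_comp hf

lemma exists_isTensorValue {C : ℝ≥0} (hT : HasWeakType T C) {f : Rd d → Cm m}
    (hf : Integrable f volume) : ∃ g, IsTensorValue T f g := by
  choose g hg using fun i => exists_isValue hT (integrable_coord hf i)
  exact ⟨fun x => WithLp.toLp 2 fun i => g i x, fun i => hg i⟩

lemma IsTensorValue.ae_eq {C : ℝ≥0} (hT : HasWeakType T C) {f g g' : Rd d → Cm m}
    (hf : Integrable f volume) (hg : IsTensorValue T f g) (hg' : IsTensorValue T f g') :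
    g =ᵐ[volume] g' := by
  have h := ae_all_iff.2 fun i =>
    IsValue.ae_eq hT (integrable_coord hf i).aestronglyMeasurable (hg i) (hg' i)
  filter_upwards [h] with x hx
  ext i
  exact hx i

/-- The commutator is well defined on its initial domain. -/
lemma exists_unique_isCommutatorValue {C : ℝ≥0} (hT : HasWeakType T C) {p : ℝ}
    {U B : Rd d → Mat m} {f : Rd d → Cm m} (hf : f ∈ commDomain p U B) :
    ∃ h, IsCommutatorValue T B f h ∧
      ∀ h', IsCommutatorValue T B f h' → h' =ᵐ[volume] h := by
  obtain ⟨-, hf1, hf2⟩ := hf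
  obtain ⟨u, hu⟩ := exists_isTensorValue hT hf1
  obtain ⟨v, hv⟩ := exists_isTensorValue hT hf2
  refine ⟨fun x => mul B u x - v x, ⟨u, v, hu, hv, .rfl⟩, ?_⟩
  rintro h' ⟨u', v', hu', hv', hh⟩
  filter_upwards [hh, IsTensorValue.ae_eq hT hf1 hu' hu, IsTensorValue.ae_eq hT hf2 hv' hv]
    with x h1 h2 h3
  rw [h1, h3, mul, mul, h2]

/-- The initial domain of the commutator is dense in `L^p(U)`. -/
lemma exists_commDomain_wNorm_sub_lt {p : ℝ} (hp : 0 < p) {U B : Rd d → Mat m}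
    (hU : IsMatrixWeight U) (hB : ∀ i j, AEMeasurable (fun x => B x i j) volume)
    {f : Rd d → Cm m} (hf : MemLp (weighted p U f) (ENNReal.ofReal p) volume)
    {ε : ℝ≥0∞} (hε : 0 < ε) :
    ∃ f₀ ∈ commDomain p U B, wNorm p U (f - f₀) < ε := by
  have hfc := fun i => hU.aemeasurable_of_weighted hf.1 i
  have hfm : AEStronglyMeasurable f volume := aestronglyMeasurable_of_coord hfc
  have hBfm : AEStronglyMeasurable (mul B f) volume :=
    aestronglyMeasurable_of_coord (aemeasurable_act hB hfc)
  have hφ : AEMeasurable (fun x => ‖x‖ + ‖f x‖ + ‖mul B f x‖) volume := by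
    have := hfm.norm.aemeasurable
    have := hBfm.norm.aemeasurable
    fun_prop
  set φ := hφ.mk _ with hφdef
  have hφm : Measurable φ := hφ.measurable_mk
  -- On such a set x, f and Bf are all bounded, so cutting f to it gives an element of the domain
  -- without any integrability of the weight.
  set G : ℕ → Set (Rd d) := fun n => {x | φ x ≤ n} with hG
  have hGm : ∀ n, MeasurableSet (G n) := fun n => measurableSet_le hφm measurable_const
  have hGfin : ∀ n, volume (G n) ≠ ⊤ := fun n => by
    refine ((measure_mono_ae ?_).trans_lt
      (measure_closedBall_lt_top (x := (0 : Rd d)) (r := n))).ne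
    filter_upwards [hφ.ae_eq_mk] with x hx hxG
    have : φ x ≤ n := hxG
    rw [hφdef, ← hx] at this
    have h1 : ‖x‖ ≤ n := by linarith [norm_nonneg (f x), norm_nonneg (mul B f x)]
    exact mem_closedBall_zero_iff.2 h1
  have hmem : ∀ n, (G n).indicator f ∈ commDomain p U B := by
    intro n
    have hw : weighted p U ((G n).indicator f) = (G n).indicator (weighted p U f) := by
      ext1 x; by_cases hx : x ∈ G n <;> simp [weighted, hx]
    have hb : mul B ((G n).indicator f) = (G n).indicator (mul B f) := by
      ext1 x; by_cases hx : x ∈ G n <;> simp [mul, hx]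
    refine ⟨by rw [hw]; exact hf.indicator (hGm n), ?_, ?_⟩
    · refine (integrable_indicator_iff (hGm n)).2
        (Measure.integrableOn_of_bounded (M := n) (hGfin n) hfm ?_)
      rw [ae_restrict_iff' (hGm n)]
      filter_upwards [hφ.ae_eq_mk] with x hx hxG
      have : φ x ≤ n := hxG
      rw [hφdef, ← hx] at this
      linarith [norm_nonneg x, norm_nonneg (mul B f x)]
    · rw [hb]
      refine (integrable_indicator_iff (hGm n)).2
        (Measure.integrableOn_of_bounded (M := n) (hGfin n) hBfm ?_)
      rw [ae_restrict_iff' (hGm n)]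
      filter_upwards [hφ.ae_eq_mk] with x hx hxG
      have : φ x ≤ n := hxG
      rw [hφdef, ← hx] at this
      linarith [norm_nonneg x, norm_nonneg (f x)]
  have hp0 : ENNReal.ofReal p ≠ 0 := by simpa using hp
  have hlim : Tendsto (fun n => wNorm p U (f - (G n).indicator f)) atTop (𝓝 0) := by
    have hw : ∀ n, wNorm p U (f - (G n).indicator f) =
        (∫⁻ x in (G n)ᶜ, ‖weighted p U f x‖ₑ ^ p) ^ (1 / p) := by
      intro n
      have : weighted p U (f - (G n).indicator f) = (G n)ᶜ.indicator (weighted p U f) := by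
        ext1 x; by_cases hx : x ∈ G n <;> simp [weighted, hx]
      rw [wNorm, this, eLpNorm_indicator_eq_eLpNorm_restrict (hGm n).compl,
        eLpNorm_eq_lintegral_rpow_enorm_toReal hp0 ENNReal.ofReal_ne_top,
        ENNReal.toReal_ofReal hp.le]
    have hfin : ∫⁻ x, ‖weighted p U f x‖ₑ ^ p ≠ ⊤ := by
      have := (eLpNorm_lt_top_iff_lintegral_rpow_enorm_lt_top hp0 ENNReal.ofReal_ne_top).1 hf.2
      rw [ENNReal.toReal_ofReal hp.le] at this
      exact this.ne
    have h0 : Tendsto (fun n => ∫⁻ x in (G n)ᶜ, ‖weighted p U f x‖ₑ ^ p) atTop (𝓝 0) := by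
      have hlim0 := tendsto_lintegral_of_dominated_convergence'
        (F := fun n => (G n)ᶜ.indicator fun x => ‖weighted p U f x‖ₑ ^ p) (f := fun _ => 0)
        (fun x => ‖weighted p U f x‖ₑ ^ p)
        (fun n => (hf.1.enorm.pow_const p).indicator (hGm n).compl)
        (fun n => Eventually.of_forall fun x => Set.indicator_le_self _ _ x) hfin
        (Eventually.of_forall fun x => by
          refine tendsto_const_nhds.congr' ?_
          filter_upwards [eventually_ge_atTop ⌈φ x⌉₊] with n hn
          have hx : x ∈ G n := Nat.ceil_le.1 hn
          simp [hx])
      simpa [lintegral_indicator (hGm _).compl] using hlim0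
    simp only [hw]
    have := (ENNReal.continuous_rpow_const (y := 1 / p)).tendsto 0
    rw [ENNReal.zero_rpow_of_pos (by positivity)] at this
    exact this.comp h0
  obtain ⟨n, hn⟩ := (hlim.eventually_lt_const hε).exists
  exact ⟨_, hmem n, hn⟩

end welldefined

/-! ### The bilinear estimate on one cube -/

section bilinear

variable {d : ℕ}

/-- The mixed Luxemburg norms of `N`, in one of the two orders, are at most `κ` on all cubes. -/
def HasMixedBound (C D : ℝ≥0 → ℝ≥0) (N : Rd d → Rd d → ℝ≥0∞) (κ : ℝ≥0∞) : Prop :=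
  (∀ (a : Rd d) (l : ℝ), 0 < l →
    luxNorm D (cube a l) (fun y => luxNorm C (cube a l) fun x => N x y) ≤ κ) ∨
  (∀ (a : Rd d) (l : ℝ), 0 < l →
    luxNorm C (cube a l) (fun x => luxNorm D (cube a l) fun y => N x y) ≤ κ)

lemma aemeasurable_dotProduct_prod {ι : Type*} [Fintype ι] {w F : Rd d → ι → ℂ}
    (hw : ∀ i, AEMeasurable (fun x => w x i) volume)
    (hF : ∀ i, AEMeasurable (fun x => F x i) volume) (s t : Set (Rd d)) :
    AEMeasurable (fun z : Rd d × Rd d => dotProduct (w z.1) (F z.2))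
      ((volume.restrict s).prod (volume.restrict t)) :=
  Finset.aemeasurable_fun_sum _ fun i _ =>
    ((hw i).restrict.comp_quasiMeasurePreserving Measure.quasiMeasurePreserving_fst).mul
      ((hF i).restrict.comp_quasiMeasurePreserving Measure.quasiMeasurePreserving_snd)

/-- Fubini is applied to |w·F|, which is almost everywhere measurable on the product; the kernel `N`
enters only afterwards as a pointwise majorant and needs no measurability. For the second order of
the norms no interchange is needed. -/
lemma HasMixedBound.lintegral_le {C D : ℝ≥0 → ℝ≥0} {N : Rd d → Rd d → ℝ≥0∞} {κ : ℝ≥0∞}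
    (hN : HasMixedBound C D N κ) (hκ : κ ≠ ⊤) {ι : Type*} [Fintype ι] {w F : Rd d → ι → ℂ}
    (hw : ∀ i, AEMeasurable (fun x => w x i) volume)
    (hF : ∀ i, AEMeasurable (fun x => F x i) volume) {g h : Rd d → ℝ≥0∞}
    (hg : Measurable g) (hh : Measurable h) (hgt : ∀ x, g x ≠ ⊤) (hht : ∀ x, h x ≠ ⊤)
    (hle : ∀ᵐ y, ∀ x, ‖dotProduct (w x) (F y)‖ₑ ≤ N x y * h y) {a : Rd d} {l : ℝ} (hl : 0 < l)
    (hgl : luxNormE (conjE C) (cube a l) g ≠ ⊤) (hhl : luxNormE (conjE D) (cube a l) h ≠ ⊤) :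
    ∫⁻ x in cube a l, (∫⁻ y in cube a l, ‖dotProduct (w x) (F y)‖ₑ) * g x ≤
      4 * volume (cube a l) ^ 2 * κ * luxNormE (conjE C) (cube a l) g *
        luxNormE (conjE D) (cube a l) h := by
  have hQ0 : volume (cube a l) ≠ 0 := by
    rw [volume_cube]; exact (ENNReal.pow_pos (ENNReal.ofReal_pos.2 hl) _).ne'
  have hQt : volume (cube a l) ≠ ⊤ := by
    rw [volume_cube]; exact ENNReal.pow_ne_top ENNReal.ofReal_ne_top
  set Q := cube a l
  have hle' : ∀ᵐ y ∂volume.restrict Q, ∀ x, ‖dotProduct (w x) (F y)‖ₑ ≤ N x y * h y :=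
    ae_restrict_of_ae hle
  rcases hN with hN | hN
  · calc ∫⁻ x in Q, (∫⁻ y in Q, ‖dotProduct (w x) (F y)‖ₑ) * g x
        = ∫⁻ x in Q, ∫⁻ y in Q, ‖dotProduct (w x) (F y)‖ₑ * g x := by
          refine lintegral_congr fun x => ?_
          rw [lintegral_mul_const' _ _ (hgt x)]
      _ = ∫⁻ y in Q, ∫⁻ x in Q, ‖dotProduct (w x) (F y)‖ₑ * g x :=
          lintegral_lintegral_swap ((aemeasurable_dotProduct_prod hw hF Q Q).enorm.mul
            (hg.comp measurable_fst).aemeasurable)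
      _ ≤ ∫⁻ y in Q, (∫⁻ x in Q, N x y * g x) * h y := by
          refine lintegral_mono_ae ?_
          filter_upwards [hle'] with y hy
          rw [← lintegral_mul_const' _ _ (hht y)]
          refine lintegral_mono fun x => ?_
          calc ‖dotProduct (w x) (F y)‖ₑ * g x ≤ N x y * h y * g x := by gcongr; exact hy x
            _ = N x y * g x * h y := by ring
      _ ≤ _ := lintegral_lintegral_mul_le hQ0 hQt N hg.aemeasurable hh.aemeasurable hκ
          (hN a l hl) hgl hhl
  · calc ∫⁻ x in Q, (∫⁻ y in Q, ‖dotProduct (w x) (F y)‖ₑ) * g x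
        ≤ ∫⁻ x in Q, (∫⁻ y in Q, N x y * h y) * g x := by
          refine lintegral_mono fun x => ?_
          gcongr ?_ * _
          refine lintegral_mono_ae ?_
          filter_upwards [hle'] with y hy using hy x
      _ ≤ 4 * volume Q ^ 2 * κ * luxNormE (conjE D) Q h * luxNormE (conjE C) Q g :=
          lintegral_lintegral_mul_le hQ0 hQt (fun y x => N x y) hh.aemeasurable hg.aemeasurable hκ
            (hN a l hl) hhl hgl
      _ = _ := by ring

/-- The maximal function is finite at some point of the cube, and it dominates the Luxemburg norm
there. -/
lemma luxNormE_ne_top_of_lintegral_maxFn {Φ : ℝ≥0∞ → ℝ≥0∞} {h : Rd d → ℝ≥0∞} {q : ℝ}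
    (hq : 0 < q) (hfin : ∫⁻ x, maxFn Φ h x ^ q ≠ ⊤) (k : ℤ) (n : Fin d → ℤ) :
    luxNormE Φ (tripleCube k n) h ≠ ⊤ := by
  have hae : ∀ᵐ x ∂volume.restrict (dyadicCube k n), maxFn Φ h x ^ q < ⊤ :=
    ae_restrict_of_ae (ae_lt_top ((measurable_maxFn Φ h).pow_const q) hfin)
  have hmem := ae_restrict_mem (μ := volume) (measurableSet_dyadicCube k n)
  have : (ae (volume.restrict (dyadicCube k n))).NeBot := by
    rw [ae_neBot, Ne, Measure.restrict_eq_zero]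
    exact (volume_dyadicCube_pos k n).ne'
  obtain ⟨x, hx, hxm⟩ := (hae.and hmem).exists
  refine ((luxNormE_le_maxFn hxm).trans_lt ?_).ne
  by_contra hc
  rw [not_lt_top_iff.1 hc, ENNReal.top_rpow_of_pos hq] at hx
  exact lt_irrefl _ hx

/-- The bilinear `L^p × L^{p'}` estimate on a single cube. -/
theorem exists_bilinear_bound (hd : 0 < d) (ι : Type*) [Fintype ι] {T : LTwoOp d}
    {K : Rd d → Rd d → ℂ} {c δ : ℝ} (hK : IsStandardKernel K c δ) (hT : HasKernel T K)
    {p q : ℝ} (hpq : p.HolderConjugate q) {C D : ℝ≥0 → ℝ≥0}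
    (hC : MemB (conj C) q) (hD : MemB (conj D) p) :
    ∃ A : ℝ≥0, ∀ F : Rd d → ι → ℂ, (∀ i, MemLp (fun x => F x i) 2 volume) →
      ∀ w : Rd d → ι → ℂ, (∀ i, AEMeasurable (fun x => w x i) volume) →
      ∀ (N : Rd d → Rd d → ℝ≥0∞) (κ : ℝ≥0∞), HasMixedBound C D N κ → κ ≠ ⊤ →
      ∀ g h : Rd d → ℝ≥0∞, Measurable g → Measurable h → (∀ x, g x ≠ ⊤) → (∀ x, h x ≠ ⊤) →
      (∀ᵐ y, ∀ x, ‖dotProduct (w x) (F y)‖ₑ ≤ N x y * h y) →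
      ∫⁻ x, h x ^ p ≠ ⊤ → ∫⁻ x, g x ^ q ≠ ⊤ →
      ∀ (k : ℤ) (n : Fin d → ℤ),
        ∫⁻ x in dyadicCube k n, ‖dotProduct (w x) (opVec T F (tripleCube k n) x)‖ₑ * g x ≤
          A * κ * ((∫⁻ x, h x ^ p) ^ (1 / p) * (∫⁻ x, g x ^ q) ^ (1 / q)) := by
  obtain ⟨A, hA⟩ := exists_sparse_form_bound hd ι hK hT
  obtain ⟨KC, hKC⟩ := exists_maxFn_bound hd hC hpq.symm.pos
  obtain ⟨KD, hKD⟩ := exists_maxFn_bound hd hD hpq.pos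
  have hp0 := hpq.pos
  have hq0 := hpq.symm.pos
  refine ⟨A * (3 ^ d * 4) * (KD ^ (1 / p) * KC ^ (1 / q)), ?_⟩
  intro F hF w hw N κ hN hκ g h hg hh hgt hht hle hhI hgI k n
  have hMh : ∫⁻ x, maxFn (conjE D) h x ^ p ≠ ⊤ :=
    ((hKD h hh).trans_lt (ENNReal.mul_lt_top (by simp) hhI.lt_top)).ne
  have hMg : ∫⁻ x, maxFn (conjE C) g x ^ q ≠ ⊤ :=
    ((hKC g hg).trans_lt (ENNReal.mul_lt_top (by simp) hgI.lt_top)).ne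
  -- The Hölder bound carries |3Q|² while the form bound is normalized by |3Q||Q|; the quotient is
  -- 3^d, and 4 comes from using Young's inequality twice.
  set M : Rd d → ℝ≥0∞ := fun x =>
    3 ^ d * 4 * κ * (maxFn (conjE D) h x * maxFn (conjE C) g x) with hM
  have hsp := hA F hF w hw g M hg.aemeasurable (fun k n x hx => by
    calc ∫⁻ x' in dyadicCube k n, (∫⁻ y in tripleCube k n, ‖dotProduct (w x') (F y)‖ₑ) * g x'
        ≤ ∫⁻ x' in tripleCube k n, (∫⁻ y in tripleCube k n, ‖dotProduct (w x') (F y)‖ₑ) * g x' :=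
          lintegral_mono_set (dyadicCube_subset_tripleCube k n)
      _ ≤ 4 * volume (tripleCube k n) ^ 2 * κ * luxNormE (conjE C) (tripleCube k n) g *
            luxNormE (conjE D) (tripleCube k n) h := by
          have h1 := luxNormE_ne_top_of_lintegral_maxFn hq0 hMg k n
          have h2 := luxNormE_ne_top_of_lintegral_maxFn hp0 hMh k n
          rw [tripleCube_eq_cube] at h1 h2 ⊢
          exact hN.lintegral_le hκ hw (fun i => (hF i).1.aemeasurable) hg hh hgt hht hle
            (by positivity) h1 h2
      _ ≤ 4 * volume (tripleCube k n) ^ 2 * κ * maxFn (conjE C) g x * maxFn (conjE D) h x := by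
          gcongr
          · exact luxNormE_le_maxFn hx
          · exact luxNormE_le_maxFn hx
      _ = volume (tripleCube k n) * volume (dyadicCube k n) * M x := by
          rw [hM, sq]
          nth_rw 2 [volume_tripleCube]
          ring) k n
  refine hsp.trans ?_
  have hHol := ENNReal.lintegral_mul_le_Lp_mul_Lq volume hpq
    (measurable_maxFn (conjE D) h).aemeasurable (measurable_maxFn (conjE C) g).aemeasurable
  calc (A : ℝ≥0∞) * ∫⁻ x in dyadicCube k n, M x ≤ A * ∫⁻ x, M x := by
        exact mul_le_mul_right (setLIntegral_le_lintegral _ _) _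
    _ = A * (3 ^ d * 4 * κ) * ∫⁻ x, maxFn (conjE D) h x * maxFn (conjE C) g x := by
        simp only [hM]
        rw [lintegral_const_mul _ (by
          exact (measurable_maxFn (conjE D) h).mul (measurable_maxFn (conjE C) g)), ← mul_assoc]
    _ ≤ A * (3 ^ d * 4 * κ) * ((∫⁻ x, maxFn (conjE D) h x ^ p) ^ (1 / p) *
          (∫⁻ x, maxFn (conjE C) g x ^ q) ^ (1 / q)) := by gcongr; exact hHol
    _ ≤ A * (3 ^ d * 4 * κ) * ((KD * ∫⁻ x, h x ^ p) ^ (1 / p) *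
          (KC * ∫⁻ x, g x ^ q) ^ (1 / q)) := by
        gcongr
        · exact hKD h hh
        · exact hKC g hg
    _ = _ := by
        rw [ENNReal.mul_rpow_of_nonneg _ _ (by positivity),
          ENNReal.mul_rpow_of_nonneg _ _ (by positivity)]
        push_cast
        rw [ENNReal.coe_rpow_of_nonneg _ (by positivity),
          ENNReal.coe_rpow_of_nonneg _ (by positivity)]
        ring

end bilinear

/-! ### Exhaustion of space by the dyadic cubes at the origin -/

section boxes

variable {d : ℕ}

/-- The index of one of the `2^d` dyadic cubes having the origin as a vertex. -/
def cornerIdx (b : Fin d → Bool) : Fin d → ℤ := fun i => if b i then -1 else 0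

/-- The cube `[-2^k, 2^k)^d`, as a union of dyadic cubes. -/
def originBox (d k : ℕ) : Set (Rd d) := ⋃ b : Fin d → Bool, dyadicCube k (cornerIdx b)

lemma measurableSet_originBox (k : ℕ) : MeasurableSet (originBox d k) :=
  MeasurableSet.iUnion fun _ => measurableSet_dyadicCube _ _

lemma volume_originBox_ne_top (k : ℕ) : volume (originBox d k) ≠ ⊤ := by
  refine ((measure_iUnion_le _).trans_lt ?_).ne
  rw [tsum_fintype]
  exact ENNReal.sum_lt_top.2 fun b _ => volume_dyadicCube_lt_top _ _

/-- Coordinates of corner indices lie in {-1, 0} and so differ by at most one. Dyadic cubes around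
one point exhaust only an orthant, whereas the triple of each corner cube contains the whole box. -/
lemma originBox_subset_tripleCube (k : ℕ) (b : Fin d → Bool) :
    originBox d k ⊆ tripleCube k (cornerIdx b) := by
  intro x hx i
  obtain ⟨b', hb'⟩ := Set.mem_iUnion.1 hx
  have : dyadicIdx k x = cornerIdx b' := hb'
  rw [this, cornerIdx, cornerIdx]
  split_ifs <;> simp

lemma eventually_mem_originBox (x : Rd d) : ∀ᶠ k : ℕ in atTop, x ∈ originBox d k := by
  have h : ∀ᶠ k : ℕ in atTop, ‖x‖ < 2 ^ k :=
    (tendsto_pow_atTop_atTop_of_one_lt one_lt_two).eventually_gt_atTop ‖x‖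
  filter_upwards [h] with k hk
  refine Set.mem_iUnion.2 ⟨fun i => decide (x i < 0), ?_⟩
  change dyadicIdx k x = _
  ext i
  have h1 : |x i| < 2 ^ k := (PiLp.norm_apply_le x i).trans_lt hk
  rw [abs_lt] at h1
  rw [dyadicIdx_eq_iff, cornerIdx, zpow_natCast]
  by_cases hx : x i < 0 <;> simp only [hx, decide_true, decide_false, if_true] <;>
    push_cast
  · constructor <;> linarith
  · constructor <;> simp <;> linarith

lemma setLIntegral_originBox_le {k : ℕ} {φ : Rd d → ℝ≥0∞} {R : ℝ≥0∞}
    (h : ∀ b : Fin d → Bool, ∫⁻ x in dyadicCube k (cornerIdx b), φ x ≤ R) :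
    ∫⁻ x in originBox d k, φ x ≤ 2 ^ d * R := by
  refine (lintegral_iUnion_le _ _).trans ?_
  rw [tsum_fintype]
  refine (Finset.sum_le_sum fun b _ => h b).trans ?_
  simp

end boxes

/-! ### Duality in L^p -/

section duality

variable {α : Type*} [MeasurableSpace α] {μ : Measure α} [SigmaFinite μ]

/-- The converse of Hölder's inequality, for nonnegative functions. -/
theorem lintegral_rpow_le_of_dual {p q : ℝ} (hpq : p.HolderConjugate q) {Φ : α → ℝ≥0∞}
    (hΦ : AEMeasurable Φ μ) {R : ℝ≥0∞}
    (h : ∀ g : α → ℝ≥0∞, Measurable g → (∀ x, g x ≠ ⊤) → ∫⁻ x, g x ^ q ∂μ ≠ ⊤ →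
      ∫⁻ x, Φ x * g x ∂μ ≤ R * (∫⁻ x, g x ^ q ∂μ) ^ (1 / q)) :
    (∫⁻ x, Φ x ^ p ∂μ) ^ (1 / p) ≤ R := by
  have hp0 := hpq.pos
  have hq0 := hpq.symm.pos
  set Ψ := hΦ.mk Φ with hΨ
  have hΨm : Measurable Ψ := hΦ.measurable_mk
  -- Bounded truncations on sets of finite measure: the integral of τ^p is finite, so it can be
  -- divided out below.
  set τ : ℕ → α → ℝ≥0∞ := fun n => (spanningSets μ n).indicator fun x => min (Ψ x) n with hτ
  have hτm : ∀ n, Measurable (τ n) := fun n =>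
    (hΨm.min measurable_const).indicator (measurableSet_spanningSets μ n)
  have hτn : ∀ n x, τ n x ≤ n := fun n x =>
    (Set.indicator_le_self _ _ x).trans (min_le_right _ _)
  have hτΨ : ∀ n x, τ n x ≤ Ψ x := fun n x =>
    (Set.indicator_le_self _ _ x).trans (min_le_left _ _)
  have hτt : ∀ n x, τ n x ≠ ⊤ := fun n x => ((hτn n x).trans_lt (ENNReal.natCast_lt_top n)).ne
  have hI : ∀ n, ∫⁻ x, τ n x ^ p ∂μ ≠ ⊤ := by
    intro n
    refine (lt_of_le_of_lt (b := ∫⁻ x in spanningSets μ n, (n : ℝ≥0∞) ^ p ∂μ) ?_ ?_).ne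
    · rw [← lintegral_indicator (measurableSet_spanningSets μ n)]
      refine lintegral_mono fun x => ?_
      by_cases hx : x ∈ spanningSets μ n
      · rw [Set.indicator_of_mem hx]; exact ENNReal.rpow_le_rpow (hτn n x) hp0.le
      · simp [hτ, hx, hp0]
    · rw [setLIntegral_const]
      exact ENNReal.mul_lt_top (ENNReal.rpow_lt_top_of_nonneg hp0.le (by simp))
        (measure_spanningSets_lt_top μ n)
  have hbound : ∀ n, ∫⁻ x, τ n x ^ p ∂μ ≤ R ^ p := by
    intro n
    set I := ∫⁻ x, τ n x ^ p ∂μ with hIdef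
    have hpow : ∀ x, (τ n x ^ (p - 1)) ^ q = τ n x ^ p := fun x => by
      rw [← ENNReal.rpow_mul, hpq.sub_one_mul_conj]
    -- The extremal test function: its q-th power is τ^p because (p - 1)q = p.
    have hg := h (fun x => τ n x ^ (p - 1)) ((hτm n).pow_const _)
      (fun x => ENNReal.rpow_ne_top_of_nonneg hpq.sub_one_pos.le (hτt n x))
      (by simp only [hpow]; exact hI n)
    simp only [hpow] at hg
    have h1 : I ≤ R * I ^ (1 / q) := by
      refine le_trans ?_ hg
      refine lintegral_mono_ae ?_
      filter_upwards [hΦ.ae_eq_mk] with x hx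
      calc τ n x ^ p = τ n x * τ n x ^ (p - 1) := by
            nth_rw 2 [← ENNReal.rpow_one (τ n x)]
            rw [← ENNReal.rpow_add_of_nonneg _ _ zero_le_one hpq.sub_one_pos.le]
            congr 1; ring
        _ ≤ Φ x * τ n x ^ (p - 1) := by gcongr; rw [hx]; exact hτΨ n x
    by_cases hI0 : I = 0
    · rw [hI0]; exact zero_le
    have hIt : I ≠ ⊤ := hI n
    have h2 : I ^ (1 / p) ≤ R := by
      have h3 : I = I ^ (1 / p) * I ^ (1 / q) := by
        rw [← ENNReal.rpow_add _ _ hI0 hIt, one_div, one_div, hpq.inv_add_inv_eq_one,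
          ENNReal.rpow_one]
      nth_rw 1 [h3] at h1
      have h5 : I ^ (1 / q) ≠ 0 := by simp [hI0, hIt]
      have h6 : I ^ (1 / q) ≠ ⊤ := ENNReal.rpow_ne_top_of_nonneg (by positivity) hIt
      exact (ENNReal.mul_le_mul_iff_left h5 h6).1 h1
    calc I = (I ^ (1 / p)) ^ p := by
          rw [← ENNReal.rpow_mul, one_div, inv_mul_cancel₀ hp0.ne', ENNReal.rpow_one]
      _ ≤ R ^ p := by gcongr
  have hlim : ∫⁻ x, Φ x ^ p ∂μ ≤ R ^ p := by
    calc ∫⁻ x, Φ x ^ p ∂μ = ∫⁻ x, Ψ x ^ p ∂μ := by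
          refine lintegral_congr_ae ?_
          filter_upwards [hΦ.ae_eq_mk] with x hx; rw [hx]
      _ = ∫⁻ x, liminf (fun n => τ n x ^ p) atTop ∂μ := by
          refine lintegral_congr fun x => ?_
          have hm : Tendsto (fun n : ℕ => min (Ψ x) n) atTop (𝓝 (min (Ψ x) ⊤)) :=
            tendsto_const_nhds.min ENNReal.tendsto_nat_nhds_top
          rw [min_eq_left le_top] at hm
          have hm' : Tendsto (fun n => τ n x) atTop (𝓝 (Ψ x)) := by
            refine hm.congr' ?_
            filter_upwards [eventually_ge_atTop (spanningSetsIndex μ x)] with n hn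
            have : x ∈ spanningSets μ n :=
              mem_spanningSets_of_index_le μ x hn
            rw [hτ]; simp only [Set.indicator_of_mem this]
          exact (((ENNReal.continuous_rpow_const (y := p)).tendsto _).comp hm').liminf_eq.symm
      _ ≤ liminf (fun n => ∫⁻ x, τ n x ^ p ∂μ) atTop :=
          lintegral_liminf_le fun n => (hτm n).pow_const p
      _ ≤ R ^ p := by
          refine (liminf_le_liminf (Eventually.of_forall hbound)).trans ?_
          rw [liminf_const]
  calc (∫⁻ x, Φ x ^ p ∂μ) ^ (1 / p) ≤ (R ^ p) ^ (1 / p) := by gcongr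
    _ = R := by rw [← ENNReal.rpow_mul, one_div, mul_inv_cancel₀ hp0.ne', ENNReal.rpow_one]

end duality

/-! ### Passage from L² to L¹ by truncation -/

section limits

variable {d : ℕ}

lemma exists_seq_tendsto_ae_of_forall {α ι E : Type*} [Finite ι] [MeasurableSpace α]
    {μ : Measure α} [NormedAddCommGroup E] {f : ι → ℕ → α → E} {g : ι → α → E}
    (h : ∀ i, TendstoInMeasure μ (f i) atTop (g i)) :
    ∃ ns : ℕ → ℕ, StrictMono ns ∧
      ∀ᵐ x ∂μ, ∀ i, Tendsto (fun n => f i (ns n) x) atTop (𝓝 (g i x)) := by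
  classical
  have := Fintype.ofFinite ι
  suffices H : ∀ s : Finset ι, ∃ ns : ℕ → ℕ, StrictMono ns ∧
      ∀ i ∈ s, ∀ᵐ x ∂μ, Tendsto (fun n => f i (ns n) x) atTop (𝓝 (g i x)) by
    obtain ⟨ns, hns, hs⟩ := H Finset.univ
    exact ⟨ns, hns, ae_all_iff.2 fun i => hs i (Finset.mem_univ i)⟩
  intro s
  induction s using Finset.induction_on with
  | empty => exact ⟨id, strictMono_id, by simp⟩
  | insert i s his ih =>
    obtain ⟨ns, hns, hs⟩ := ih
    obtain ⟨ms, hms, hm⟩ := ((h i).comp hns.tendsto_atTop).exists_seq_tendsto_ae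
    refine ⟨ns ∘ ms, hns.comp hms, fun j hj => ?_⟩
    rcases Finset.mem_insert.1 hj with rfl | hj
    · exact hm
    · filter_upwards [hs j hj] with x hx
      exact hx.comp hms.tendsto_atTop

/-- Truncation sets on which finitely many measurable functions are bounded. -/
lemma exists_truncation {ι : Type*} [Fintype ι] {F : Rd d → ι → ℂ}
    (hF : ∀ i, AEMeasurable (fun x => F x i) volume) :
    ∃ G : ℕ → Set (Rd d), (∀ n, MeasurableSet (G n)) ∧ (∀ n, G n ⊆ originBox d n) ∧
      (∀ n i, ∀ᵐ x, x ∈ G n → ‖F x i‖ ≤ n) ∧ ∀ x, ∀ᶠ n in atTop, x ∈ G n := by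
  have hφ : AEMeasurable (fun x => ∑ i, ‖F x i‖) volume :=
    Finset.aemeasurable_fun_sum _ fun i _ => (hF i).norm
  refine ⟨fun n => {x | hφ.mk _ x ≤ n} ∩ originBox d n, fun n =>
    (measurableSet_le hφ.measurable_mk measurable_const).inter (measurableSet_originBox n),
    fun n => Set.inter_subset_right, fun n i => ?_, fun x => ?_⟩
  · filter_upwards [hφ.ae_eq_mk] with x hx hxG
    have h1 : hφ.mk _ x ≤ n := hxG.1
    rw [← hx] at h1
    exact (Finset.single_le_sum (f := fun i => ‖F x i‖) (fun j _ => norm_nonneg _)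
      (Finset.mem_univ i)).trans h1
  · filter_upwards [eventually_mem_originBox x, eventually_ge_atTop ⌈hφ.mk _ x⌉₊] with n h1 h2
    exact ⟨Nat.ceil_le.1 h2, h1⟩

/-- The bilinear `L^p × L^{p'}` estimate for values of the extension of `T` to `L¹`. -/
theorem exists_bilinear_bound_of_isValue (hd : 0 < d) (ι : Type*) [Fintype ι] {T : LTwoOp d}
    {K : Rd d → Rd d → ℂ} {c δ : ℝ} (hK : IsStandardKernel K c δ) (hT : HasKernel T K)
    {p q : ℝ} (hpq : p.HolderConjugate q) {C D : ℝ≥0 → ℝ≥0}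
    (hC : MemB (conj C) q) (hD : MemB (conj D) p) :
    ∃ A : ℝ≥0, ∀ F V : Rd d → ι → ℂ, (∀ i, Integrable (fun x => F x i) volume) →
      (∀ i, IsValue T (fun x => F x i) (fun x => V x i)) →
      ∀ w : Rd d → ι → ℂ, (∀ i, AEMeasurable (fun x => w x i) volume) →
      ∀ (N : Rd d → Rd d → ℝ≥0∞) (κ : ℝ≥0∞), HasMixedBound C D N κ → κ ≠ ⊤ →
      ∀ g h : Rd d → ℝ≥0∞, Measurable g → Measurable h → (∀ x, g x ≠ ⊤) → (∀ x, h x ≠ ⊤) →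
      (∀ᵐ y, ∀ x, ‖dotProduct (w x) (F y)‖ₑ ≤ N x y * h y) →
      ∫⁻ x, h x ^ p ≠ ⊤ → ∫⁻ x, g x ^ q ≠ ⊤ →
        ∫⁻ x, ‖dotProduct (w x) (V x)‖ₑ * g x ≤
          A * κ * ((∫⁻ x, h x ^ p) ^ (1 / p) * (∫⁻ x, g x ^ q) ^ (1 / q)) := by
  obtain ⟨Cw, hCw⟩ := hT.hasWeakType hd hK
  obtain ⟨A, hA⟩ := exists_bilinear_bound hd ι hK hT hpq hC hD
  -- One estimate for each of the 2^d corner cubes that make up the box.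
  refine ⟨2 ^ d * A, ?_⟩
  intro F V hF hV w hw N κ hN hκ g h hg hh hgt hht hle hhI hgI
  obtain ⟨G, hGm, hGb, hGn, hGe⟩ := exists_truncation fun i => (hF i).aestronglyMeasurable.aemeasurable
  set Fn : ℕ → Rd d → ι → ℂ := fun n => (G n).indicator F with hFn
  have hFni : ∀ n i, (fun x => Fn n x i) = (G n).indicator fun x => F x i := by
    intro n i; ext1 x; by_cases hx : x ∈ G n <;> simp [hFn, hx]
  have hmem : ∀ n i, MemLp (fun x => Fn n x i) 2 volume := by
    intro n i
    rw [hFni, memLp_indicator_iff_restrict (hGm n)]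
    have : IsFiniteMeasure (volume.restrict (G n)) := ⟨by
      rw [Measure.restrict_apply_univ]
      exact (measure_mono (hGb n)).trans_lt (volume_originBox_ne_top n).lt_top⟩
    refine MemLp.of_bound (hF i).aestronglyMeasurable.restrict n ?_
    rw [ae_restrict_iff' (hGm n)]
    exact hGn n i
  have hlim : ∀ i, Tendsto (fun n => ∫⁻ x, ‖Fn n x i - F x i‖ₑ) atTop (𝓝 0) := by
    intro i
    have := tendsto_lintegral_of_dominated_convergence'
      (F := fun n x => ‖Fn n x i - F x i‖ₑ) (f := fun _ => 0) (fun x => ‖F x i‖ₑ)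
      (fun n => ((hmem n i).1.sub (hF i).1).enorm)
      (fun n => Eventually.of_forall fun x => by
        by_cases hx : x ∈ G n <;> simp [hFn, hx])
      (hF i).2.ne
      (Eventually.of_forall fun x => by
        refine tendsto_const_nhds.congr' ?_
        filter_upwards [hGe x] with n hn
        simp [hFn, hn])
    simpa using this
  obtain ⟨ns, hns, hae⟩ := exists_seq_tendsto_ae_of_forall fun i =>
    (hV i).tendstoInMeasure hCw (fun n => hmem n i) (hlim i) (hF i).aestronglyMeasurable
  set φ : ℕ → Rd d → ℝ≥0∞ := fun n x =>
    ‖dotProduct (w x) (fun i => opFun T (fun y => Fn n y i) x)‖ₑ * g x with hφ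
  have hφm : ∀ n, AEMeasurable (φ n) volume := fun n => by
    refine (AEMeasurable.enorm ?_).mul hg.aemeasurable
    exact Finset.aemeasurable_fun_sum _ fun i _ => (hw i).mul (memLp_opFun T).1.aemeasurable
  have hbound : ∀ n, ∫⁻ x in originBox d n, φ n x ≤ 2 ^ d *
      (A * κ * ((∫⁻ x, h x ^ p) ^ (1 / p) * (∫⁻ x, g x ^ q) ^ (1 / q))) := by
    intro n
    refine setLIntegral_originBox_le fun b => ?_
    have hle' : ∀ᵐ y, ∀ x, ‖dotProduct (w x) (Fn n y)‖ₑ ≤ N x y * h y := by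
      filter_upwards [hle] with y hy x
      by_cases hyG : y ∈ G n
      · simpa [hFn, hyG] using hy x
      · simp [hFn, hyG]
    -- The truncated function vanishes off the box, hence off the triple of each corner cube, so the
    -- cut-off inside `opVec` changes nothing.
    have hind : opVec T (Fn n) (tripleCube n (cornerIdx b)) =
        fun x i => opFun T (fun y => Fn n y i) x := by
      ext x i
      rw [opVec, Set.indicator_eq_self.2]
      rw [hFni]
      exact Set.support_indicator_subset.trans
        ((hGb n).trans (originBox_subset_tripleCube n b))
    have := hA (Fn n) (hmem n) w hw N κ hN hκ g h hg hh hgt hht hle' hhI hgI n (cornerIdx b)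
    rwa [hind] at this
  calc ∫⁻ x, ‖dotProduct (w x) (V x)‖ₑ * g x
      ≤ ∫⁻ x, liminf (fun n => (originBox d (ns n)).indicator (φ (ns n)) x) atTop := by
        refine lintegral_mono_ae ?_
        filter_upwards [hae] with x hx
        refine (Tendsto.liminf_eq ?_).ge
        have h1 : Tendsto (fun n => dotProduct (w x) fun i => opFun T (fun y => Fn (ns n) y i) x)
            atTop (𝓝 (dotProduct (w x) (V x))) :=
          tendsto_finsetSum _ fun i _ => (hx i).const_mul _
        have h2 : Tendsto (fun n => φ (ns n) x) atTop (𝓝 (‖dotProduct (w x) (V x)‖ₑ * g x)) :=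
          ENNReal.Tendsto.mul_const h1.enorm (Or.inr (hgt x))
        refine h2.congr' ?_
        filter_upwards [hns.tendsto_atTop.eventually (eventually_mem_originBox x)] with n hn
        rw [Set.indicator_of_mem hn]
    _ ≤ liminf (fun n => ∫⁻ x, (originBox d (ns n)).indicator (φ (ns n)) x) atTop :=
        lintegral_liminf_le' fun n => (hφm _).indicator (measurableSet_originBox _)
    _ ≤ 2 ^ d * (A * κ * ((∫⁻ x, h x ^ p) ^ (1 / p) * (∫⁻ x, g x ^ q) ^ (1 / q))) := by
        refine (liminf_le_liminf (Eventually.of_forall fun n => ?_)).trans (liminf_const _).le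
        rw [lintegral_indicator (measurableSet_originBox _)]
        exact hbound _
    _ = _ := by push_cast; ring

end limits

/-! ### The commutator as a vector-valued form -/

section commutator

variable {d m : ℕ}

lemma act_sub_left (A B : Mat m) (v : Cm m) : act (A - B) v = act A v - act B v := by
  simp [act]

/-- The rows of `(V^{1/p} B, -V^{1/p})`. -/
def commRow (p : ℝ) (V B : Rd d → Mat m) (i : Fin m) (x : Rd d) : Fin m ⊕ Fin m → ℂ :=
  Sum.elim (fun j => (mpow (V x) (1 / p) * B x) i j) (fun j => -mpow (V x) (1 / p) i j)

/-- Used twice: with u = f(y), v = B(y)f(y) it produces the oscillation kernel, and with the values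
of T on f and on Bf it produces the weighted commutator. -/
lemma dotProduct_commRow (p : ℝ) (V B : Rd d → Mat m) (i : Fin m) (x : Rd d) (u v : Cm m) :
    dotProduct (commRow p V B i x) (Sum.elim (fun j => u j) fun j => v j) =
      act (mpow (V x) (1 / p)) (act (B x) u - v) i := by
  rw [map_sub, ← act_mul, PiLp.sub_apply, act_apply, act_apply, dotProduct,
    Fintype.sum_sum_type, sub_eq_add_neg, ← Finset.sum_neg_distrib]
  simp [commRow]

lemma aemeasurable_commRow {p : ℝ} {V B : Rd d → Mat m} (hV : IsMatrixWeight V)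
    (hB : ∀ i j, AEMeasurable (fun x => B x i j) volume) (i : Fin m) (j : Fin m ⊕ Fin m) :
    AEMeasurable (fun x => commRow p V B i x j) volume := by
  rcases j with j | j
  · simp only [commRow, Sum.elim_inl, Matrix.mul_apply]
    exact Finset.aemeasurable_fun_sum _ fun l _ => (hV.aemeasurable_mpow _ i l).mul (hB l j)
  · simp only [commRow, Sum.elim_inr]
    exact (hV.aemeasurable_mpow _ i j).neg

/-- The difference B(x) - B(y) appears because both components of F are evaluated at y while the row
is evaluated at x; inserting U^{-1/p}(y)U^{1/p}(y) gives the operator norm in the bump condition. -/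
lemma ae_enorm_dotProduct_commRow_le {p : ℝ} {U V B : Rd d → Mat m} (hU : IsMatrixWeight U)
    (f : Rd d → Cm m) (i : Fin m) :
    ∀ᵐ y ∂(volume : Measure (Rd d)), ∀ x,
      ‖dotProduct (commRow p V B i x) (Sum.elim (fun j => f y j) fun j => mul B f y j)‖ₑ ≤
        oscKernel p U V B x y * ‖weighted p U f y‖ₑ := by
  filter_upwards [hU.ae_act_mpow_neg (1 / p)] with y hy x
  have h1 : act (mpow (V x) (1 / p)) (act (B x) (f y) - act (B y) (f y)) =
      act (mpow (V x) (1 / p) * (B x - B y) * mpow (U y) (-(1 / p))) (weighted p U f y) := by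
    rw [act_mul, weighted, hy, act_mul, act_sub_left]
  rw [dotProduct_commRow, mul, h1, oscKernel]
  refine le_trans ?_ (ContinuousLinearMap.le_opENorm _ _)
  rw [← ofReal_norm, ← ofReal_norm]
  exact ENNReal.ofReal_le_ofReal (PiLp.norm_apply_le _ i)

lemma norm_le_sum_norm_coord (v : Cm m) : ‖v‖ ≤ ∑ i, ‖v i‖ := by
  have : v = ∑ i, v i • EuclideanSpace.single i (1 : ℂ) := by
    ext j
    simp [Pi.single_apply]
  conv_lhs => rw [this]
  refine (norm_sum_le _ _).trans (Finset.sum_le_sum fun i _ => ?_)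
  simp [norm_smul]

lemma IsValue.aemeasurable {T : LTwoOp d} {f g : Rd d → ℂ} (h : IsValue T f g) :
    AEMeasurable g volume := by
  obtain ⟨φ, -, -, hφ⟩ := h
  exact hφ.aemeasurable fun n => (Lp.aestronglyMeasurable _).aemeasurable

/-- The commutator estimate under a finite bump condition. -/
theorem exists_wNorm_commutator_bound (hd : 0 < d) (m : ℕ) {T : LTwoOp d}
    {K : Rd d → Rd d → ℂ} {c δ : ℝ} (hK : IsStandardKernel K c δ) (hT : HasKernel T K)
    {p q : ℝ} (hpq : p.HolderConjugate q) {C D : ℝ≥0 → ℝ≥0}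
    (hC : MemB (conj C) q) (hD : MemB (conj D) p) :
    ∃ A : ℝ≥0, ∀ U V B : Rd d → Mat m, IsMatrixWeight U → IsMatrixWeight V →
      (∀ i j, AEMeasurable (fun x => B x i j) volume) →
      ∀ κ : ℝ≥0∞, HasMixedBound C D (oscKernel p U V B) κ → κ ≠ ⊤ →
      ∀ f ∈ commDomain p U B, ∀ h, IsCommutatorValue T B f h →
        wNorm p V h ≤ A * κ * wNorm p U f := by
  obtain ⟨A, hA⟩ := exists_bilinear_bound_of_isValue hd (Fin m ⊕ Fin m) hK hT hpq hC hD
  have hp0 := hpq.pos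
  have hpE : ENNReal.ofReal p ≠ 0 := by simpa using hp0
  -- The norm of a vector is estimated by the sum of its m coordinates, each treated by its own row.
  refine ⟨m * A, ?_⟩
  rintro U V B hU hV hB κ hN hκ f ⟨hfU, hf1, hf2⟩ h ⟨u, v, hu, hv, hh⟩
  set F : Rd d → Fin m ⊕ Fin m → ℂ := fun y =>
    Sum.elim (fun j => f y j) fun j => mul B f y j with hFdef
  set Val : Rd d → Fin m ⊕ Fin m → ℂ := fun y =>
    Sum.elim (fun j => u y j) fun j => v y j with hVal
  have hFint : ∀ j, Integrable (fun x => F x j) volume := by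
    rintro (j | j)
    · exact integrable_coord hf1 j
    · exact integrable_coord hf2 j
  have hFval : ∀ j, IsValue T (fun x => F x j) (fun x => Val x j) := by
    rintro (j | j)
    · exact hu j
    · exact hv j
  have hfm := hfU.1
  set hh' : Rd d → ℝ≥0∞ := fun y => ‖hfm.mk _ y‖ₑ with hhdef
  have hhm : Measurable hh' := hfm.stronglyMeasurable_mk.enorm
  have hhint : ∫⁻ x, hh' x ^ p = ∫⁻ x, ‖weighted p U f x‖ₑ ^ p := by
    refine lintegral_congr_ae ?_
    filter_upwards [hfm.ae_eq_mk] with x hx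
    rw [hhdef]; simp only; rw [← hx]
  have hwU : wNorm p U f = (∫⁻ x, hh' x ^ p) ^ (1 / p) := by
    rw [hhint, wNorm, eLpNorm_eq_lintegral_rpow_enorm_toReal hpE ENNReal.ofReal_ne_top,
      ENNReal.toReal_ofReal hp0.le]
  have hhfin : ∫⁻ x, hh' x ^ p ≠ ⊤ := by
    have := (eLpNorm_lt_top_iff_lintegral_rpow_enorm_lt_top hpE ENNReal.ofReal_ne_top).1 hfU.2
    rw [ENNReal.toReal_ofReal hp0.le] at this
    rw [hhint]
    exact this.ne
  have hrow : ∀ i, eLpNorm (fun x => dotProduct (commRow p V B i x) (Val x)) (ENNReal.ofReal p)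
      volume ≤ A * κ * wNorm p U f := by
    intro i
    have hΦm : AEMeasurable (fun x => dotProduct (commRow p V B i x) (Val x)) volume :=
      Finset.aemeasurable_fun_sum _ fun j _ =>
        (aemeasurable_commRow hV hB i j).mul (hFval j).aemeasurable
    rw [eLpNorm_eq_lintegral_rpow_enorm_toReal hpE ENNReal.ofReal_ne_top,
      ENNReal.toReal_ofReal hp0.le, hwU]
    refine lintegral_rpow_le_of_dual hpq hΦm.enorm fun g hg hgt hgI => ?_
    rw [mul_assoc]
    refine hA F Val hFint hFval _ (aemeasurable_commRow hV hB i) _ κ hN hκ g hh' hg hhm hgt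
      (fun x => enorm_ne_top) ?_ hhfin hgI
    filter_upwards [ae_enorm_dotProduct_commRow_le (p := p) (V := V) (B := B) hU f i,
      hfm.ae_eq_mk] with y hy hy' x
    rw [hhdef]; simp only; rw [← hy']
    exact hy x
  have hle : ∀ᵐ x ∂(volume : Measure (Rd d)), ‖weighted p V h x‖ ≤
      ‖∑ i, ‖dotProduct (commRow p V B i x) (Val x)‖‖ := by
    filter_upwards [hh] with x hx
    have h1 : ∀ i, dotProduct (commRow p V B i x) (Val x) = weighted p V h x i := fun i => by
      rw [hVal, dotProduct_commRow, weighted, hx, mul]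
    simp only [h1]
    rw [Real.norm_of_nonneg (Finset.sum_nonneg fun i _ => norm_nonneg _)]
    exact norm_le_sum_norm_coord _
  have hmeas : ∀ i, AEStronglyMeasurable
      (fun x => ‖dotProduct (commRow p V B i x) (Val x)‖) volume := fun i =>
    (Finset.aemeasurable_fun_sum _ fun j _ =>
      (aemeasurable_commRow hV hB i j).mul (hFval j).aemeasurable).norm.aestronglyMeasurable
  calc wNorm p V h ≤ eLpNorm (∑ i, fun x => ‖dotProduct (commRow p V B i x) (Val x)‖)
        (ENNReal.ofReal p) volume := by
        refine eLpNorm_mono_ae ?_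
        filter_upwards [hle] with x hx
        simpa using hx
    _ ≤ ∑ i, eLpNorm (fun x => ‖dotProduct (commRow p V B i x) (Val x)‖)
        (ENNReal.ofReal p) volume :=
        eLpNorm_sum_le (fun i _ => hmeas i) (by simpa using hpq.lt.le)
    _ ≤ ∑ _i : Fin m, A * κ * wNorm p U f := by
        refine Finset.sum_le_sum fun i _ => ?_
        rw [eLpNorm_norm]
        exact hrow i
    _ = _ := by simp; ring

lemma ae_eq_zero_of_wNorm_eq_zero {p : ℝ} (hp : 0 < p) {U : Rd d → Mat m} (hU : IsMatrixWeight U)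
    {f : Rd d → Cm m} (hf : AEStronglyMeasurable (weighted p U f) volume) (h0 : wNorm p U f = 0) :
    f =ᵐ[volume] 0 := by
  have h1 := (eLpNorm_eq_zero_iff hf (by simpa using hp)).1 h0
  filter_upwards [h1, hU.ae_act_mpow_neg (1 / p)] with x hx hy
  rw [← hy (f x)]
  change act _ (weighted p U f x) = 0
  rw [hx, Pi.zero_apply, map_zero]

lemma IsValue.ae_eq_zero {T : LTwoOp d} {C : ℝ≥0} (hT : HasWeakType T C) {f g : Rd d → ℂ}
    (hf : f =ᵐ[volume] 0) (h : IsValue T f g) : g =ᵐ[volume] 0 := by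
  refine h.ae_eq hT ((aestronglyMeasurable_zero (β := ℂ)).congr hf.symm) ⟨fun _ => 0, ?_, ?_, ?_⟩
  · intro n
    exact (integrable_zero _ _ _).congr (Lp.coeFn_zero ..).symm
  · refine tendsto_const_nhds.congr fun n => ?_
    rw [eLpNorm_congr_ae (g := 0), eLpNorm_zero]
    filter_upwards [hf, Lp.coeFn_zero ℂ 2 (volume : Measure (Rd d))] with x h1 h2
    rw [h1, h2]; simp
  · refine TendstoInMeasure.congr' (f := fun _ => 0) (g := 0) ?_ .rfl ?_
    · refine Eventually.of_forall fun n => ?_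
      simp only [map_zero]
      exact (Lp.coeFn_zero ..).symm
    · intro ε hε
      simp [hε.ne']

/-- For the degenerate case of an infinite bump constant and ‖f‖ = 0, where the product ∞ · 0 is 0:
then f = 0 almost everywhere, so Tf, T(Bf) and the commutator vanish too. -/
lemma wNorm_commutator_eq_zero {T : LTwoOp d} {C : ℝ≥0} (hT : HasWeakType T C) {p : ℝ}
    (hp : 0 < p) {U V B : Rd d → Mat m} (hU : IsMatrixWeight U) {f h : Rd d → Cm m}
    (hf : f ∈ commDomain p U B) (hh : IsCommutatorValue T B f h) (h0 : wNorm p U f = 0) :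
    wNorm p V h = 0 := by
  have hf0 := ae_eq_zero_of_wNorm_eq_zero hp hU hf.1.1 h0
  obtain ⟨u, v, hu, hv, huv⟩ := hh
  have hu0 := ae_all_iff.2 fun i => (hu i).ae_eq_zero hT (by
    filter_upwards [hf0] with x hx; rw [hx]; rfl)
  have hv0 := ae_all_iff.2 fun i => (hv i).ae_eq_zero hT (by
    filter_upwards [hf0] with x hx; rw [mul, hx, Pi.zero_apply, map_zero]; rfl)
  rw [wNorm, eLpNorm_congr_ae (g := 0), eLpNorm_zero]
  filter_upwards [huv, hu0, hv0] with x h1 h2 h3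
  have h2' : u x = 0 := by ext i; exact h2 i
  have h3' : v x = 0 := by ext i; exact h3 i
  rw [weighted, h1, mul, h2', h3']
  simp

lemma hasMixedBound_kappa₁ (p : ℝ) (C D : ℝ≥0 → ℝ≥0) (U V B : Rd d → Mat m) :
    HasMixedBound C D (oscKernel p U V B) (kappa₁ p C D U V B) :=
  Or.inl fun a l hl => le_iSup₂_of_le a l (le_iSup_of_le hl le_rfl)

lemma hasMixedBound_kappa₂ (p : ℝ) (C D : ℝ≥0 → ℝ≥0) (U V B : Rd d → Mat m) :
    HasMixedBound C D (oscKernel p U V B) (kappa₂ p C D U V B) :=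
  Or.inr fun a l hl => le_iSup₂_of_le a l (le_iSup_of_le hl le_rfl)

end commutator

end OrliczCommutator

end

/-! ### The main theorem -/

theorem proposition1p6 {d m : ℕ} (hd : 0 < d) (p : ℝ) (hp : 1 < p)
    (T : Lp ℂ 2 (volume : Measure (OrliczCommutator.Rd d)) →L[ℂ]
      Lp ℂ 2 (volume : Measure (OrliczCommutator.Rd d)))
    (hT : OrliczCommutator.IsCZO T)
    (C D : ℝ≥0 → ℝ≥0) (hC : OrliczCommutator.IsYoung C) (hD : OrliczCommutator.IsYoung D)
    (hCbar : OrliczCommutator.MemB (OrliczCommutator.conj C) (p / (p - 1)))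
    (hDbar : OrliczCommutator.MemB (OrliczCommutator.conj D) p) :
    ∃ K : ℝ≥0, ∀ U V B : OrliczCommutator.Rd d → OrliczCommutator.Mat m,
      OrliczCommutator.IsMatrixWeight U → OrliczCommutator.IsMatrixWeight V →
      (∀ i j, LocallyIntegrable (fun x => B x i j) volume) →
      -- the initial domain is dense in `L^p(U)`
      (∀ f, MemLp (OrliczCommutator.weighted p U f) (ENNReal.ofReal p) volume →
        ∀ ε : ℝ≥0∞, 0 < ε → ∃ f₀ ∈ OrliczCommutator.commDomain p U B,
          OrliczCommutator.wNorm p U (f - f₀) < ε) ∧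
      -- on it the commutator is well defined
      (∀ f ∈ OrliczCommutator.commDomain p U B,
        ∃ h, OrliczCommutator.IsCommutatorValue T B f h ∧
          ∀ h', OrliczCommutator.IsCommutatorValue T B f h' → h' =ᵐ[volume] h) ∧
      OrliczCommutator.commNorm p T U V B ≤
        K * min (OrliczCommutator.kappa₁ p C D U V B) (OrliczCommutator.kappa₂ p C D U V B) := by
  obtain ⟨k, c, δ, hk, hTk⟩ := hT.exists_kernel
  obtain ⟨Cw, hCw⟩ := hTk.hasWeakType hd hk
  have hpq : p.HolderConjugate (p / (p - 1)) := Real.HolderConjugate.conjExponent hp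
  obtain ⟨A, hA⟩ :=
    OrliczCommutator.exists_wNorm_commutator_bound hd m hk hTk hpq hCbar hDbar
  -- The constant must be nonzero, so that an infinite bump constant gives an infinite right-hand
  -- side whenever ‖f‖ is not zero.
  refine ⟨A + 1, fun U V B hU hV hB => ?_⟩
  have hBm : ∀ i j, AEMeasurable (fun x => B x i j) volume := fun i j =>
    (hB i j).aestronglyMeasurable.aemeasurable
  refine ⟨fun f hf ε hε =>
      OrliczCommutator.exists_commDomain_wNorm_sub_lt (zero_lt_one.trans hp) hU hBm hf hε,
    fun f hf => OrliczCommutator.exists_unique_isCommutatorValue hCw hf, sInf_le ?_⟩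
  intro f hf h hh
  have key : ∀ κ : ℝ≥0∞, OrliczCommutator.HasMixedBound C D
      (OrliczCommutator.oscKernel p U V B) κ →
      OrliczCommutator.wNorm p V h ≤ ((A + 1 : ℝ≥0) : ℝ≥0∞) * κ * OrliczCommutator.wNorm p U f := by
    intro κ hκ
    by_cases h0 : OrliczCommutator.wNorm p U f = 0
    · rw [OrliczCommutator.wNorm_commutator_eq_zero hCw (zero_lt_one.trans hp) hU hf hh h0]
      exact zero_le
    by_cases hκt : κ = ⊤
    · rw [hκt, ENNReal.mul_top (by positivity), ENNReal.top_mul h0]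
      exact le_top
    · refine (hA U V B hU hV hBm κ hκ hκt f hf h hh).trans ?_
      gcongr
      exact le_self_add
  rcases le_total (OrliczCommutator.kappa₁ p C D U V B) (OrliczCommutator.kappa₂ p C D U V B)
    with hle | hle
  · rw [min_eq_left hle]
    exact key _ (OrliczCommutator.hasMixedBound_kappa₁ p C D U V B)
  · rw [min_eq_right hle]
    exact key _ (OrliczCommutator.hasMixedBound_kappa₂ p C D U V B)
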